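/- Let $\widehat{\mathcal A}$ be the Weyl algebra: the associative unital $\mathbb C$-algebra with generators $a(k), a^*(k)$ ($k\in\mathbb Z$) and relations $[a(k),a^*(m)]=\delta_{k+m,0}$, $[a(k),a(m)]=[a^*(k),a^*(m)]=0$. Let $M$ be the $\widehat{\mathcal A}$-module generated by a vector $\mathbf 1$ subject to $a(k)\mathbf 1=a^*(k+1)\mathbf 1=0$ for $k\ge 0$. There is a unique vertex algebra structure $(M,Y,\mathbf 1)$ with $$Y(a(-1)\mathbf 1,z)=\sum_{k\in\mathbb Z}a(k)z^{-k-1},\qquad Y(a^*(0)\mathbf 1,z)=\sum_{k\in\mathbb Z}a^*(k)z^{-k};$$ it is called the Weyl vertex algebra, and it is equipped with the conformal vector $\omega=\tfrac12\big(a(-1)a^*(-1)-a(-2)a^*(0)\big)\mathbf 1$. For $p\ge 1$ put $\zeta_p=e^{2\pi i/p}$, and let $g_p$ be the linear automorphism of $M$ induced by the automorphism $a(k)\mapsto\zeta_p a(k)$, $a^*(k)\mapsto\zeta_p^{-1}a^*(k)$ ($k\in\mathbb Z$) of $\widehat{\mathcal A}$. It is an automorphism of $(M,Y,\mathbf 1,\omega)$,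 that is, $g_p(u_kv)=g_p(u)_kg_p(v)$ for all $u,v\in M$, $k\in\mathbb Z$, and $g_p(\omega)=\omega$; let $M^{\langle g_p\rangle}=\{v\in M : g(v)=v\text{ for all }g\in\langle g_p\rangle\}$ be the orbifold vertex subalgebra. For $n\ge 0$, $\boldsymbol\lambda=(\lambda_0,\dots,\lambda_n)\in\mathbb C^{n+1}$ and $\boldsymbol\mu=(\mu_1,\dots,\mu_n)\in\mathbb C^n$, let $M_1(\boldsymbol\lambda,\boldsymbol\mu)=\widehat{\mathcal A}/I$, where $I$ is the left ideal generated by $a(i)-\lambda_i$ ($0\le i\le n$), $a^*(j)-\mu_j$ ($1\le j\le n$), and $a(k),a^*(k)$ ($k>n$). It carries a unique structure of weak $M$-module in which $a(-1)\mathbf 1$ and $a^*(0)\mathbf 1$ act by the fields $\sum_k a(k)z^{-k-1}$ and $\sum_k a^*(k)z^{-k}$. **Theorem.** If $\Lambda=(\boldsymbol\lambda,\boldsymbol\mu)\neq 0$, then for every $p\ge 1$ the module $M_1(\boldsymbol\lambda,\boldsymbol\mu)$, restricted to $M^{\langle g_p\rangle}$, is an irreducible weak $M^{\langle g_p\rangle}$-module: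 it is nonzero, and its only subspaces stable under all modes $v_k$ ($v\in M^{\langle g_p\rangle}$, $k\in\mathbb Z$) are $0$ and $M_1(\boldsymbol\lambda,\boldsymbol\mu)$. -/

import Mathlib

/-! ### Vertex algebras, weak modules, automorphisms and orbifolds -/

/-- The Jacobi identity for a family of modes `Y u n = u_n` on `V` and `YW u n = u_n` on `W`.
It is the equality of the coefficients of `z₀^(-l-1) z₁^(-m-1) z₂^(-n-1)`, applied to `w`, for all
`l, m, n`, in
`z₀⁻¹ δ((z₁-z₂)/z₀) YW(u,z₁) YW(v,z₂) - z₀⁻¹ δ((z₂-z₁)/(-z₀)) YW(v,z₂) YW(u,z₁)`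
`  = z₂⁻¹ δ((z₁-z₀)/z₂) YW(Y(u,z₀)v,z₂)`,
where `(x-y)^k` is expanded in nonnegative powers of `y`. The sums are finite for modes that satisfy
the truncation condition, which is part of the structures below. -/
def JacobiIdentity {V W : Type*} [AddCommGroup V] [Module ℂ V] [AddCommGroup W] [Module ℂ W]
    (Y : V →ₗ[ℂ] (ℤ → Module.End ℂ V)) (YW : V →ₗ[ℂ] (ℤ → Module.End ℂ W)) : Prop :=
  ∀ (u v : V) (w : W) (l m n : ℤ),
    (∑ᶠ i : ℕ, ((-1 : ℤ) ^ i * Ring.choose l i) •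
        (YW u (m + l - i) (YW v (n + i) w)
          - (Int.negOnePow l : ℤ) • YW v (n + l - i) (YW u (m + i) w)))
      = ∑ᶠ i : ℕ, (Ring.choose m i : ℤ) • YW (Y u (l + i) v) (m + n - i) w

/-- A vertex algebra structure on the complex vector space `V`: the vacuum and the modes
`Y u n = u_n`, where `Y(u,z) = ∑ u_n z^(-n-1)`. -/
@[ext]
structure VertexAlgebra (V : Type*) [AddCommGroup V] [Module ℂ V] where
  /-- the vacuum vector -/
  vac : V
  /-- the modes `Y u n = u_n` -/
  Y : V →ₗ[ℂ] (ℤ → Module.End ℂ V)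
  truncation : ∀ u v : V, ∃ N : ℤ, ∀ n : ℤ, N ≤ n → Y u n v = 0
  vacuum : ∀ n : ℤ, Y vac n = if n = -1 then 1 else 0
  creation_regular : ∀ (v : V) (n : ℤ), 0 ≤ n → Y v n vac = 0
  creation : ∀ v : V, Y v (-1) vac = v
  jacobi : JacobiIdentity Y Y

namespace VertexAlgebra

section General

variable {V : Type*} [AddCommGroup V] [Module ℂ V]

/-- A weak module structure on the complex vector space `W` for the vertex algebra `A`. -/
@[ext]
structure WeakModule (A : VertexAlgebra V) (W : Type*) [AddCommGroup W] [Module ℂ W] where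
  /-- the modes `Y u n = u_n` on `W` -/
  Y : V →ₗ[ℂ] (ℤ → Module.End ℂ W)
  truncation : ∀ (u : V) (w : W), ∃ N : ℤ, ∀ n : ℤ, N ≤ n → Y u n w = 0
  vacuum : ∀ n : ℤ, Y A.vac n = if n = -1 then 1 else 0
  jacobi : JacobiIdentity A.Y Y

/-- A weak module is irreducible if it is nonzero and its only subspaces that are stable under all
modes are `0` and the whole space. -/
def WeakModule.IsIrreducible {A : VertexAlgebra V} {W : Type*} [AddCommGroup W] [Module ℂ W]
    (N : A.WeakModule W) : Prop :=
  Nontrivial W ∧ ∀ U : Submodule ℂ W,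
    (∀ (u : V) (n : ℤ), ∀ w ∈ U, N.Y u n w ∈ U) → U = ⊥ ∨ U = ⊤

/-- A vertex subalgebra: a subspace that contains the vacuum and is closed under all `n`-th
products. -/
structure VertexSubalgebra (A : VertexAlgebra V) extends Submodule ℂ V where
  vac_mem : A.vac ∈ toSubmodule
  mode_mem : ∀ u ∈ toSubmodule, ∀ v ∈ toSubmodule, ∀ n : ℤ, A.Y u n v ∈ toSubmodule

/-- A vertex subalgebra is a vertex algebra. -/
def VertexSubalgebra.toVertexAlgebra {A : VertexAlgebra V} (B : A.VertexSubalgebra) :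
    VertexAlgebra B.toSubmodule where
  vac := ⟨A.vac, B.vac_mem⟩
  Y :=
    { toFun := fun u n => (A.Y u n).restrict fun v hv => B.mode_mem u u.2 v hv n
      map_add' := fun u v => by
        funext n; ext w; simp
      map_smul' := fun c u => by
        funext n; ext w; simp }
  truncation := fun u v => by
    obtain ⟨N, hN⟩ := A.truncation u v
    exact ⟨N, fun n hn => Subtype.ext (by simpa using hN n hn)⟩
  vacuum := fun n => by
    ext w
    have h := A.vacuum n
    by_cases hn : n = -1
    · subst hn
      simpa using congrArg (fun f : Module.End ℂ V => f w) h
    · rw [if_neg hn] at h ⊢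
      simpa using congrArg (fun f : Module.End ℂ V => f w) h
  creation_regular := fun v n hn => Subtype.ext (by simpa using A.creation_regular v n hn)
  creation := fun v => Subtype.ext (by simpa using A.creation v)
  jacobi := fun u v w l m n => by
    have key : ∀ f : ℕ → B.toSubmodule,
        ((∑ᶠ i, f i : B.toSubmodule) : V) = ∑ᶠ i, (f i : V) := fun f =>
      B.toSubmodule.subtype.toAddMonoidHom.map_finsum_of_injective
        (by exact Subtype.val_injective) f
    apply Subtype.ext
    rw [key, key]
    simpa using A.jacobi u v w l m n

/-- The restriction of a weak module to a vertex subalgebra. -/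
def WeakModule.restrict {A : VertexAlgebra V} {W : Type*} [AddCommGroup W] [Module ℂ W]
    (N : A.WeakModule W) (B : A.VertexSubalgebra) : B.toVertexAlgebra.WeakModule W where
  Y := N.Y ∘ₗ B.toSubmodule.subtype
  truncation := fun u w => N.truncation u w
  vacuum := fun n => N.vacuum n
  jacobi := fun u v w l m n => N.jacobi u v w l m n

/-- The group of automorphisms of the vertex algebra `A` with conformal vector `ω`: the linear
automorphisms `g` with `g (u_n v) = (g u)_n (g v)` and `g ω = ω`. -/
def aut (A : VertexAlgebra V) (ω : V) : Subgroup (V ≃ₗ[ℂ] V) where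
  carrier := {g | (∀ (u v : V) (n : ℤ), g (A.Y u n v) = A.Y (g u) n (g v)) ∧ g ω = ω}
  one_mem' := ⟨fun _ _ _ => rfl, rfl⟩
  mul_mem' := fun {g h} hg hh =>
    ⟨fun u v n => by simp only [LinearEquiv.mul_apply, hh.1, hg.1],
      by simp only [LinearEquiv.mul_apply, hh.2, hg.2]⟩
  inv_mem' := fun {g} hg =>
    ⟨fun u v n => by
        apply g.injective
        rw [hg.1]
        simp only [← LinearEquiv.mul_apply, mul_inv_cancel, LinearEquiv.coe_one, id_eq],
      by
        apply g.injective
        rw [hg.2]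
        simp only [← LinearEquiv.mul_apply, mul_inv_cancel, LinearEquiv.coe_one, id_eq]⟩

/-- Automorphisms fix the vacuum. -/
theorem aut_apply_vac (A : VertexAlgebra V) (ω : V) {g : V ≃ₗ[ℂ] V} (hg : g ∈ A.aut ω) :
    g A.vac = A.vac := by
  have h := hg.1 A.vac (g.symm A.vac) (-1)
  rw [A.vacuum, if_pos rfl, Module.End.one_apply, LinearEquiv.apply_symm_apply, A.creation] at h
  exact h.symm

/-- The orbifold `V^G = {v | g v = v for all g ∈ G}` for a group `G` of automorphisms. -/
def orbifold (A : VertexAlgebra V) (ω : V) (G : Subgroup (V ≃ₗ[ℂ] V)) (hG : G ≤ A.aut ω) :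
    A.VertexSubalgebra where
  carrier := {v | ∀ g ∈ G, g v = v}
  add_mem' := fun {u v} hu hv g hg => by rw [map_add, hu g hg, hv g hg]
  zero_mem' := fun g _ => map_zero g
  smul_mem' := fun c v hv g hg => by rw [map_smul, hv g hg]
  vac_mem := fun _ hg => A.aut_apply_vac ω (hG hg)
  mode_mem := fun u hu v hv n g hg => by rw [(hG hg).1, hu g hg, hv g hg]

end General

end VertexAlgebra

/-! ### The Weyl algebra and its Whittaker modules -/

/-- The generators `a(n)`, `a*(n)` of the Weyl algebra, for integers `n`. -/
inductive WeylGen : Type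
  | a (n : ℤ) : WeylGen
  | astar (n : ℤ) : WeylGen

/-- The defining relations of the Weyl algebra. -/
inductive WeylRel : FreeAlgebra ℂ WeylGen → FreeAlgebra ℂ WeylGen → Prop
  | a_astar (n m : ℤ) : WeylRel
      (FreeAlgebra.ι ℂ (WeylGen.a n) * FreeAlgebra.ι ℂ (WeylGen.astar m)
        - FreeAlgebra.ι ℂ (WeylGen.astar m) * FreeAlgebra.ι ℂ (WeylGen.a n))
      (if n + m = 0 then 1 else 0)
  | a_a (n m : ℤ) : WeylRel
      (FreeAlgebra.ι ℂ (WeylGen.a n) * FreeAlgebra.ι ℂ (WeylGen.a m)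
        - FreeAlgebra.ι ℂ (WeylGen.a m) * FreeAlgebra.ι ℂ (WeylGen.a n)) 0
  | astar_astar (n m : ℤ) : WeylRel
      (FreeAlgebra.ι ℂ (WeylGen.astar n) * FreeAlgebra.ι ℂ (WeylGen.astar m)
        - FreeAlgebra.ι ℂ (WeylGen.astar m) * FreeAlgebra.ι ℂ (WeylGen.astar n)) 0

/-- The Weyl algebra. -/
def WeylAlgebra : Type := RingQuot WeylRel

noncomputable instance WeylAlgebra.instRing : Ring WeylAlgebra :=
  inferInstanceAs (Ring (RingQuot WeylRel))

noncomputable instance WeylAlgebra.instAlgebra : Algebra ℂ WeylAlgebra :=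
  inferInstanceAs (Algebra ℂ (RingQuot WeylRel))

namespace WeylAlgebra

/-- The generator `a(n)` of the Weyl algebra. -/
noncomputable def a (n : ℤ) : WeylAlgebra :=
  RingQuot.mkAlgHom ℂ WeylRel (FreeAlgebra.ι ℂ (WeylGen.a n))

/-- The generator `a*(n)` of the Weyl algebra. -/
noncomputable def astar (n : ℤ) : WeylAlgebra :=
  RingQuot.mkAlgHom ℂ WeylRel (FreeAlgebra.ι ℂ (WeylGen.astar n))

theorem a_astar (n m : ℤ) : a n * astar m - astar m * a n = if n + m = 0 then 1 else 0 := by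
  have h := RingQuot.mkAlgHom_rel ℂ (WeylRel.a_astar n m)
  rw [map_sub, map_mul, map_mul] at h
  refine h.trans ?_
  split_ifs
  · exact map_one _
  · exact map_zero _

theorem a_a (n m : ℤ) : a n * a m - a m * a n = 0 := by
  have h := RingQuot.mkAlgHom_rel ℂ (WeylRel.a_a n m)
  rwa [map_sub, map_mul, map_mul, map_zero] at h

theorem astar_astar (n m : ℤ) : astar n * astar m - astar m * astar n = 0 := by
  have h := RingQuot.mkAlgHom_rel ℂ (WeylRel.astar_astar n m)
  rwa [map_sub, map_mul, map_mul, map_zero] at h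

/-- The endomorphism `a(n) ↦ t a(n)`, `a*(n) ↦ t⁻¹ a*(n)` of the Weyl algebra. -/
noncomputable def scale (t : ℂˣ) : WeylAlgebra →ₐ[ℂ] WeylAlgebra :=
  RingQuot.liftAlgHom ℂ
    ⟨FreeAlgebra.lift ℂ fun x => match x with
      | WeylGen.a n => (t : ℂ) • a n
      | WeylGen.astar n => (t : ℂ)⁻¹ • astar n, by
      intro x y h
      have ht : (t : ℂ) ≠ 0 := t.ne_zero
      cases h with
      | a_astar n m =>
        simp only [map_sub, map_mul, FreeAlgebra.lift_ι_apply, smul_mul_smul_comm]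
        rw [inv_mul_cancel₀ ht, mul_inv_cancel₀ ht, one_smul, one_smul, a_astar]
        split_ifs <;> simp
      | a_a n m =>
        simp only [map_sub, map_mul, FreeAlgebra.lift_ι_apply, smul_mul_smul_comm, map_zero]
        rw [← smul_sub, a_a, smul_zero]
      | astar_astar n m =>
        simp only [map_sub, map_mul, FreeAlgebra.lift_ι_apply, smul_mul_smul_comm, map_zero]
        rw [← smul_sub, astar_astar, smul_zero]⟩

theorem scale_a (t : ℂˣ) (n : ℤ) : scale t (a n) = (t : ℂ) • a n :=
  (RingQuot.liftAlgHom_mkAlgHom_apply ℂ _ _ _).trans (FreeAlgebra.lift_ι_apply _ _)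

theorem scale_astar (t : ℂˣ) (n : ℤ) : scale t (astar n) = (t : ℂ)⁻¹ • astar n :=
  (RingQuot.liftAlgHom_mkAlgHom_apply ℂ _ _ _).trans (FreeAlgebra.lift_ι_apply _ _)

theorem scale_comp_scale (s t : ℂˣ) (h : s * t = 1) :
    (scale s).comp (scale t) = AlgHom.id ℂ WeylAlgebra := by
  have hc : (s : ℂ) * t = 1 := by rw [← Units.val_mul, h, Units.val_one]
  apply RingQuot.ringQuot_ext'
  apply FreeAlgebra.hom_ext
  funext x
  cases x with
  | a n =>
    change scale s (scale t (a n)) = a n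
    rw [scale_a, map_smul, scale_a, smul_smul, mul_comm, hc, one_smul]
  | astar n =>
    change scale s (scale t (astar n)) = astar n
    rw [scale_astar, map_smul, scale_astar, smul_smul, ← mul_inv, mul_comm, hc, inv_one, one_smul]

/-- The automorphism `a(n) ↦ t a(n)`, `a*(n) ↦ t⁻¹ a*(n)` of the Weyl algebra. -/
noncomputable def scaleEquiv (t : ℂˣ) : WeylAlgebra ≃ₐ[ℂ] WeylAlgebra :=
  AlgEquiv.ofAlgHom (scale t) (scale t⁻¹)
    (scale_comp_scale _ _ (mul_inv_cancel t)) (scale_comp_scale _ _ (inv_mul_cancel t))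

end WeylAlgebra

open WeylAlgebra in
/-- The left ideal of the Weyl algebra that is generated by `a(k)` and `a*(k+1)` for `k ≥ 0`. -/
noncomputable def weylVacuumIdeal : Submodule WeylAlgebra WeylAlgebra :=
  Submodule.span WeylAlgebra
    (Set.range (fun k : ℕ => a k) ∪ Set.range (fun k : ℕ => astar (k + 1)))

/-- The Weyl module `M`, generated by a vector `𝟏` with `a(k) 𝟏 = a*(k+1) 𝟏 = 0` for `k ≥ 0`. -/
abbrev WeylModule : Type := WeylAlgebra ⧸ weylVacuumIdeal

open WeylAlgebra in
/-- The left ideal `I` of the Weyl algebra that is generated by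
`a(0) - λ_0, …, a(n) - λ_n`, `a*(1) - μ_1, …, a*(n) - μ_n`, and `a(k)`, `a*(k)` for `k > n`.
The entry `μ_j` of the family `mu` is `mu (j - 1)`. -/
noncomputable def whittakerIdeal {n : ℕ} (lam : Fin (n + 1) → ℂ) (mu : Fin n → ℂ) :
    Submodule WeylAlgebra WeylAlgebra :=
  Submodule.span WeylAlgebra
    (Set.range (fun k : Fin (n + 1) => a (k : ℕ) - algebraMap ℂ WeylAlgebra (lam k))
      ∪ Set.range (fun k : Fin n => astar ((k : ℕ) + 1) - algebraMap ℂ WeylAlgebra (mu k))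
      ∪ {x | ∃ k : ℤ, n < k ∧ (x = a k ∨ x = astar k)})

/-- The Whittaker module `M_1(λ, μ)`. -/
abbrev WhittakerModule {n : ℕ} (lam : Fin (n + 1) → ℂ) (mu : Fin n → ℂ) : Type :=
  WeylAlgebra ⧸ whittakerIdeal lam mu

/-! ### The Weyl vertex algebra and its automorphism `g_p` -/

namespace WeylModule

open WeylAlgebra

/-- The generating vector `𝟏` of the Weyl module. -/
noncomputable def one : WeylModule := Submodule.Quotient.mk 1

/-- The conformal vector `ω = 1/2 (a(-1) a*(-1) - a(-2) a*(0)) 𝟏`. -/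
noncomputable def omega : WeylModule :=
  (1 / 2 : ℂ) • (a (-1) * astar (-1) - a (-2) * astar 0) • one

theorem scale_mem (t : ℂˣ) {x : WeylAlgebra} (hx : x ∈ weylVacuumIdeal) :
    scaleEquiv t x ∈ weylVacuumIdeal := by
  induction hx using Submodule.span_induction with
  | mem x hx =>
    rcases hx with ⟨k, rfl⟩ | ⟨k, rfl⟩
    · change scale t (a k) ∈ _
      rw [scale_a]
      exact Submodule.smul_of_tower_mem _ _ (Submodule.subset_span (Or.inl ⟨k, rfl⟩))
    · change scale t (astar (k + 1)) ∈ _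
      rw [scale_astar]
      exact Submodule.smul_of_tower_mem _ _ (Submodule.subset_span (Or.inr ⟨k, rfl⟩))
  | zero => rw [map_zero]; exact Submodule.zero_mem _
  | add x y _ _ hx hy => rw [map_add]; exact Submodule.add_mem _ hx hy
  | smul c x _ hx => rw [smul_eq_mul, map_mul]; exact Submodule.smul_mem _ (scaleEquiv t c) hx

/-- The linear automorphism of `M` that is induced by the automorphism `a(n) ↦ t a(n)`,
`a*(n) ↦ t⁻¹ a*(n)` of the Weyl algebra. -/
noncomputable def scale (t : ℂˣ) : WeylModule ≃ₗ[ℂ] WeylModule :=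
  (Submodule.Quotient.restrictScalarsEquiv ℂ weylVacuumIdeal).symm ≪≫ₗ
    Submodule.Quotient.equiv (weylVacuumIdeal.restrictScalars ℂ)
      (weylVacuumIdeal.restrictScalars ℂ) (scaleEquiv t).toLinearEquiv (by
        apply le_antisymm
        · rintro _ ⟨x, hx, rfl⟩
          exact scale_mem t hx
        · intro x hx
          exact ⟨(scaleEquiv t).symm x, scale_mem t⁻¹ hx, (scaleEquiv t).apply_symm_apply x⟩) ≪≫ₗ
    Submodule.Quotient.restrictScalarsEquiv ℂ weylVacuumIdeal

/-- The primitive `p`-th root of unity `ζ_p = e^(2πi/p)`. -/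
noncomputable def zeta (p : ℕ) : ℂˣ :=
  Units.mk0 (Complex.exp (2 * Real.pi * Complex.I / p)) (Complex.exp_ne_zero _)

/-- The automorphism `g_p` of `M`, which is induced by `a(n) ↦ ζ_p a(n)`,
`a*(n) ↦ ζ_p⁻¹ a*(n)`. -/
noncomputable def g (p : ℕ) : WeylModule ≃ₗ[ℂ] WeylModule := scale (zeta p)

end WeylModule

open WeylAlgebra in
/-- The vertex algebra structure `A` on the Weyl module is the one of the Weyl vertex algebra: the
vacuum is `𝟏`, `Y(a(-1)𝟏, z) = ∑ a(n) z^(-n-1)` and `Y(a*(0)𝟏, z) = ∑ a*(n) z^(-n)`. -/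
def IsWeylVertexAlgebra (A : VertexAlgebra WeylModule) : Prop :=
  A.vac = WeylModule.one ∧
  (∀ (n : ℤ) (v : WeylModule), A.Y (a (-1) • WeylModule.one) n v = a n • v) ∧
  (∀ (n : ℤ) (v : WeylModule), A.Y (astar 0 • WeylModule.one) (n - 1) v = astar n • v)

open WeylAlgebra in
/-- The weak module structure `N` on a module `W` over the Weyl algebra is given by the action of
the Weyl algebra: `a(-1)𝟏` acts by `∑ a(n) z^(-n-1)` and `a*(0)𝟏` by `∑ a*(n) z^(-n)`. -/
def IsInducedByWeylAction {A : VertexAlgebra WeylModule} {W : Type*} [AddCommGroup W] [Module ℂ W]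
    [Module WeylAlgebra W] (N : A.WeakModule W) : Prop :=
  (∀ (n : ℤ) (w : W), N.Y (a (-1) • WeylModule.one) n w = a n • w) ∧
  (∀ (n : ℤ) (w : W), N.Y (astar 0 • WeylModule.one) (n - 1) w = astar n • w)

/-! Irreducibility. Index the generators by the modes of their fields, so that `mode s k` is `a(k)`
or `a*(k+1)`. On the Whittaker module each `mode s k` with `k ≥ 0` has the cyclic vector as an
eigenvector, and since commutators of generators are scalars, `mode s k` minus that eigenvalue is
locally nilpotent (`exists_pow_sub_apply_eq_zero`). Because `Λ ≠ 0`, some `T = mode s k` has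
eigenvalue `c ≠ 0`. Let `U` be stable under the modes of the orbifold. By the Jacobi identity a
product `u_m v_n w` is a combination of vectors `(u_l v)_q w` (`mode_mode_mem`), so a product of
generators whose `g_p`-weights multiply to `1` maps `U` into itself. In particular `T^p` does. Near
`c ≠ 0` the map `X ↦ X^p` is a local coordinate, so on each vector `T` is a polynomial in `T^p`
(`apply_mem_of_pow_apply_mem`); hence `T` preserves `U`, and it maps `U` onto `U`
(`exists_apply_eq_of_locally_unipotent`). Now write `w ∈ U` as `T^j w'` with `w' ∈ U` and `j` such
that `x T^j` has weight `1`, for a given generator `x`: then `x w = x T^j w' ∈ U`. So `U` is stable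
under the whole Weyl algebra, over which the Whittaker module is simple
(`eq_bot_or_eq_top_of_mode_smul_mem`): it is a quotient of a polynomial space on which suitable
generators act by derivatives up to constants. Existence of the structures. On a restricted module,
pairwise local fields satisfy the Jacobi identity for the `l`-th products of fields
(`IsLocal.jacobi`), and locality survives products (Dong's lemma, `IsLocal.prod`). The commutator
formula `prod_prod_sub_of_isLocal` makes the operators `prod n (genField hW s)` satisfy the Weyl
relations on the space of fields, and the vacuum ideal kills the identity field. This gives a map
`vertexOp` from `M` to fields, which turns products of vectors into products of fields
(`vertexOp_stateField`). With `W = M` it yields the vertex algebra, with general `W` the weak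
module. Uniqueness holds because the Jacobi identity determines the modes of `mode s k • u` from
those of `u` and of a generator. -/

/-! ### Binomial sums of doubly indexed families -/

section BinomialSums

variable {W W' : Type*} [AddCommGroup W] [AddCommGroup W']

/-- The coefficient `(-1)^i (l choose i)`. -/
def altChoose (l : ℤ) (i : ℕ) : ℤ := (-1) ^ i * Ring.choose l i

theorem altChoose_zero_right (l : ℤ) : altChoose l 0 = 1 := by
  simp [altChoose]

theorem altChoose_zero_succ (i : ℕ) : altChoose 0 (i + 1) = 0 := by
  simp [altChoose, Ring.choose_zero_succ]

theorem altChoose_succ_succ (l : ℤ) (i : ℕ) :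
    altChoose (l + 1) (i + 1) = altChoose l (i + 1) - altChoose l i := by
  simp only [altChoose, Ring.choose_succ_succ, pow_succ]
  ring

/-- The coefficients of `(z - x)^l f`, expanded in nonnegative powers of `x`. -/
noncomputable def binSum (l : ℤ) (f : ℤ → ℤ → W) (m n : ℤ) : W :=
  ∑ᶠ i : ℕ, altChoose l i • f (m + l - i) (n + i)

/-- The family vanishes when its second index is large. -/
def TruncRight (f : ℤ → ℤ → W) : Prop := ∃ N : ℤ, ∀ m n : ℤ, N ≤ n → f m n = 0

/-- The family vanishes when its first index is large. -/
def TruncLeft (g : ℤ → ℤ → W) : Prop := ∃ N : ℤ, ∀ m n : ℤ, N ≤ m → g m n = 0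

theorem finsum_eq_sum_range (f : ℕ → W) (K : ℕ) (h : ∀ i, K ≤ i → f i = 0) :
    ∑ᶠ i, f i = ∑ i ∈ Finset.range K, f i := by
  apply finsum_eq_sum_of_support_subset
  intro i hi
  simp only [Finset.coe_range, Set.mem_Iio]
  by_contra hK
  exact hi (h i (not_lt.mp hK))

theorem finite_support_of_le (f : ℕ → W) (K : ℕ) (h : ∀ i, K ≤ i → f i = 0) :
    (Function.support f).Finite := by
  apply (Finset.range K).finite_toSet.subset
  intro i hi
  simp only [Finset.coe_range, Set.mem_Iio]
  by_contra hK
  exact hi (h i (not_lt.mp hK))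

theorem binSum_eq_sum {f : ℤ → ℤ → W} {N : ℤ} (hf : ∀ m n : ℤ, N ≤ n → f m n = 0) (l m n : ℤ)
    {K : ℕ} (hK : N ≤ n + K) :
    binSum l f m n = ∑ i ∈ Finset.range K, altChoose l i • f (m + l - i) (n + i) := by
  apply finsum_eq_sum_range
  intro i hi
  rw [hf _ _ (by omega), smul_zero]

theorem TruncRight.finite_support {f : ℤ → ℤ → W} (hf : TruncRight f) (c : ℕ → ℤ) (k : ℕ → ℤ)
    (n : ℤ) : (Function.support fun i : ℕ => c i • f (k i) (n + i)).Finite := by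
  obtain ⟨N, hN⟩ := hf
  apply finite_support_of_le _ (N - n).toNat
  intro i hi
  rw [hN _ _ (by omega), smul_zero]

theorem TruncRight.add {f f' : ℤ → ℤ → W} (hf : TruncRight f) (hf' : TruncRight f') :
    TruncRight (f + f') := by
  obtain ⟨N, hN⟩ := hf
  obtain ⟨N', hN'⟩ := hf'
  exact ⟨max N N', fun m n hn => by
    simp [hN m n (le_trans (le_max_left _ _) hn), hN' m n (le_trans (le_max_right _ _) hn)]⟩

theorem TruncRight.neg {f : ℤ → ℤ → W} (hf : TruncRight f) : TruncRight (-f) := by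
  obtain ⟨N, hN⟩ := hf
  exact ⟨N, fun m n hn => by simp [hN m n hn]⟩

theorem TruncRight.sub {f f' : ℤ → ℤ → W} (hf : TruncRight f) (hf' : TruncRight f') :
    TruncRight (f - f') := by
  rw [sub_eq_add_neg]; exact hf.add hf'.neg

theorem binSum_zero_left (f : ℤ → ℤ → W) (m n : ℤ) : binSum 0 f m n = f m n := by
  rw [binSum, finsum_eq_sum_range _ 1]
  · simp [altChoose_zero_right]
  · intro i hi
    obtain ⟨j, rfl⟩ := Nat.exists_eq_add_of_le' hi
    rw [altChoose_zero_succ, zero_smul]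

theorem binSum_zero (l m n : ℤ) : binSum l (0 : ℤ → ℤ → W) m n = 0 := by
  simp [binSum]

theorem binSum_add (l : ℤ) {f f' : ℤ → ℤ → W} (hf : TruncRight f) (hf' : TruncRight f') (m n : ℤ) :
    binSum l (f + f') m n = binSum l f m n + binSum l f' m n := by
  rw [binSum, binSum, binSum, ← finsum_add_distrib (hf.finite_support _ _ _)
    (hf'.finite_support _ _ _)]
  simp

theorem binSum_neg (l : ℤ) (f : ℤ → ℤ → W) (m n : ℤ) :
    binSum l (-f) m n = -binSum l f m n := by
  simp [binSum, finsum_neg_distrib]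

theorem binSum_sub (l : ℤ) {f f' : ℤ → ℤ → W} (hf : TruncRight f) (hf' : TruncRight f') (m n : ℤ) :
    binSum l (f - f') m n = binSum l f m n - binSum l f' m n := by
  rw [sub_eq_add_neg, binSum_add l hf hf'.neg, binSum_neg, sub_eq_add_neg]

theorem map_binSum (φ : W →+ W') (l : ℤ) {f : ℤ → ℤ → W} (hf : TruncRight f) (m n : ℤ) :
    φ (binSum l f m n) = binSum l (fun m n => φ (f m n)) m n := by
  rw [binSum, φ.map_finsum (hf.finite_support _ _ _)]
  simp [binSum]

/-- Pascal's rule, that is `(z - x)^(l+1) = (z - x)(z - x)^l` read on coefficients. -/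
theorem binSum_succ (l : ℤ) {f : ℤ → ℤ → W} (hf : TruncRight f) (m n : ℤ) :
    binSum (l + 1) f m n = binSum l f (m + 1) n - binSum l f m (n + 1) := by
  obtain ⟨N, hN⟩ := hf
  obtain ⟨K, hK⟩ : ∃ K : ℕ, N ≤ n + K := ⟨(N - n).toNat, by omega⟩
  -- The last sum starts at `n + 1`, so it is one term shorter and matches the other two once their
  -- terms with `i = 0` are split off.
  rw [binSum_eq_sum hN _ _ _ (K := K + 1) (by push_cast; omega),
    binSum_eq_sum hN _ _ _ (K := K + 1) (by push_cast; omega),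
    binSum_eq_sum hN _ _ _ (K := K) (by omega), Finset.sum_range_succ', Finset.sum_range_succ']
  simp only [altChoose_succ_succ, sub_smul, Finset.sum_sub_distrib, altChoose_zero_right]
  have e1 : ∀ i : ℕ, f (m + (l + 1) - (i + 1 : ℕ)) (n + (i + 1 : ℕ)) = f (m + l - i) (n + 1 + i) := by
    intro i; congr 1 <;> (push_cast; ring)
  have e2 : ∀ i : ℕ, f (m + 1 + l - (i + 1 : ℕ)) (n + (i + 1 : ℕ)) = f (m + l - i) (n + 1 + i) := by
    intro i; congr 1 <;> (push_cast; ring)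
  have e3 : f (m + (l + 1) - (0 : ℕ)) (n + (0 : ℕ)) = f (m + 1 + l - (0 : ℕ)) (n + (0 : ℕ)) := by
    congr 1; ring
  simp only [e1, e2, e3]
  abel

theorem binSum_eq_zero_of_le {f : ℤ → ℤ → W} {N : ℤ} (hf : ∀ m n : ℤ, N ≤ n → f m n = 0)
    (l m : ℤ) {n : ℤ} (hn : N ≤ n) : binSum l f m n = 0 := by
  rw [binSum_eq_sum hf l m n (K := 0) (by simpa using hn)]
  simp

/-- The coefficients of the residue-type expression `(z - x)^l f - (-x + z)^l g`, where each power
is expanded in the region in which the first summand is large. -/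
noncomputable def resSum (l : ℤ) (f g : ℤ → ℤ → W) (m n : ℤ) : W :=
  binSum l f m n - (Int.negOnePow l : ℤ) • binSum l (fun n m => g m n) n m

theorem TruncLeft.swap {g : ℤ → ℤ → W} (hg : TruncLeft g) : TruncRight fun n m => g m n := by
  obtain ⟨N, hN⟩ := hg
  exact ⟨N, fun m n hn => hN n m hn⟩

theorem resSum_zero_left (f g : ℤ → ℤ → W) (m n : ℤ) : resSum 0 f g m n = f m n - g m n := by
  simp [resSum, binSum_zero_left]

/-- The two expansions obey the same recursion: exchanging the variables costs a sign, which
`Int.negOnePow` absorbs. -/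
theorem resSum_succ (l : ℤ) {f g : ℤ → ℤ → W} (hf : TruncRight f) (hg : TruncLeft g) (m n : ℤ) :
    resSum (l + 1) f g m n = resSum l f g (m + 1) n - resSum l f g m (n + 1) := by
  rw [resSum, resSum, resSum, binSum_succ l hf, binSum_succ l hg.swap, Int.negOnePow_succ]
  simp only [Units.val_neg, neg_smul, smul_sub]
  abel

/-- Passes to the single sum in which `JacobiIdentity` is phrased; the truncation conditions make
both supports finite. -/
theorem resSum_eq_finsum (l : ℤ) {f g : ℤ → ℤ → W} (hf : TruncRight f) (hg : TruncLeft g)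
    (m n : ℤ) : resSum l f g m n = ∑ᶠ i : ℕ, altChoose l i •
      (f (m + l - i) (n + i) - (Int.negOnePow l : ℤ) • g (m + i) (n + l - i)) := by
  have h := (zsmulAddGroupHom (Int.negOnePow l : ℤ) : W →+ W).map_finsum
    (hg.swap.finite_support (altChoose l) (fun i => n + l - i) m)
  simp only [zsmulAddGroupHom_apply] at h
  rw [resSum, binSum, binSum, h, ← finsum_sub_distrib (hf.finite_support _ _ _)]
  · refine finsum_congr fun i => ?_
    rw [smul_sub, smul_comm]
  · refine (hg.swap.finite_support (altChoose l) (fun i => n + l - i) m).subset ?_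
    intro i hi h0
    exact hi (by dsimp only at h0 ⊢; rw [h0, smul_zero])

theorem resSum_sub (l : ℤ) {f g f' g' : ℤ → ℤ → W} (hf : TruncRight f) (hg : TruncLeft g)
    (hf' : TruncRight f') (hg' : TruncLeft g') (m n : ℤ) :
    resSum l (f - f') (g - g') m n = resSum l f g m n - resSum l f' g' m n := by
  have h := binSum_sub l hg.swap hg'.swap n m
  have h' : (fun n m => (g - g') m n) = (fun n m => g m n) - fun n m => g' m n := rfl
  rw [resSum, resSum, resSum, binSum_sub l hf hf', h', h, smul_sub]
  abel

theorem resSum_add (l : ℤ) {f g f' g' : ℤ → ℤ → W} (hf : TruncRight f) (hg : TruncLeft g)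
    (hf' : TruncRight f') (hg' : TruncLeft g') (m n : ℤ) :
    resSum l (f + f') (g + g') m n = resSum l f g m n + resSum l f' g' m n := by
  have h := binSum_add l hg.swap hg'.swap n m
  have h' : (fun n m => (g + g') m n) = (fun n m => g m n) + fun n m => g' m n := rfl
  rw [resSum, resSum, resSum, binSum_add l hf hf', h', h, smul_add]
  abel

theorem map_resSum (φ : W →+ W') (l : ℤ) {f g : ℤ → ℤ → W} (hf : TruncRight f) (hg : TruncLeft g)
    (m n : ℤ) :
    φ (resSum l f g m n) = resSum l (fun m n => φ (f m n)) (fun m n => φ (g m n)) m n := by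
  rw [resSum, map_sub, map_zsmul, map_binSum φ l hf, map_binSum φ l hg.swap, resSum]

/-- A family that satisfies the recursion of `resSum` vanishes as soon as it vanishes for large `l`
and for `m = 0`. -/
theorem eq_zero_of_recursion (d : ℤ → ℤ → ℤ → W)
    (hrec : ∀ l m n, d (l + 1) m n = d l (m + 1) n - d l m (n + 1)) (N : ℤ)
    (hN : ∀ l m n, N ≤ l → d l m n = 0) (h0 : ∀ l n, d l 0 n = 0) (l m n : ℤ) : d l m n = 0 := by
  -- Solved for `d l (m + 1) n`, the recursion carries the vanishing from `m = 0` to all `m ≥ 0`,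
  -- for every `l`.
  have hpos : ∀ (k : ℕ) (l n : ℤ), d l k n = 0 := by
    intro k
    induction k with
    | zero => intro l n; exact_mod_cast h0 l n
    | succ k ih =>
      intro l n
      have := hrec l k n
      rw [ih, ih, sub_zero] at this
      exact_mod_cast this.symm
  -- Descent in `l`: if level `l + 1` vanishes, then `d l m (n + 1) = d l (m + 1) n`, which carries
  -- the vanishing at `m = 0` to negative `m`.
  have hl : ∀ (j : ℕ) (m n : ℤ), d (N - j) m n = 0 := by
    intro j
    induction j with
    | zero => intro m n; exact hN _ _ _ (by simp)
    | succ j ih =>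
      have hneg : ∀ (k : ℕ) (n : ℤ), d (N - (j + 1 : ℕ)) (-k) n = 0 := by
        intro k
        induction k with
        | zero => intro n; simpa using hpos 0 _ n
        | succ k ihk =>
          intro n
          have := hrec (N - (j + 1 : ℕ)) (-(k + 1 : ℕ)) (n - 1)
          rw [show N - ((j + 1 : ℕ) : ℤ) + 1 = N - j by push_cast; ring, ih,
            show -((k + 1 : ℕ) : ℤ) + 1 = -k by push_cast; ring, ihk, sub_add_cancel, zero_sub] at this
          exact neg_eq_zero.mp this.symm
      intro m n
      rcases le_total 0 m with h | h
      · obtain ⟨k, rfl⟩ := Int.eq_ofNat_of_zero_le h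
        exact hpos _ _ _
      · obtain ⟨k, hk⟩ := Int.eq_ofNat_of_zero_le (neg_nonneg.mpr h)
        rw [show m = -(k : ℤ) by omega]
        exact hneg _ _
  rcases le_total N l with h | h
  · exact hN _ _ _ h
  · obtain ⟨k, hk⟩ := Int.eq_ofNat_of_zero_le (sub_nonneg.mpr h)
    rw [show l = N - (k : ℤ) by omega]
    exact hl _ _ _

end BinomialSums

/-! ### Difference operators -/

section Differences

variable {W W' : Type*} [AddCommGroup W] [AddCommGroup W']

theorem addEnd_mul_apply {A : Type*} [AddCommGroup A] (f g : AddMonoid.End A) (x : A) :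
    (f * g) x = f (g x) := rfl

/-- Multiplication of a formal distribution in two variables by the difference of the variables. -/
def diffOp (W : Type*) [AddCommGroup W] : AddMonoid.End (ℤ → ℤ → W) where
  toFun f m n := f (m + 1) n - f m (n + 1)
  map_zero' := by funext m n; simp
  map_add' f g := by funext m n; simp only [Pi.add_apply]; abel

theorem diffOp_apply (f : ℤ → ℤ → W) (m n : ℤ) :
    diffOp W f m n = f (m + 1) n - f m (n + 1) := rfl

theorem diffOp_pow_succ_apply (N : ℕ) (f : ℤ → ℤ → W) (m n : ℤ) :
    (diffOp W ^ (N + 1)) f m n = (diffOp W ^ N) f (m + 1) n - (diffOp W ^ N) f m (n + 1) := by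
  rw [pow_succ', addEnd_mul_apply, diffOp_apply]

theorem diffOp_pow_map (φ : W →+ W') (N : ℕ) (f : ℤ → ℤ → W) (m n : ℤ) :
    (diffOp W' ^ N) (fun m n => φ (f m n)) m n = φ ((diffOp W ^ N) f m n) := by
  induction N generalizing m n with
  | zero => rfl
  | succ N ih => rw [diffOp_pow_succ_apply, diffOp_pow_succ_apply, ih, ih, map_sub]

theorem diffOp_pow_eq_zero_of_le {N N' : ℕ} (h : N ≤ N') {f : ℤ → ℤ → W}
    (hf : (diffOp W ^ N) f = 0) : (diffOp W ^ N') f = 0 := by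
  obtain ⟨j, rfl⟩ := Nat.exists_eq_add_of_le' h
  rw [pow_add, addEnd_mul_apply, hf, map_zero]

theorem diffOp_pow_swap (N : ℕ) (f : ℤ → ℤ → W) (m n : ℤ) :
    (diffOp W ^ N) (fun n m => f m n) n m = (-1 : ℤ) ^ N • (diffOp W ^ N) f m n := by
  induction N generalizing m n with
  | zero => simp
  | succ N ih =>
    rw [diffOp_pow_succ_apply, diffOp_pow_succ_apply, ih, ih, pow_succ, mul_neg_one, neg_smul,
      smul_sub]
    abel

/-- For a nonnegative exponent both expansions are the same polynomial, so only `f - g` matters.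
This is the link between locality and the vanishing of high products. -/
theorem resSum_natCast (N : ℕ) {f g : ℤ → ℤ → W} (hf : TruncRight f) (hg : TruncLeft g)
    (m n : ℤ) : resSum (N : ℤ) f g m n = (diffOp W ^ N) (f - g) m n := by
  induction N generalizing m n with
  | zero => rw [Nat.cast_zero, resSum_zero_left]; rfl
  | succ N ih => rw [Nat.cast_succ, resSum_succ _ hf hg, diffOp_pow_succ_apply, ih, ih]

theorem TruncRight.diffOp {f : ℤ → ℤ → W} (hf : TruncRight f) : TruncRight (diffOp W f) := by
  obtain ⟨N, hN⟩ := hf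
  exact ⟨N, fun m n hn => by rw [diffOp_apply, hN _ _ hn, hN _ _ (by omega), sub_zero]⟩

theorem TruncLeft.diffOp {f : ℤ → ℤ → W} (hf : TruncLeft f) : TruncLeft (diffOp W f) := by
  obtain ⟨N, hN⟩ := hf
  exact ⟨N, fun m n hn => by rw [diffOp_apply, hN _ _ hn, hN _ _ (by omega), sub_zero]⟩

theorem binSum_shift_left (l : ℤ) (f : ℤ → ℤ → W) (m n : ℤ) :
    binSum l (fun m n => f (m + 1) n) m n = binSum l f (m + 1) n := by
  refine finsum_congr fun i => ?_
  dsimp only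
  rw [show m + l - (i : ℤ) + 1 = m + 1 + l - i by ring]

theorem binSum_shift_right (l : ℤ) (f : ℤ → ℤ → W) (m n : ℤ) :
    binSum l (fun m n => f m (n + 1)) m n = binSum l f m (n + 1) := by
  refine finsum_congr fun i => ?_
  dsimp only
  rw [show n + (i : ℤ) + 1 = n + 1 + i by ring]

theorem resSum_shift_left (l : ℤ) (f g : ℤ → ℤ → W) (m n : ℤ) :
    resSum l (fun m n => f (m + 1) n) (fun m n => g (m + 1) n) m n = resSum l f g (m + 1) n := by
  rw [resSum, resSum, binSum_shift_left, binSum_shift_right l (fun n m => g m n)]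

theorem resSum_shift_right (l : ℤ) (f g : ℤ → ℤ → W) (m n : ℤ) :
    resSum l (fun m n => f m (n + 1)) (fun m n => g m (n + 1)) m n = resSum l f g m (n + 1) := by
  rw [resSum, resSum, binSum_shift_right, binSum_shift_left l (fun n m => g m n)]

theorem resSum_diffOp (l : ℤ) {f g : ℤ → ℤ → W} (hf : TruncRight f) (hg : TruncLeft g)
    (m n : ℤ) : resSum l (diffOp W f) (diffOp W g) m n = resSum (l + 1) f g m n := by
  obtain ⟨N, hN⟩ := hf
  obtain ⟨N', hN'⟩ := hg
  have h := resSum_sub l (f := fun m n => f (m + 1) n) (g := fun m n => g (m + 1) n)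
    (f' := fun m n => f m (n + 1)) (g' := fun m n => g m (n + 1))
    ⟨N, fun m n hn => hN _ _ hn⟩ ⟨N', fun m n hn => hN' _ _ (by omega)⟩
    ⟨N, fun m n hn => hN _ _ (by omega)⟩ ⟨N', fun m n hn => hN' _ _ hn⟩ m n
  rw [resSum_shift_left, resSum_shift_right] at h
  rw [resSum_succ l ⟨N, hN⟩ ⟨N', hN'⟩]
  exact h

/-- `diffOp` in the first two of three variables. -/
def diffOp₁₂ (W : Type*) [AddCommGroup W] : AddMonoid.End (ℤ → ℤ → ℤ → W) where
  toFun f m q n := f (m + 1) q n - f m (q + 1) n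
  map_zero' := by funext m q n; simp
  map_add' f g := by funext m q n; simp only [Pi.add_apply]; abel

theorem diffOp₁₂_apply (f : ℤ → ℤ → ℤ → W) (m q n : ℤ) :
    diffOp₁₂ W f m q n = f (m + 1) q n - f m (q + 1) n := rfl

/-- `diffOp` in the last two of three variables. -/
def diffOp₂₃ (W : Type*) [AddCommGroup W] : AddMonoid.End (ℤ → ℤ → ℤ → W) where
  toFun f m q n := f m (q + 1) n - f m q (n + 1)
  map_zero' := by funext m q n; simp
  map_add' f g := by funext m q n; simp only [Pi.add_apply]; abel

theorem diffOp₂₃_apply (f : ℤ → ℤ → ℤ → W) (m q n : ℤ) :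
    diffOp₂₃ W f m q n = f m (q + 1) n - f m q (n + 1) := rfl

/-- `diffOp` in the first and the last of three variables. -/
def diffOp₁₃ (W : Type*) [AddCommGroup W] : AddMonoid.End (ℤ → ℤ → ℤ → W) where
  toFun f m q n := f (m + 1) q n - f m q (n + 1)
  map_zero' := by funext m q n; simp
  map_add' f g := by funext m q n; simp only [Pi.add_apply]; abel

theorem diffOp₁₃_apply (f : ℤ → ℤ → ℤ → W) (m q n : ℤ) :
    diffOp₁₃ W f m q n = f (m + 1) q n - f m q (n + 1) := rfl

theorem commute_diffOp₁₂_diffOp₂₃ : Commute (diffOp₁₂ W) (diffOp₂₃ W) := by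
  refine AddMonoidHom.ext fun f => ?_
  funext m q n
  change diffOp₁₂ W (diffOp₂₃ W f) m q n = diffOp₂₃ W (diffOp₁₂ W f) m q n
  simp only [diffOp₁₂_apply, diffOp₂₃_apply]
  abel

theorem commute_diffOp₁₃_diffOp₂₃ : Commute (diffOp₁₃ W) (diffOp₂₃ W) := by
  refine AddMonoidHom.ext fun f => ?_
  funext m q n
  change diffOp₁₃ W (diffOp₂₃ W f) m q n = diffOp₂₃ W (diffOp₁₃ W f) m q n
  simp only [diffOp₁₃_apply, diffOp₂₃_apply]
  abel

theorem commute_diffOp₁₃_diffOp₁₂ : Commute (diffOp₁₃ W) (diffOp₁₂ W) := by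
  refine AddMonoidHom.ext fun f => ?_
  funext m q n
  change diffOp₁₃ W (diffOp₁₂ W f) m q n = diffOp₁₂ W (diffOp₁₃ W f) m q n
  simp only [diffOp₁₃_apply, diffOp₁₂_apply]
  abel

theorem diffOp₁₂_pow_apply (N : ℕ) (f : ℤ → ℤ → ℤ → W) (m q n : ℤ) :
    (diffOp₁₂ W ^ N) f m q n = (diffOp W ^ N) (fun m q => f m q n) m q := by
  induction N generalizing m q n with
  | zero => rfl
  | succ N ih =>
    rw [diffOp_pow_succ_apply, ← ih, ← ih, pow_succ', addEnd_mul_apply]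
    rfl

theorem diffOp₂₃_pow_apply (N : ℕ) (f : ℤ → ℤ → ℤ → W) (m q n : ℤ) :
    (diffOp₂₃ W ^ N) f m q n = (diffOp W ^ N) (f m) q n := by
  induction N generalizing m q n with
  | zero => rfl
  | succ N ih =>
    rw [diffOp_pow_succ_apply, ← ih, ← ih, pow_succ', addEnd_mul_apply]
    rfl

theorem diffOp₁₃_pow_apply (N : ℕ) (f : ℤ → ℤ → ℤ → W) (m q n : ℤ) :
    (diffOp₁₃ W ^ N) f m q n = (diffOp W ^ N) (fun m n => f m q n) m n := by
  induction N generalizing m q n with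
  | zero => rfl
  | succ N ih =>
    rw [diffOp_pow_succ_apply, ← ih, ← ih, pow_succ', addEnd_mul_apply]
    rfl

/-- The truncation condition on each slice with fixed last variable. -/
def TruncMid (f : ℤ → ℤ → ℤ → W) : Prop := ∀ n, TruncRight fun m q => f m q n

/-- The truncation condition on each slice with fixed last variable. -/
def TruncFst (f : ℤ → ℤ → ℤ → W) : Prop := ∀ n, TruncLeft fun m q => f m q n

theorem TruncMid.diffOp₁₃ {f : ℤ → ℤ → ℤ → W} (hf : TruncMid f) : TruncMid (diffOp₁₃ W f) := by
  intro n
  obtain ⟨N, hN⟩ := hf n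
  obtain ⟨N', hN'⟩ := hf (n + 1)
  refine ⟨max N N', fun m q hq => ?_⟩
  change f (m + 1) q n - f m q (n + 1) = 0
  simp only at hN hN'
  rw [hN _ _ (le_trans (le_max_left _ _) hq), hN' _ _ (le_trans (le_max_right _ _) hq), sub_zero]

theorem TruncFst.diffOp₁₃ {f : ℤ → ℤ → ℤ → W} (hf : TruncFst f) : TruncFst (diffOp₁₃ W f) := by
  intro n
  obtain ⟨N, hN⟩ := hf n
  obtain ⟨N', hN'⟩ := hf (n + 1)
  refine ⟨max N N', fun m q hq => ?_⟩
  change f (m + 1) q n - f m q (n + 1) = 0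
  simp only at hN hN'
  rw [hN _ _ (by omega), hN' _ _ (le_trans (le_max_right _ _) hq), sub_zero]

theorem TruncMid.diffOp₂₃ {f : ℤ → ℤ → ℤ → W} (hf : TruncMid f) : TruncMid (diffOp₂₃ W f) := by
  intro n
  obtain ⟨N, hN⟩ := hf n
  obtain ⟨N', hN'⟩ := hf (n + 1)
  refine ⟨max N N', fun m q hq => ?_⟩
  change f m (q + 1) n - f m q (n + 1) = 0
  simp only at hN hN'
  rw [hN _ _ (by omega), hN' _ _ (le_trans (le_max_right _ _) hq), sub_zero]

theorem TruncFst.diffOp₂₃ {f : ℤ → ℤ → ℤ → W} (hf : TruncFst f) : TruncFst (diffOp₂₃ W f) := by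
  intro n
  obtain ⟨N, hN⟩ := hf n
  obtain ⟨N', hN'⟩ := hf (n + 1)
  refine ⟨max N N', fun m q hq => ?_⟩
  change f m (q + 1) n - f m q (n + 1) = 0
  simp only at hN hN'
  rw [hN _ _ (le_trans (le_max_left _ _) hq), hN' _ _ (le_trans (le_max_right _ _) hq), sub_zero]

theorem TruncMid.diffOp₂₃_pow {f : ℤ → ℤ → ℤ → W} (hf : TruncMid f) (N : ℕ) :
    TruncMid ((_root_.diffOp₂₃ W ^ N) f) := by
  induction N with
  | zero => exact hf
  | succ N ih => rw [pow_succ', addEnd_mul_apply]; exact ih.diffOp₂₃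

theorem TruncFst.diffOp₂₃_pow {f : ℤ → ℤ → ℤ → W} (hf : TruncFst f) (N : ℕ) :
    TruncFst ((_root_.diffOp₂₃ W ^ N) f) := by
  induction N with
  | zero => exact hf
  | succ N ih => rw [pow_succ', addEnd_mul_apply]; exact ih.diffOp₂₃

/-- `resSum` in the first two of three variables. -/
noncomputable def resSum₁₂ (k : ℤ) (f g : ℤ → ℤ → ℤ → W) (m q n : ℤ) : W :=
  resSum k (fun m q => f m q n) (fun m q => g m q n) m q

/-- The second variable survives as the variable of the product, so the factor `x₂ - x₃` passes
through. -/
theorem resSum₁₂_diffOp₂₃ (k : ℤ) {f g : ℤ → ℤ → ℤ → W} (hf : TruncMid f) (hg : TruncFst g) (m : ℤ) :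
    resSum₁₂ k (diffOp₂₃ W f) (diffOp₂₃ W g) m = diffOp W (resSum₁₂ k f g m) := by
  funext q n
  obtain ⟨N, hN⟩ := hf n
  obtain ⟨N', hN'⟩ := hg n
  have h := resSum_sub k (f := fun m q => f m (q + 1) n) (g := fun m q => g m (q + 1) n)
    (f' := fun m q => f m q (n + 1)) (g' := fun m q => g m q (n + 1))
    ⟨N, fun m q hn => hN _ _ (by omega)⟩ ⟨N', fun m q hn => hN' _ _ hn⟩ (hf _) (hg _) m q
  rw [resSum_shift_right k (fun m q => f m q n) (fun m q => g m q n)] at h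
  exact h

theorem resSum₁₂_diffOp₂₃_pow (k : ℤ) {f g : ℤ → ℤ → ℤ → W} (hf : TruncMid f) (hg : TruncFst g)
    (m : ℤ) (N : ℕ) :
    resSum₁₂ k ((diffOp₂₃ W ^ N) f) ((diffOp₂₃ W ^ N) g) m
      = (diffOp W ^ N) (resSum₁₂ k f g m) := by
  induction N with
  | zero => rfl
  | succ N ih =>
    simp only [pow_succ', addEnd_mul_apply]
    rw [resSum₁₂_diffOp₂₃ k (hf.diffOp₂₃_pow N) (hg.diffOp₂₃_pow N), ih]

/-- Write `x₂ - x₃ = (x₁ - x₃) - (x₁ - x₂)`; the factor `x₁ - x₂` raises the exponent `k` by one. -/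
theorem diffOp_resSum₁₂ (k : ℤ) {f g : ℤ → ℤ → ℤ → W} (hf : TruncMid f) (hg : TruncFst g) (m : ℤ) :
    diffOp W (resSum₁₂ k f g m)
      = resSum₁₂ k (diffOp₁₃ W f) (diffOp₁₃ W g) m - resSum₁₂ (k + 1) f g m := by
  rw [← resSum₁₂_diffOp₂₃ k hf hg]
  funext q n
  have e : ∀ f : ℤ → ℤ → ℤ → W, (fun m q => diffOp₂₃ W f m q n)
      = (fun m q => diffOp₁₃ W f m q n) - diffOp W (fun m q => f m q n) := by
    intro f
    funext m q
    change f m (q + 1) n - f m q (n + 1)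
      = f (m + 1) q n - f m q (n + 1) - (f (m + 1) q n - f m (q + 1) n)
    abel
  change resSum k (fun m q => diffOp₂₃ W f m q n) (fun m q => diffOp₂₃ W g m q n) m q = _
  rw [e, e, resSum_sub k (hf.diffOp₁₃ n) (hg.diffOp₁₃ n) (hf n).diffOp (hg n).diffOp,
    resSum_diffOp k (hf n) (hg n)]
  rfl

/-- The combinatorial core of Dong's lemma. Expand `((x₁ - x₃) - (x₁ - x₂))^(s + d)`: every term has
at least `s` factors `x₁ - x₃`, which kill `f` and `g`, or at least `d` factors `x₁ - x₂`, which
raise the exponent to at least `t`, where only `f - g` enters and is killed. The induction spends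
one factor at a time. -/
theorem diffOp_pow_resSum₁₂_eq_zero (t e : ℕ) : ∀ (s d : ℕ), s + d = e →
    ∀ (k : ℤ) (f g : ℤ → ℤ → ℤ → W), TruncMid f → TruncFst g →
      (diffOp₁₃ W ^ s) f = 0 → (diffOp₁₃ W ^ s) g = 0 → (diffOp₁₂ W ^ t) (f - g) = 0 →
      (t : ℤ) ≤ k + d → ∀ m, (diffOp W ^ e) (resSum₁₂ k f g m) = 0 := by
  induction e with
  | zero =>
    intro s d hsd k f g _ _ hfs hgs _ _ m
    obtain rfl : s = 0 := by omega
    have hf0 : f = 0 := hfs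
    have hg0 : g = 0 := hgs
    subst hf0 hg0
    funext q n
    change resSum k (0 : ℤ → ℤ → W) (0 : ℤ → ℤ → W) m q = 0
    have h := binSum_zero (W := W) k q m
    rw [resSum, binSum_zero]
    change 0 - (Int.negOnePow k : ℤ) • binSum k (0 : ℤ → ℤ → W) q m = 0
    rw [h, smul_zero, sub_zero]
  | succ e ih =>
    intro s d hsd k f g hf hg hfs hgs hfg hk m
    rcases s with _ | s
    · have hf0 : f = 0 := hfs
      have hg0 : g = 0 := hgs
      have : resSum₁₂ k f g m = 0 := by
        subst hf0 hg0
        funext q n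
        change resSum k (0 : ℤ → ℤ → W) (0 : ℤ → ℤ → W) m q = 0
        have h := binSum_zero (W := W) k q m
        rw [resSum, binSum_zero]
        change 0 - (Int.negOnePow k : ℤ) • binSum k (0 : ℤ → ℤ → W) q m = 0
        rw [h, smul_zero, sub_zero]
      rw [this, map_zero]
    · rcases d with _ | d
      · have : resSum₁₂ k f g m = 0 := by
          obtain ⟨K, rfl⟩ := Int.eq_ofNat_of_zero_le (show 0 ≤ k by omega)
          funext q n
          change resSum (K : ℤ) (fun m q => f m q n) (fun m q => g m q n) m q = 0
          rw [resSum_natCast K (hf n) (hg n),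
            diffOp_pow_eq_zero_of_le (N := t) (by omega)]
          · rfl
          · funext m q
            have := congrFun (congrFun (congrFun hfg m) q) n
            rw [diffOp₁₂_pow_apply] at this
            exact this
        rw [this, map_zero]
      · rw [pow_succ, addEnd_mul_apply, diffOp_resSum₁₂ k hf hg, map_sub,
          ih s (d + 1) (by omega) k _ _ hf.diffOp₁₃ hg.diffOp₁₃ _ _ _ hk,
          ih (s + 1) d (by omega) (k + 1) f g hf hg hfs hgs hfg (by push_cast at hk; omega), sub_zero]
        · rwa [pow_succ, addEnd_mul_apply] at hfs
        · rwa [pow_succ, addEnd_mul_apply] at hgs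
        · rw [← map_sub, ← addEnd_mul_apply,
            ← (commute_diffOp₁₃_diffOp₁₂ (W := W).pow_right t).eq, addEnd_mul_apply, hfg,
            map_zero]

end Differences

/-! ### Fields and their products -/

section Fields

variable {W : Type*} [AddCommGroup W] [Module ℂ W]

variable (W) in
/-- The fields on `W`: the families of modes `A n` such that, for every `w`, `A n w = 0` for all
large `n`. -/
def modeFields : Submodule ℂ (ℤ → Module.End ℂ W) where
  carrier := {A | ∀ w, ∃ N : ℤ, ∀ n, N ≤ n → A n w = 0}
  add_mem' := by
    intro A B hA hB w
    obtain ⟨N, hN⟩ := hA w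
    obtain ⟨N', hN'⟩ := hB w
    exact ⟨max N N', fun n hn => by
      simp [hN n (le_trans (le_max_left _ _) hn), hN' n (le_trans (le_max_right _ _) hn)]⟩
  zero_mem' := fun w => ⟨0, fun n _ => rfl⟩
  smul_mem' := by
    intro c A hA w
    obtain ⟨N, hN⟩ := hA w
    exact ⟨N, fun n hn => by simp [hN n hn]⟩

namespace modeFields

theorem truncRight_comp (A B : modeFields W) (w : W) :
    TruncRight fun m n => A.1 m (B.1 n w) := by
  obtain ⟨N, hN⟩ := B.2 w
  exact ⟨N, fun m n hn => by simp [hN n hn]⟩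

theorem truncLeft_comp (A B : modeFields W) (w : W) :
    TruncLeft fun m n => B.1 n (A.1 m w) := by
  obtain ⟨N, hN⟩ := A.2 w
  exact ⟨N, fun m n hn => by simp [hN m hn]⟩

theorem exists_common_bound (A : modeFields W) (v : ℕ → W) (K : ℕ) :
    ∃ N : ℤ, ∀ i < K, ∀ n, N ≤ n → A.1 n (v i) = 0 := by
  induction K with
  | zero => exact ⟨0, fun i hi => absurd hi (Nat.not_lt_zero i)⟩
  | succ K ih =>
    obtain ⟨N, hN⟩ := ih
    obtain ⟨N', hN'⟩ := A.2 (v K)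
    refine ⟨max N N', fun i hi n hn => ?_⟩
    rcases Nat.lt_succ_iff_lt_or_eq.mp hi with h | rfl
    · exact hN i h n (le_trans (le_max_left _ _) hn)
    · exact hN' n (le_trans (le_max_right _ _) hn)

/-- The left-hand side of the Jacobi identity for two fields. -/
noncomputable def jacobiSum (l : ℤ) (A B : modeFields W) (w : W) (m n : ℤ) : W :=
  resSum l (fun m n => A.1 m (B.1 n w)) (fun m n => B.1 n (A.1 m w)) m n

theorem jacobiSum_add (l : ℤ) (A B : modeFields W) (w w' : W) (m n : ℤ) :
    jacobiSum l A B (w + w') m n = jacobiSum l A B w m n + jacobiSum l A B w' m n := by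
  rw [jacobiSum, jacobiSum, jacobiSum, ← resSum_add l (truncRight_comp A B w)
    (truncLeft_comp A B w) (truncRight_comp A B w') (truncLeft_comp A B w')]
  simp only [map_add]
  rfl

theorem jacobiSum_smul (l : ℤ) (A B : modeFields W) (c : ℂ) (w : W) (m n : ℤ) :
    jacobiSum l A B (c • w) m n = c • jacobiSum l A B w m n := by
  have h := map_resSum (DistribSMul.toAddMonoidHom W c) l (truncRight_comp A B w)
    (truncLeft_comp A B w) m n
  simp only [DistribSMul.toAddMonoidHom_apply] at h
  rw [jacobiSum, jacobiSum, h]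
  simp only [map_smul]

theorem jacobiSum_succ (l : ℤ) (A B : modeFields W) (w : W) (m n : ℤ) :
    jacobiSum (l + 1) A B w m n = jacobiSum l A B w (m + 1) n - jacobiSum l A B w m (n + 1) :=
  resSum_succ l (truncRight_comp A B w) (truncLeft_comp A B w) m n

/-- Makes a product of fields a field. In the second half only finitely many vectors `A.1 (m + i) w`
are nonzero, so one truncation bound for `B` serves them all. -/
theorem jacobiSum_truncation (l : ℤ) (A B : modeFields W) (w : W) (m : ℤ) :
    ∃ N : ℤ, ∀ n, N ≤ n → jacobiSum l A B w m n = 0 := by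
  obtain ⟨N, hN⟩ := B.2 w
  obtain ⟨N', hN'⟩ := A.2 w
  obtain ⟨K, hK⟩ : ∃ K : ℕ, N' ≤ m + K := ⟨(N' - m).toNat, by omega⟩
  obtain ⟨N'', hN''⟩ := exists_common_bound B (fun i => A.1 (m + i) w) K
  refine ⟨max N (N'' - l + K), fun n hn => ?_⟩
  rw [jacobiSum, resSum,
    binSum_eq_zero_of_le (N := N) (fun m n hn => by simp [hN n hn]) l m (le_trans (le_max_left _ _) hn),
    binSum_eq_sum (N := N') (K := K) (fun m n hn => by simp [hN' n hn]) l n m hK,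
    Finset.sum_eq_zero, smul_zero, sub_zero]
  intro i hi
  have hi' := Finset.mem_range.mp hi
  have := le_trans (le_max_right _ _) hn
  rw [hN'' i hi' _ (by omega), smul_zero]

/-- The `l`-th product of two fields. -/
noncomputable def prod (l : ℤ) (A : modeFields W) : modeFields W →ₗ[ℂ] modeFields W where
  toFun B := ⟨fun n =>
    { toFun := fun w => jacobiSum l A B w 0 n
      map_add' := fun w w' => jacobiSum_add l A B w w' 0 n
      map_smul' := fun c w => jacobiSum_smul l A B c w 0 n },
    fun w => jacobiSum_truncation l A B w 0⟩
  map_add' B B' := by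
    apply Subtype.ext
    funext n
    ext w
    change jacobiSum l A (B + B') w 0 n = jacobiSum l A B w 0 n + jacobiSum l A B' w 0 n
    rw [jacobiSum, jacobiSum, jacobiSum, ← resSum_add l (truncRight_comp A B w)
      (truncLeft_comp A B w) (truncRight_comp A B' w) (truncLeft_comp A B' w)]
    congr 1
    funext m n
    exact map_add (A.1 m) _ _
  map_smul' c B := by
    apply Subtype.ext
    funext n
    ext w
    change jacobiSum l A (c • B) w 0 n = c • jacobiSum l A B w 0 n
    have h := map_resSum (DistribSMul.toAddMonoidHom W c) l (truncRight_comp A B w)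
      (truncLeft_comp A B w) 0 n
    simp only [DistribSMul.toAddMonoidHom_apply] at h
    rw [jacobiSum, jacobiSum, h]
    congr 1
    funext m n
    exact map_smul (A.1 m) c _

theorem prod_apply (l : ℤ) (A B : modeFields W) (n : ℤ) (w : W) :
    (prod l A B).1 n w = jacobiSum l A B w 0 n := rfl

theorem ext_apply {A B : modeFields W} (h : ∀ n w, A.1 n w = B.1 n w) : A = B :=
  Subtype.ext (funext fun n => LinearMap.ext fun w => h n w)

/-- Mutual locality of two fields. -/
def IsLocal (A B : modeFields W) : Prop :=
  ∃ N : ℕ, ∀ w, (diffOp W ^ N) (fun m n => A.1 m (B.1 n w) - B.1 n (A.1 m w)) = 0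

theorem IsLocal.symm {A B : modeFields W} (h : IsLocal A B) : IsLocal B A := by
  obtain ⟨N, hN⟩ := h
  refine ⟨N, fun w => ?_⟩
  have e : (fun m n => B.1 m (A.1 n w) - A.1 n (B.1 m w))
      = -(fun m n => A.1 n (B.1 m w) - B.1 m (A.1 n w)) := by
    funext m n
    exact (neg_sub _ _).symm
  rw [e, map_neg, neg_eq_zero]
  funext n m
  have := diffOp_pow_swap N (fun m n => A.1 m (B.1 n w) - B.1 n (A.1 m w)) m n
  rw [this, hN]
  simp

theorem IsLocal.jacobiSum_eq_zero {A B : modeFields W} (h : IsLocal A B) :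
    ∃ N : ℤ, ∀ l, N ≤ l → ∀ w m n, jacobiSum l A B w m n = 0 := by
  obtain ⟨N, hN⟩ := h
  refine ⟨N, fun l hl w m n => ?_⟩
  obtain ⟨L, rfl⟩ := Int.eq_ofNat_of_zero_le (show 0 ≤ l by omega)
  have h := diffOp_pow_eq_zero_of_le (N' := L) (by omega) (hN w)
  rw [jacobiSum, resSum_natCast L (truncRight_comp A B w) (truncLeft_comp A B w)]
  exact congrFun (congrFun h m) n

theorem IsLocal.exists_prod_eq_zero {A B : modeFields W} (h : IsLocal A B) :
    ∃ N : ℤ, ∀ l, N ≤ l → prod l A B = 0 := by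
  obtain ⟨N, hN⟩ := h.jacobiSum_eq_zero
  exact ⟨N, fun l hl => ext_apply fun n w => hN l hl w 0 n⟩

/-- The right-hand side of the Jacobi identity satisfies the recursion of the left-hand side. -/
theorem finsum_choose_recursion {X : Type*} [AddCommGroup X] (P : ℤ → ℤ → X) (N : ℤ)
    (hP : ∀ l k, N ≤ l → P l k = 0) (l m n : ℤ) :
    (∑ᶠ i : ℕ, (Ring.choose m i : ℤ) • P (l + 1 + i) (m + n - i))
      = (∑ᶠ i : ℕ, (Ring.choose (m + 1) i : ℤ) • P (l + i) (m + 1 + n - i))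
        - ∑ᶠ i : ℕ, (Ring.choose m i : ℤ) • P (l + i) (m + (n + 1) - i) := by
  obtain ⟨K, hK⟩ : ∃ K : ℕ, N ≤ l + K := ⟨(N - l).toNat, by omega⟩
  rw [finsum_eq_sum_range _ K (fun i hi => by rw [hP _ _ (by omega), smul_zero]),
    finsum_eq_sum_range _ (K + 1) (fun i hi => by rw [hP _ _ (by omega), smul_zero]),
    finsum_eq_sum_range _ (K + 1) (fun i hi => by rw [hP _ _ (by omega), smul_zero]),
    Finset.sum_range_succ', Finset.sum_range_succ']
  simp only [Ring.choose_succ_succ, add_smul, Finset.sum_add_distrib, Ring.choose_zero_right]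
  have e1 : ∀ i : ℕ, m + 1 + n - ((i + 1 : ℕ) : ℤ) = m + n - i := fun i => by push_cast; ring
  have e2 : ∀ i : ℕ, m + (n + 1) - ((i + 1 : ℕ) : ℤ) = m + n - i := fun i => by push_cast; ring
  have e3 : ∀ i : ℕ, l + ((i + 1 : ℕ) : ℤ) = l + 1 + i := fun i => by push_cast; ring
  have e4 : m + 1 + n - ((0 : ℕ) : ℤ) = m + (n + 1) - ((0 : ℕ) : ℤ) := by push_cast; ring
  simp only [e1, e2, e3, e4]
  abel

/-- Both sides satisfy the recursion of `(z - x)^l`, both vanish for large `l` by locality, and at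
`m = 0` they agree by the definition of `prod`; so `eq_zero_of_recursion` applies to their
difference. -/
theorem IsLocal.jacobi {A B : modeFields W} (h : IsLocal A B) (l m n : ℤ) (w : W) :
    jacobiSum l A B w m n
      = ∑ᶠ i : ℕ, (Ring.choose m i : ℤ) • (prod (l + i) A B).1 (m + n - i) w := by
  obtain ⟨N, hN⟩ := h.jacobiSum_eq_zero
  have hP : ∀ l k, N ≤ l → (prod l A B).1 k w = 0 := fun l k hl => hN l hl w 0 k
  have key := eq_zero_of_recursion (fun l m n => jacobiSum l A B w m n
    - ∑ᶠ i : ℕ, (Ring.choose m i : ℤ) • (prod (l + i) A B).1 (m + n - i) w) ?_ N ?_ ?_ l m n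
  · exact sub_eq_zero.mp key
  · intro l m n
    rw [jacobiSum_succ, finsum_choose_recursion (fun l k => (prod l A B).1 k w) N hP l m n]
    abel
  · intro l m n hl
    rw [hN l hl, finsum_eq_zero_of_forall_eq_zero, sub_zero]
    intro i
    rw [hP _ _ (by omega), smul_zero]
  · intro l n
    rw [finsum_eq_sum_range _ 1]
    · simp [prod_apply]
    · intro i hi
      obtain ⟨j, rfl⟩ := Nat.exists_eq_add_of_le' hi
      rw [Ring.choose_zero_succ, zero_smul]

theorem IsLocal.commutator {A B : modeFields W} (h : IsLocal A B) (m n : ℤ) (w : W) :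
    A.1 m (B.1 n w) - B.1 n (A.1 m w)
      = ∑ᶠ i : ℕ, (Ring.choose m i : ℤ) • (prod (i : ℤ) A B).1 (m + n - i) w := by
  have := h.jacobi 0 m n w
  rw [jacobiSum, resSum_zero_left] at this
  simpa using this

/-- Dong's lemma. -/
theorem IsLocal.prod {A B C : modeFields W} (hAB : IsLocal A B) (hAC : IsLocal A C)
    (hBC : IsLocal B C) (k : ℤ) : IsLocal (prod k A B) C := by
  obtain ⟨N₁, h₁⟩ := hAB
  obtain ⟨N₂, h₂⟩ := hAC
  obtain ⟨N₃, h₃⟩ := hBC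
  set N := max N₁ (max N₂ N₃) with hN
  replace h₁ := fun w => diffOp_pow_eq_zero_of_le (N' := N) (by omega) (h₁ w)
  replace h₂ := fun w => diffOp_pow_eq_zero_of_le (N' := N) (by omega) (h₂ w)
  replace h₃ := fun w => diffOp_pow_eq_zero_of_le (N' := N) (by omega) (h₃ w)
  -- The last `N` factors are used on the locality of `B` and `C`. The others are the `s + d` of
  -- `diffOp_pow_resSum₁₂_eq_zero`, with `s = N` and `d` chosen so that `N ≤ k + d`.
  refine ⟨(N + (N - k).toNat) + N, fun w => ?_⟩
  set f : ℤ → ℤ → ℤ → W := fun m q n => A.1 m (B.1 q (C.1 n w)) - C.1 n (A.1 m (B.1 q w)) with hf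
  set g : ℤ → ℤ → ℤ → W := fun m q n => B.1 q (A.1 m (C.1 n w)) - C.1 n (B.1 q (A.1 m w)) with hg
  have tf1 : ∀ n, TruncRight fun m q => A.1 m (B.1 q (C.1 n w)) := fun n => truncRight_comp A B _
  have tg1 : ∀ n, TruncLeft fun m q => B.1 q (A.1 m (C.1 n w)) := fun n => truncLeft_comp A B _
  have tf2 : ∀ n, TruncRight fun m q => C.1 n (A.1 m (B.1 q w)) := fun n => by
    obtain ⟨M, hM⟩ := truncRight_comp A B w
    exact ⟨M, fun m q hq => (congrArg (C.1 n) (hM m q hq)).trans (map_zero _)⟩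
  have tg2 : ∀ n, TruncLeft fun m q => C.1 n (B.1 q (A.1 m w)) := fun n => by
    obtain ⟨M, hM⟩ := truncLeft_comp A B w
    exact ⟨M, fun m q hq => (congrArg (C.1 n) (hM m q hq)).trans (map_zero _)⟩
  have tf : TruncMid f := fun n => (tf1 n).sub (tf2 n)
  have tg : TruncFst g := fun n => by
    obtain ⟨M, hM⟩ := tg1 n
    obtain ⟨M', hM'⟩ := tg2 n
    refine ⟨max M M', fun m q hm => ?_⟩
    simp only at hM hM' ⊢
    rw [hg]
    simp only
    rw [hM _ _ (le_trans (le_max_left _ _) hm), hM' _ _ (le_trans (le_max_right _ _) hm), sub_zero]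
  have e : (fun m n => (modeFields.prod k A B).1 m (C.1 n w) - C.1 n ((modeFields.prod k A B).1 m w))
      = resSum₁₂ k f g 0 := by
    funext q n
    rw [prod_apply, prod_apply, jacobiSum, jacobiSum]
    have h := map_resSum (C.1 n).toAddMonoidHom k (truncRight_comp A B w) (truncLeft_comp A B w) 0 q
    simp only [LinearMap.toAddMonoidHom_coe] at h
    rw [h, ← resSum_sub k (tf1 n) (tg1 n) (tf2 n) (tg2 n)]
    rfl
  have comm_zero : ∀ (F : ℤ → ℤ → ℤ → W), (∀ m, (diffOp W ^ N) (F m) = 0) →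
      (diffOp₂₃ W ^ N) F = 0 := fun F hF => by
    funext m q n
    rw [diffOp₂₃_pow_apply, hF]; rfl
  have comm_zero' : ∀ (F : ℤ → ℤ → ℤ → W), (∀ q, (diffOp W ^ N) (fun m n => F m q n) = 0) →
      (diffOp₁₃ W ^ N) F = 0 := fun F hF => by
    funext m q n
    rw [diffOp₁₃_pow_apply, hF]; rfl
  have comm_zero'' : ∀ (F : ℤ → ℤ → ℤ → W), (∀ n, (diffOp W ^ N) (fun m q => F m q n) = 0) →
      (diffOp₁₂ W ^ N) F = 0 := fun F hF => by
    funext m q n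
    rw [diffOp₁₂_pow_apply, hF]; rfl
  have comp_zero : ∀ (L : Module.End ℂ W) (h : ℤ → ℤ → W), (diffOp W ^ N) h = 0 →
      (diffOp W ^ N) (fun m n => L (h m n)) = 0 := fun L h hh => by
    funext m n
    have := diffOp_pow_map L.toAddMonoidHom N h m n
    simp only [LinearMap.toAddMonoidHom_coe] at this
    rw [this, hh]
    simp
  have hcomm : Commute (diffOp₁₃ W ^ N) (diffOp₂₃ W ^ N) :=
    (commute_diffOp₁₃_diffOp₂₃ (W := W)).pow_pow N N
  have hcomm' : Commute (diffOp₁₂ W ^ N) (diffOp₂₃ W ^ N) :=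
    (commute_diffOp₁₂_diffOp₂₃ (W := W)).pow_pow N N
  have kill : ∀ (F₁ F₂ : ℤ → ℤ → ℤ → W), (diffOp₂₃ W ^ N) F₁ = 0 → (diffOp₁₃ W ^ N) F₂ = 0 →
      (diffOp₁₃ W ^ N) ((diffOp₂₃ W ^ N) (F₁ + F₂)) = 0 := fun F₁ F₂ hF₁ hF₂ => by
    rw [map_add, map_add, hF₁, map_zero, zero_add, ← addEnd_mul_apply, hcomm.eq, addEnd_mul_apply,
      hF₂, map_zero]
  -- `[AB, C] = A[B, C] + [A, C]B`: the first summand dies under `(x₂ - x₃)^N`, the second under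
  -- `(x₁ - x₃)^N`.
  have hfs : (diffOp₁₃ W ^ N) ((diffOp₂₃ W ^ N) f) = 0 := by
    have : f = (fun m q n => A.1 m (B.1 q (C.1 n w) - C.1 n (B.1 q w)))
        + fun m q n => A.1 m (C.1 n (B.1 q w)) - C.1 n (A.1 m (B.1 q w)) := by
      funext m q n
      simp only [hf, Pi.add_apply, map_sub]
      abel
    rw [this]
    exact kill _ _ (comm_zero _ fun m => comp_zero (A.1 m) _ (h₃ w))
      (comm_zero' _ fun q => h₂ (B.1 q w))
  have hgs : (diffOp₁₃ W ^ N) ((diffOp₂₃ W ^ N) g) = 0 := by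
    have : g = (fun m q n => B.1 q (C.1 n (A.1 m w)) - C.1 n (B.1 q (A.1 m w)))
        + fun m q n => B.1 q (A.1 m (C.1 n w) - C.1 n (A.1 m w)) := by
      funext m q n
      simp only [hg, Pi.add_apply, map_sub]
      abel
    rw [this]
    exact kill _ _ (comm_zero _ fun m => h₃ (A.1 m w))
      (comm_zero' _ fun q => comp_zero (B.1 q) _ (h₂ w))
  -- Here `f - g` is `[[A, B], C]`, killed by `(x₁ - x₂)^N`.
  have hfg : (diffOp₁₂ W ^ N) ((diffOp₂₃ W ^ N) f - (diffOp₂₃ W ^ N) g) = 0 := by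
    have : f - g = (fun m q n => A.1 m (B.1 q (C.1 n w)) - B.1 q (A.1 m (C.1 n w)))
        - fun m q n => C.1 n (A.1 m (B.1 q w) - B.1 q (A.1 m w)) := by
      funext m q n
      simp only [hf, hg, Pi.sub_apply, map_sub]
      abel
    rw [← map_sub, ← addEnd_mul_apply, hcomm'.eq, addEnd_mul_apply, this, map_sub,
      comm_zero'' _ fun n => h₁ (C.1 n w), comm_zero'' _ fun n => comp_zero (C.1 n) _ (h₁ w),
      sub_zero, map_zero]
  rw [e, pow_add, addEnd_mul_apply, ← resSum₁₂_diffOp₂₃_pow k tf tg]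
  exact diffOp_pow_resSum₁₂_eq_zero N _ N _ rfl k _ _ (tf.diffOp₂₃_pow N) (tg.diffOp₂₃_pow N)
    hfs hgs hfg (by omega) 0

end modeFields

end Fields

/-! ### Identities for products of fields -/

section BinomialIdentities

variable {W : Type*} [AddCommGroup W]

/-- Both sides are the trinomial coefficient `Ring.choose k (i + r) * (i + r).choose i`. -/
theorem Ring_choose_mul_choose_sub (k : ℤ) (i r : ℕ) :
    Ring.choose k i * Ring.choose (k - i) r = Ring.choose k r * Ring.choose (k - r) i := by
  have h₁ := Ring.choose_smul_choose k (n := i + r) (k := i) (Nat.le_add_right _ _)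
  have h₂ := Ring.choose_smul_choose k (n := i + r) (k := r) (Nat.le_add_left _ _)
  rw [Nat.add_sub_cancel_left] at h₁
  rw [Nat.add_sub_cancel] at h₂
  rw [← h₁, ← h₂, Nat.choose_symm_add]

theorem sum_antidiagonal_altChoose (k l : ℤ) (t : ℕ) :
    ∑ p ∈ Finset.HasAntidiagonal.antidiagonal t, altChoose k p.1 * altChoose l p.2 = altChoose (k + l) t := by
  rw [altChoose, Ring.add_choose_eq t (Commute.all k l), Finset.mul_sum]
  refine Finset.sum_congr rfl fun p hp => ?_
  rw [← Finset.HasAntidiagonal.mem_antidiagonal.mp hp, altChoose, altChoose, pow_add]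
  ring

/-- Trinomial symmetry pulls `Ring.choose k r` out of the sum; Vandermonde does the rest. -/
theorem sum_antidiagonal_altChoose_choose_sub (k l : ℤ) (r t : ℕ) :
    ∑ p ∈ Finset.HasAntidiagonal.antidiagonal t,
        altChoose k p.1 * altChoose l p.2 * Ring.choose (k - p.1) r
      = Ring.choose k r * altChoose (k + l - r) t := by
  rw [show k + l - r = (k - r) + l by ring, ← sum_antidiagonal_altChoose, Finset.mul_sum]
  refine Finset.sum_congr rfl fun p _ => ?_
  have := Ring_choose_mul_choose_sub k p.1 r
  simp only [altChoose]
  linear_combination (-1) ^ p.1 * (-1) ^ p.2 * Ring.choose l p.2 * this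

/-- Terms with first index below `r` vanish; shifting that index by `r` yields the sign and again a
Vandermonde sum. -/
theorem sum_antidiagonal_altChoose_choose (k l : ℤ) (r s : ℕ) :
    ∑ p ∈ Finset.HasAntidiagonal.antidiagonal (s + r),
        altChoose k p.1 * altChoose l p.2 * Ring.choose (p.1 : ℤ) r
      = (-1) ^ r * Ring.choose k r * altChoose (k + l - r) s := by
  have h0 : ∑ p ∈ Finset.HasAntidiagonal.antidiagonal (s + r),
        altChoose k p.1 * altChoose l p.2 * Ring.choose (p.1 : ℤ) r
      = ∑ p ∈ (Finset.HasAntidiagonal.antidiagonal (s + r)).filter (fun p => r ≤ p.1),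
        altChoose k p.1 * altChoose l p.2 * Ring.choose (p.1 : ℤ) r := by
    symm
    apply Finset.sum_filter_of_ne
    intro p _ hp
    by_contra hr
    apply hp
    rw [Ring.choose_natCast, Nat.choose_eq_zero_of_lt (not_le.mp hr)]
    simp
  rw [h0, Finset.Nat.antidiagonal_filter_le_fst_of_le (Nat.le_add_left _ _), Finset.sum_map,
    Nat.add_sub_cancel, show k + l - r = (k - r) + l by ring, ← sum_antidiagonal_altChoose,
    Finset.mul_sum]
  refine Finset.sum_congr rfl fun p _ => ?_
  have h := Ring.choose_smul_choose k (n := p.1 + r) (k := r) (Nat.le_add_left _ _)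
  rw [Nat.add_sub_cancel, nsmul_eq_mul] at h
  simp only [Function.Embedding.prodMap, Function.Embedding.coeFn_mk, Prod.map,
    Function.Embedding.refl_apply, altChoose, Ring.choose_natCast]
  rw [pow_add]
  linear_combination (-1) ^ p.1 * (-1) ^ r * (-1) ^ p.2 * Ring.choose l p.2 * h

theorem sum_antidiagonal_altChoose_choose_of_lt (k l : ℤ) {r t : ℕ} (h : t < r) :
    ∑ p ∈ Finset.HasAntidiagonal.antidiagonal t,
        altChoose k p.1 * altChoose l p.2 * Ring.choose (p.1 : ℤ) r = 0 := by
  refine Finset.sum_eq_zero fun p hp => ?_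
  rw [Ring.choose_natCast, Nat.choose_eq_zero_of_lt
    (lt_of_le_of_lt (Finset.HasAntidiagonal.antidiagonal.fst_le hp) h)]
  simp

theorem finite_support_prod (X : ℕ × ℕ → W) (J : ℕ) (h : ∀ i j, J ≤ j → X (i, j) = 0)
    (h' : ∀ j, ∃ I, ∀ i, I ≤ i → X (i, j) = 0) : (Function.support X).Finite := by
  choose I hI using h'
  apply ((Finset.range ((Finset.range J).sup I)) ×ˢ Finset.range J).finite_toSet.subset
  rintro ⟨i, j⟩ hij
  have hj : j < J := by
    by_contra hj
    exact hij (h i j (not_lt.mp hj))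
  have hi : i < I j := by
    by_contra hi
    exact hij (hI j i (not_lt.mp hi))
  have : I j ≤ (Finset.range J).sup I := Finset.le_sup (Finset.mem_range.mpr hj)
  simp only [Finset.coe_product, Finset.coe_range, Set.mem_prod, Set.mem_Iio]
  exact ⟨lt_of_lt_of_le hi this, hj⟩

theorem finite_support_prod' (X : ℕ × ℕ → W) (I : ℕ) (h : ∀ i j, I ≤ i → X (i, j) = 0)
    (h' : ∀ i, ∃ J, ∀ j, J ≤ j → X (i, j) = 0) : (Function.support X).Finite := by
  have := finite_support_prod (X ∘ Prod.swap) I (fun i j hj => h j i hj) h'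
  rw [Function.support_comp_eq_preimage] at this
  have h2 := this.image Prod.swap
  rwa [Set.image_preimage_eq _ Prod.swap_surjective] at h2

theorem finsum_prod_eq_finsum_antidiagonal (c : ℕ × ℕ → ℤ) (X : ℕ → W) (K : ℕ)
    (hX : ∀ t, K ≤ t → X t = 0) :
    ∑ᶠ p : ℕ × ℕ, c p • X (p.1 + p.2)
      = ∑ᶠ t : ℕ, (∑ p ∈ Finset.HasAntidiagonal.antidiagonal t, c p) • X t := by
  rw [finsum_eq_sum_range _ K (fun t ht => by rw [hX t ht, smul_zero]),
    finsum_eq_sum_of_support_subset (s := (Finset.range K).biUnion Finset.HasAntidiagonal.antidiagonal),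
    Finset.sum_biUnion]
  · refine Finset.sum_congr rfl fun t _ => ?_
    rw [Finset.sum_smul]
    refine Finset.sum_congr rfl fun p hp => ?_
    rw [Finset.HasAntidiagonal.mem_antidiagonal.mp hp]
  · intro t _ t' _ htt'
    rw [Function.onFun, Finset.disjoint_left]
    intro p hp hp'
    exact htt' ((Finset.HasAntidiagonal.mem_antidiagonal.mp hp).symm.trans (Finset.HasAntidiagonal.mem_antidiagonal.mp hp'))
  · intro p hp
    simp only [Finset.coe_biUnion, Set.mem_iUnion, Finset.mem_coe, Finset.mem_range,
      Finset.HasAntidiagonal.mem_antidiagonal, exists_prop, exists_eq_right']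
    by_contra hK
    exact hp (by simp only [hX _ (not_lt.mp hK), smul_zero])

theorem finsum_prod_choose_sub (k l : ℤ) (r : ℕ) (X : ℕ → W) (K : ℕ)
    (hX : ∀ t, K ≤ t → X t = 0) :
    ∑ᶠ p : ℕ × ℕ, (altChoose k p.1 * altChoose l p.2 * Ring.choose (k - p.1) r) • X (p.1 + p.2)
      = Ring.choose k r • ∑ᶠ t : ℕ, altChoose (k + l - r) t • X t := by
  rw [finsum_prod_eq_finsum_antidiagonal _ X K hX,
    finsum_eq_sum_range _ K (fun t ht => by rw [hX t ht, smul_zero]),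
    finsum_eq_sum_range _ K (fun t ht => by rw [hX t ht, smul_zero]), Finset.smul_sum]
  refine Finset.sum_congr rfl fun t _ => ?_
  rw [sum_antidiagonal_altChoose_choose_sub, mul_smul]

theorem finsum_prod_choose (k l : ℤ) (r : ℕ) (X : ℕ → W) (K : ℕ)
    (hX : ∀ t, K ≤ t → X t = 0) :
    ∑ᶠ p : ℕ × ℕ, (altChoose k p.1 * altChoose l p.2 * Ring.choose (p.1 : ℤ) r) • X (p.1 + p.2)
      = Ring.choose k r • (-1 : ℤ) ^ r • ∑ᶠ t : ℕ, altChoose (k + l - r) t • X (t + r) := by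
  rw [finsum_prod_eq_finsum_antidiagonal _ X K hX,
    finsum_eq_sum_range _ (r + K) (fun t ht => by rw [hX t (by omega), smul_zero]),
    finsum_eq_sum_range _ K (fun t ht => by rw [hX _ (by omega), smul_zero]),
    Finset.sum_range_add, Finset.sum_eq_zero, zero_add, Finset.smul_sum, Finset.smul_sum]
  · refine Finset.sum_congr rfl fun t _ => ?_
    rw [add_comm r t, sum_antidiagonal_altChoose_choose, mul_smul, mul_smul, smul_comm]
  · intro t ht
    rw [sum_antidiagonal_altChoose_choose_of_lt k l (Finset.mem_range.mp ht), zero_smul]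

end BinomialIdentities

/-! ### The commutator formula for products of fields -/

namespace modeFields

variable {W : Type*} [AddCommGroup W] [Module ℂ W]

theorem jacobiSum_eq_finsum (l : ℤ) (A B : modeFields W) (w : W) (m n : ℤ) :
    jacobiSum l A B w m n = ∑ᶠ i : ℕ, altChoose l i •
      (A.1 (m + l - i) (B.1 (n + i) w)
        - (Int.negOnePow l : ℤ) • B.1 (n + l - i) (A.1 (m + i) w)) :=
  resSum_eq_finsum l (truncRight_comp A B w) (truncLeft_comp A B w) m n

theorem jacobiSum_support (l : ℤ) (A B : modeFields W) (w : W) (m n : ℤ) :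
    ∃ K : ℕ, ∀ i : ℕ, K ≤ i → altChoose l i • (A.1 (m + l - i) (B.1 (n + i) w)
        - (Int.negOnePow l : ℤ) • B.1 (n + l - i) (A.1 (m + i) w)) = 0 := by
  obtain ⟨N, hN⟩ := B.2 w
  obtain ⟨N', hN'⟩ := A.2 w
  refine ⟨(max (N - n) (N' - m)).toNat, fun i hi => ?_⟩
  rw [hN _ (by omega), hN' _ (by omega)]
  simp

/-- The summands of the expansion of `(A_k (B_l C))_n w`. -/
noncomputable def doubleTerm (k l : ℤ) (A B C : modeFields W) (n : ℤ) (w : W) (p : ℕ × ℕ) : W :=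
  A.1 (k - p.1) (B.1 (l - p.2) (C.1 (n + p.1 + p.2) w))
    - (Int.negOnePow l : ℤ) • A.1 (k - p.1) (C.1 (n + l + p.1 - p.2) (B.1 p.2 w))
    - (Int.negOnePow k : ℤ) • B.1 (l - p.2) (C.1 (n + k - p.1 + p.2) (A.1 p.1 w))
    + (Int.negOnePow k * Int.negOnePow l : ℤ) •
      C.1 (n + k + l - p.1 - p.2) (B.1 p.2 (A.1 p.1 w))

theorem finite_support_doubleTerm (k l : ℤ) (A B C : modeFields W) (n : ℤ) (w : W)
    (c : ℕ × ℕ → ℤ) :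
    (Function.support fun p => c p • doubleTerm k l A B C n w p).Finite := by
  have bound : ∀ (D : modeFields W) (v : W) (n : ℤ),
      ∃ K : ℕ, ∀ i : ℤ, n + K ≤ i → D.1 i v = 0 := fun D v n => by
    obtain ⟨N, hN⟩ := D.2 v
    exact ⟨(N - n).toNat, fun i hi => hN i (by omega)⟩
  have h₁ : (Function.support fun p : ℕ × ℕ =>
      A.1 (k - p.1) (B.1 (l - p.2) (C.1 (n + p.1 + p.2) w))).Finite := by
    obtain ⟨K, hK⟩ := bound C w n
    apply finite_support_prod _ K
    · intro i j hj
      dsimp only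
      rw [hK _ (by omega), map_zero, map_zero]
    · intro j
      refine ⟨K, fun i hi => ?_⟩
      dsimp only
      rw [hK _ (by omega), map_zero, map_zero]
  have h₂ : (Function.support fun p : ℕ × ℕ =>
      A.1 (k - p.1) (C.1 (n + l + p.1 - p.2) (B.1 p.2 w))).Finite := by
    obtain ⟨K, hK⟩ := bound B w 0
    apply finite_support_prod _ K
    · intro i j hj
      dsimp only
      rw [hK _ (by omega), map_zero, map_zero]
    · intro j
      obtain ⟨K', hK'⟩ := bound C (B.1 j w) (n + l - j)
      refine ⟨K', fun i hi => ?_⟩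
      dsimp only
      rw [hK' _ (by omega), map_zero]
  have h₃ : (Function.support fun p : ℕ × ℕ =>
      B.1 (l - p.2) (C.1 (n + k - p.1 + p.2) (A.1 p.1 w))).Finite := by
    obtain ⟨K, hK⟩ := bound A w 0
    apply finite_support_prod' _ K
    · intro i j hi
      dsimp only
      rw [hK _ (by omega), map_zero, map_zero]
    · intro i
      obtain ⟨K', hK'⟩ := bound C (A.1 i w) (n + k - i)
      refine ⟨K', fun j hj => ?_⟩
      dsimp only
      rw [hK' _ (by omega), map_zero]
  have h₄ : (Function.support fun p : ℕ × ℕ =>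
      C.1 (n + k + l - p.1 - p.2) (B.1 p.2 (A.1 p.1 w))).Finite := by
    obtain ⟨K, hK⟩ := bound A w 0
    apply finite_support_prod' _ K
    · intro i j hi
      dsimp only
      rw [hK _ (by omega), map_zero, map_zero]
    · intro i
      obtain ⟨K', hK'⟩ := bound B (A.1 i w) 0
      refine ⟨K', fun j hj => ?_⟩
      dsimp only
      rw [hK' _ (by omega), map_zero]
  apply (((h₁.union h₂).union h₃).union h₄).subset
  intro p hp
  by_contra hc
  simp only [Set.mem_union, not_or, Function.notMem_support] at hc
  apply hp
  dsimp only
  rw [doubleTerm, hc.1.1.1, hc.1.1.2, hc.1.2, hc.2]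
  simp

theorem prod_prod_apply (k l : ℤ) (A B C : modeFields W) (n : ℤ) (w : W) :
    (prod k A (prod l B C)).1 n w
      = ∑ᶠ p : ℕ × ℕ, (altChoose k p.1 * altChoose l p.2) • doubleTerm k l A B C n w p := by
  rw [finsum_curry _ (finite_support_doubleTerm k l A B C n w _), prod_apply, jacobiSum_eq_finsum]
  refine finsum_congr fun i => ?_
  rw [prod_apply, prod_apply, jacobiSum_eq_finsum, jacobiSum_eq_finsum]
  -- The two inner sums have different lengths and must be cut at a common one before they can be
  -- merged term by term.
  obtain ⟨K, hK⟩ := jacobiSum_support l B C w 0 (n + i)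
  obtain ⟨K', hK'⟩ := jacobiSum_support l B C (A.1 (0 + i) w) 0 (n + k - i)
  rw [finsum_eq_sum_range _ (max K K') (fun j hj => hK j (le_trans (le_max_left _ _) hj)),
    finsum_eq_sum_range _ (max K K') (fun j hj => hK' j (le_trans (le_max_right _ _) hj)),
    finsum_eq_sum_range _ (max K K')]
  · rw [map_sum, Finset.smul_sum, ← Finset.sum_sub_distrib, Finset.smul_sum]
    refine Finset.sum_congr rfl fun j _ => ?_
    rw [map_zsmul, map_sub, map_zsmul, doubleTerm]
    simp only [zero_add]
    rw [show n + (i : ℤ) + l - j = n + l + i - j by ring,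
      show n + k - (i : ℤ) + l - j = n + k + l - i - j by ring]
    module
  · intro j hj
    have e₁ := congrArg (A.1 (k - i)) (hK j (le_trans (le_max_left _ _) hj))
    have e₂ := hK' j (le_trans (le_max_right _ _) hj)
    rw [map_zsmul, map_sub, map_zsmul, map_zero] at e₁
    rw [doubleTerm]
    simp only [zero_add] at e₁ e₂ ⊢
    rw [show n + (i : ℤ) + l - j = n + l + i - j by ring] at e₁
    rw [show n + k - (i : ℤ) + l - j = n + k + l - i - j by ring] at e₂
    have := congrArg₂ (fun x y => altChoose k i • x - (altChoose k i * Int.negOnePow k) • y) e₁ e₂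
    simp only [smul_zero, sub_zero] at this
    rw [← this]
    module

/-- The terms of `doubleTerm` with `C` between `A` and `B` cancel in the difference; what remains is
`[A, B]C` and `C[A, B]`. -/
theorem prod_prod_sub_apply (k l : ℤ) (A B C : modeFields W) (n : ℤ) (w : W) :
    (prod k A (prod l B C)).1 n w - (prod l B (prod k A C)).1 n w
      = ∑ᶠ p : ℕ × ℕ, (altChoose k p.1 * altChoose l p.2) •
        ((A.1 (k - p.1) (B.1 (l - p.2) (C.1 (n + p.1 + p.2) w))
          - B.1 (l - p.2) (A.1 (k - p.1) (C.1 (n + p.1 + p.2) w)))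
        - (Int.negOnePow k * Int.negOnePow l : ℤ) •
          C.1 (n + k + l - p.1 - p.2) (A.1 p.1 (B.1 p.2 w) - B.1 p.2 (A.1 p.1 w))) := by
  rw [prod_prod_apply, prod_prod_apply, ← finsum_comp_equiv (Equiv.prodComm ℕ ℕ)
      (f := fun p => (altChoose l p.1 * altChoose k p.2) • doubleTerm l k B A C n w p),
    ← finsum_sub_distrib (finite_support_doubleTerm k l A B C n w _)]
  · refine finsum_congr fun p => ?_
    rw [doubleTerm, doubleTerm]
    simp only [Equiv.prodComm_apply, Prod.fst_swap, Prod.snd_swap]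
    rw [show n + (p.2 : ℤ) + p.1 = n + p.1 + p.2 by ring,
      show n + k + (p.2 : ℤ) - p.1 = n + k - p.1 + p.2 by ring,
      show n + l - (p.2 : ℤ) + p.1 = n + l + p.1 - p.2 by ring,
      show n + l + k - (p.2 : ℤ) - p.1 = n + k + l - p.1 - p.2 by ring, map_sub]
    module
  · have := finite_support_doubleTerm l k B A C n w
      (fun p => altChoose l p.1 * altChoose k p.2)
    exact this.preimage (Equiv.prodComm ℕ ℕ).injective.injOn

/-- The commutator formula for products with mutually local fields. -/
theorem prod_prod_sub_of_isLocal {A B : modeFields W} (h : IsLocal A B) (C : modeFields W)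
    (k l : ℤ) : prod k A (prod l B C) - prod l B (prod k A C)
      = ∑ᶠ r : ℕ, (Ring.choose k r : ℤ) • prod (k + l - r) (prod (r : ℤ) A B) C := by
  obtain ⟨N, hN⟩ := h.exists_prod_eq_zero
  obtain ⟨R, hR⟩ : ∃ R : ℕ, N ≤ R := ⟨N.toNat, Int.self_le_toNat N⟩
  have hz : ∀ r : ℕ, R ≤ r → prod (r : ℤ) A B = 0 := fun r hr => hN _ (by omega)
  have zero_prod : ∀ q, prod q (0 : modeFields W) C = 0 := fun q => ext_apply fun n w => by
    rw [prod_apply, jacobiSum_eq_finsum]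
    simp
  have comm : ∀ (m q : ℤ) (v : W), A.1 m (B.1 q v) - B.1 q (A.1 m v)
      = ∑ r ∈ Finset.range R, (Ring.choose m r : ℤ) • (prod (r : ℤ) A B).1 (m + q - r) v := by
    intro m q v
    rw [h.commutator, finsum_eq_sum_range _ R]
    intro r hr
    rw [hz r hr]
    simp
  rw [finsum_eq_sum_range _ R (fun r hr => by rw [hz r hr, zero_prod, smul_zero])]
  refine ext_apply fun n w => ?_
  change (prod k A (prod l B C)).1 n w - (prod l B (prod k A C)).1 n w = _
  have e : ∀ (s : Finset ℕ) (F : ℕ → modeFields W),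
      (∑ r ∈ s, F r).1 n w = ∑ r ∈ s, (F r).1 n w := by
    intro s F
    rw [AddSubmonoidClass.coe_finsetSum, Finset.sum_apply, LinearMap.sum_apply]
  rw [e, prod_prod_sub_apply]
  obtain ⟨M, hM⟩ := C.2 w
  obtain ⟨K, hK⟩ : ∃ K : ℕ, M ≤ n + K := ⟨(M - n).toNat, by omega⟩
  have hX : ∀ r t : ℕ, K ≤ t →
      (prod (r : ℤ) A B).1 (k + l - r - t) (C.1 (n + t) w) = 0 := by
    intro r t ht
    rw [hM _ (by omega), map_zero]
  have hY : ∀ r : ℕ, ∃ K : ℕ, ∀ t : ℕ, K ≤ t →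
      C.1 (n + k + l - t) ((prod (r : ℤ) A B).1 (t - r) w) = 0 := by
    intro r
    obtain ⟨M, hM⟩ := (prod (r : ℤ) A B).2 w
    exact ⟨(M + r).toNat, fun t ht => by rw [hM _ (by omega), map_zero]⟩
  choose K' hY using hY
  have fX : ∀ r : ℕ, (Function.support fun p : ℕ × ℕ =>
      (altChoose k p.1 * altChoose l p.2 * Ring.choose (k - p.1) r) •
        (prod (r : ℤ) A B).1 (k + l - r - (p.1 + p.2 : ℕ)) (C.1 (n + (p.1 + p.2 : ℕ)) w)).Finite := by
    intro r
    apply finite_support_prod _ K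
    · intro i j hj
      rw [hX r (i + j) (by omega), smul_zero]
    · exact fun j => ⟨K, fun i hi => by rw [hX r (i + j) (by omega), smul_zero]⟩
  have fY : ∀ r : ℕ, (Function.support fun p : ℕ × ℕ =>
      (altChoose k p.1 * altChoose l p.2 * Ring.choose (p.1 : ℤ) r) •
        C.1 (n + k + l - (p.1 + p.2 : ℕ))
          ((prod (r : ℤ) A B).1 ((p.1 + p.2 : ℕ) - r) w)).Finite := by
    intro r
    apply finite_support_prod _ (K' r)
    · intro i j hj
      rw [hY r (i + j) (by omega), smul_zero]
    · exact fun j => ⟨K' r, fun i hi => by rw [hY r (i + j) (by omega), smul_zero]⟩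
  have fY' : ∀ r : ℕ, (Function.support fun p : ℕ × ℕ =>
      (Int.negOnePow k * Int.negOnePow l : ℤ) •
      (altChoose k p.1 * altChoose l p.2 * Ring.choose (p.1 : ℤ) r) •
        C.1 (n + k + l - (p.1 + p.2 : ℕ))
          ((prod (r : ℤ) A B).1 ((p.1 + p.2 : ℕ) - r) w)).Finite := fun r =>
    (fY r).subset fun p hp h0 => hp (by
      dsimp only at h0 ⊢
      rw [h0, smul_zero])
  have expand : ∀ p : ℕ × ℕ, (altChoose k p.1 * altChoose l p.2) •
        ((A.1 (k - p.1) (B.1 (l - p.2) (C.1 (n + p.1 + p.2) w))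
          - B.1 (l - p.2) (A.1 (k - p.1) (C.1 (n + p.1 + p.2) w)))
        - (Int.negOnePow k * Int.negOnePow l : ℤ) •
          C.1 (n + k + l - p.1 - p.2) (A.1 p.1 (B.1 p.2 w) - B.1 p.2 (A.1 p.1 w)))
      = ∑ r ∈ Finset.range R, ((altChoose k p.1 * altChoose l p.2 * Ring.choose (k - p.1) r) •
        (prod (r : ℤ) A B).1 (k + l - r - (p.1 + p.2 : ℕ)) (C.1 (n + (p.1 + p.2 : ℕ)) w)
        - (Int.negOnePow k * Int.negOnePow l : ℤ) •
        (altChoose k p.1 * altChoose l p.2 * Ring.choose (p.1 : ℤ) r) •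
        C.1 (n + k + l - (p.1 + p.2 : ℕ)) ((prod (r : ℤ) A B).1 ((p.1 + p.2 : ℕ) - r) w)) := by
    intro p
    rw [comm, comm, map_sum, Finset.smul_sum, ← Finset.sum_sub_distrib, Finset.smul_sum]
    refine Finset.sum_congr rfl fun r _ => ?_
    rw [map_zsmul, show k - (p.1 : ℤ) + (l - p.2) - r = k + l - r - (p.1 + p.2 : ℕ) by
        push_cast; ring, show n + (p.1 : ℤ) + p.2 = n + (p.1 + p.2 : ℕ) by push_cast; ring,
      show n + k + l - (p.1 : ℤ) - p.2 = n + k + l - (p.1 + p.2 : ℕ) by push_cast; ring,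
      show (p.1 : ℤ) + p.2 - r = (p.1 + p.2 : ℕ) - r by push_cast; ring]
    module
  -- For fixed `r`, the sum over pairs depends on `p.1 + p.2` up to a binomial weight, `Ring.choose
  -- (k - p.1) r` where `C` acts first and `Ring.choose p.1 r` where it acts last. The two closed
  -- forms are the two halves of the product of `prod r A B` with `C`.
  rw [finsum_congr expand, finsum_sum_comm]
  · refine Finset.sum_congr rfl fun r _ => ?_
    have hsm := (zsmulAddGroupHom (Int.negOnePow k * Int.negOnePow l : ℤ) : W →+ W).map_finsum (fY r)
    simp only [zsmulAddGroupHom_apply] at hsm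
    rw [finsum_sub_distrib (fX r) (fY' r), ← hsm,
      finsum_prod_choose_sub k l r
        (fun t => (prod (r : ℤ) A B).1 (k + l - r - t) (C.1 (n + t) w)) K (hX r),
      finsum_prod_choose k l r
        (fun t => C.1 (n + k + l - t) ((prod (r : ℤ) A B).1 (t - r) w)) (K' r) (hY r)]
    change _ = (Ring.choose k r : ℤ) • (prod (k + l - r) (prod (r : ℤ) A B) C).1 n w
    rw [prod_apply, jacobiSum, resSum, binSum, binSum, smul_sub]
    have hs : (Int.negOnePow (k + l - r) : ℤ)
        = Int.negOnePow k * Int.negOnePow l * (-1) ^ r := by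
      rw [Int.negOnePow_sub, Int.negOnePow_add, Int.negOnePow_def (r : ℤ), zpow_natCast]
      push_cast
      rfl
    rw [hs]
    have e₁ : ∀ t : ℕ, n + k + l - ((t + r : ℕ) : ℤ) = n + (k + l - r) - t := fun t => by
      push_cast; ring
    have e₂ : ∀ t : ℕ, ((t + r : ℕ) : ℤ) - r = t := fun t => by push_cast; ring
    simp only [e₁, e₂, zero_add]
    module
  · intro r _
    exact ((fX r).union (fY' r)).subset fun p hp => by
      by_contra hc
      simp only [Set.mem_union, not_or, Function.notMem_support] at hc
      exact hp (by dsimp only; rw [hc.1, hc.2, sub_zero])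

end modeFields

/-! ### The identity field and the derivative of a field -/

theorem altChoose_neg_one (i : ℕ) : altChoose (-1) i = 1 := by
  induction i with
  | zero => exact altChoose_zero_right _
  | succ i ih =>
    have := altChoose_succ_succ (-1) i
    rw [neg_add_cancel, altChoose_zero_succ, ih] at this
    exact (sub_eq_zero.mp this.symm)

/-- This and the next lemma are the derivatives of `(z - x)^k` in `z` and in `x`, on coefficients.
-/
theorem sub_mul_altChoose (k : ℤ) (i : ℕ) : (k - i) * altChoose k i = k * altChoose (k - 1) i := by
  have := Ring_choose_mul_choose_sub k i 1
  rw [Ring.choose_one_right, Ring.choose_one_right, Nat.cast_one] at this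
  simp only [altChoose]
  linear_combination (-1) ^ i * this

theorem succ_mul_altChoose (k : ℤ) (i : ℕ) :
    ((i : ℤ) + 1) * altChoose k (i + 1) = -(k * altChoose (k - 1) i) := by
  have := Ring.choose_smul_choose k (n := i + 1) (k := 1) (Nat.le_add_left _ _)
  rw [Ring.choose_one_right, Nat.choose_one_right, nsmul_eq_mul, Nat.add_sub_cancel, Nat.cast_one] at this
  push_cast at this
  simp only [altChoose, pow_succ]
  linear_combination -(-1) ^ i * this

namespace modeFields

variable {W : Type*} [AddCommGroup W] [Module ℂ W]

variable (W) in
/-- The identity field. -/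
def idField : modeFields W :=
  ⟨fun n => if n = -1 then 1 else 0, fun w => ⟨0, fun n hn => by
    dsimp only
    rw [if_neg (by omega)]; rfl⟩⟩

theorem idField_apply (n : ℤ) (w : W) : (idField W).1 n w = if n = -1 then w else 0 := by
  change (if n = -1 then (1 : Module.End ℂ W) else 0) w = _
  split_ifs <;> rfl

theorem idField_apply_of_ne {n : ℤ} (hn : n ≠ -1) (w : W) : (idField W).1 n w = 0 := by
  rw [idField_apply, if_neg hn]

theorem isLocal_idField (A : modeFields W) : IsLocal A (idField W) := by
  refine ⟨0, fun w => ?_⟩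
  funext m n
  change A.1 m ((idField W).1 n w) - (idField W).1 n (A.1 m w) = 0
  rw [idField_apply, idField_apply]
  split_ifs <;> simp

theorem prod_idField_of_nonneg (A : modeFields W) {l : ℤ} (hl : 0 ≤ l) :
    prod l A (idField W) = 0 := by
  obtain ⟨L, rfl⟩ := Int.eq_ofNat_of_zero_le hl
  refine ext_apply fun n w => ?_
  rw [prod_apply, jacobiSum, resSum_natCast L (truncRight_comp A _ w) (truncLeft_comp A _ w)]
  have : (fun m n => A.1 m ((idField W).1 n w)) - (fun m n => (idField W).1 n (A.1 m w)) = 0 := by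
    funext m n
    change A.1 m ((idField W).1 n w) - (idField W).1 n (A.1 m w) = 0
    rw [idField_apply, idField_apply]
    split_ifs <;> simp
  rw [this, map_zero]
  rfl

theorem prod_neg_one_idField (A : modeFields W) : prod (-1) A (idField W) = A := by
  refine ext_apply fun n w => ?_
  rw [prod_apply, jacobiSum_eq_finsum]
  simp only [altChoose_neg_one, one_smul, Int.negOnePow_neg, Int.negOnePow_one, Units.val_neg,
    Units.val_one, neg_smul, sub_neg_eq_add, zero_add]
  -- The two expansions of `(z - x)⁻¹` complement each other: for `n ≥ 0` only the second half
  -- contributes, for `n < 0` only the first.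
  rcases le_or_gt 0 n with hn | hn
  · obtain ⟨k, rfl⟩ := Int.eq_ofNat_of_zero_le hn
    rw [finsum_eq_single _ k]
    · rw [idField_apply_of_ne (by omega), idField_apply, if_pos (by ring), map_zero, zero_add]
    · intro i hi
      rw [idField_apply_of_ne (by omega), idField_apply_of_ne (by omega), map_zero, zero_add]
  · obtain ⟨k, hk⟩ := Int.eq_ofNat_of_zero_le (show 0 ≤ -1 - n by omega)
    rw [finsum_eq_single _ k]
    · rw [idField_apply, if_pos (by omega), idField_apply_of_ne (by omega), add_zero]
      rw [show (-1 : ℤ) - k = n by omega]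
    · intro i hi
      rw [idField_apply_of_ne (by omega), idField_apply_of_ne (by omega), map_zero, zero_add]

/-- Multiples are allowed because the zeroth products of generating fields are `commCoeff s t •
idField W`; the case `c = 0` handles products with the zero field. -/
theorem zsmul_idField_prod (c l : ℤ) (B : modeFields W) :
    prod l (c • idField W) B = if l = -1 then c • B else 0 := by
  refine ext_apply fun n w => ?_
  rw [prod_apply, jacobiSum_eq_finsum]
  have e : ∀ (m : ℤ) (v : W), (c • idField W).1 m v = if m = -1 then c • v else 0 := by
    intro m v
    change c • (idField W).1 m v = _
    rw [idField_apply]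
    split_ifs <;> simp
  split_ifs with h
  · subst h
    rw [finsum_eq_single _ 0]
    · rw [e, e, if_pos (by simp), if_neg (by simp), altChoose_zero_right]
      simp only [map_zero, smul_zero, sub_zero, one_smul, Nat.cast_zero, add_zero]
      rfl
    · intro i hi
      rw [e, e, if_neg (by omega), if_neg (by omega)]
      simp
  · rw [finsum_eq_zero_of_forall_eq_zero]
    · rfl
    intro i
    rw [e, e, if_neg (c := (0 : ℤ) + i = -1) (by omega), map_zero, smul_zero, sub_zero]
    -- The only index that could contribute is `i = l + 1`. Then `l ≥ 0`, and its binomial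
    -- coefficient is zero.
    by_cases hi : 0 + l - (i : ℤ) = -1
    · obtain ⟨L, rfl⟩ := Int.eq_ofNat_of_zero_le (show 0 ≤ l by omega)
      rw [altChoose, Ring.choose_natCast, Nat.choose_eq_zero_of_lt (by omega)]
      simp
    · rw [if_neg hi, smul_zero]

/-- The derivative of a field. -/
def deriv : modeFields W →ₗ[ℂ] modeFields W where
  toFun A := ⟨fun n => (-n) • A.1 (n - 1), fun w => by
    obtain ⟨N, hN⟩ := A.2 w
    exact ⟨N + 1, fun n hn => by rw [LinearMap.smul_apply, hN _ (by omega), smul_zero]⟩⟩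
  map_add' A B := ext_apply fun n w => by
    change (-n) • (A.1 (n - 1) w + B.1 (n - 1) w) = _
    rw [smul_add]
    rfl
  map_smul' c A := ext_apply fun n w => by
    change (-n) • c • A.1 (n - 1) w = c • (-n) • A.1 (n - 1) w
    rw [smul_comm]

theorem deriv_apply (A : modeFields W) (n : ℤ) (w : W) :
    (deriv A).1 n w = (-n) • A.1 (n - 1) w := rfl

theorem jacobiSum_zero_eq_sum (l : ℤ) (A B : modeFields W) (w : W) (n : ℤ) {N : ℤ}
    (hA : ∀ i, N ≤ i → A.1 i w = 0) (hB : ∀ i, N ≤ i → B.1 i w = 0) {K : ℕ} (hK : N ≤ K)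
    (hK' : N ≤ n + K) : jacobiSum l A B w 0 n = ∑ i ∈ Finset.range K, altChoose l i •
      (A.1 (l - i) (B.1 (n + i) w) - (Int.negOnePow l : ℤ) • B.1 (n + l - i) (A.1 i w)) := by
  rw [jacobiSum_eq_finsum, finsum_eq_sum_range _ K]
  · simp only [zero_add]
  · intro i hi
    rw [hA _ (by omega), hB _ (by omega)]
    simp

theorem exists_bound (A B : modeFields W) (w : W) :
    ∃ N : ℤ, (∀ i, N ≤ i → A.1 i w = 0) ∧ ∀ i, N ≤ i → B.1 i w = 0 := by
  obtain ⟨N, hN⟩ := A.2 w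
  obtain ⟨N', hN'⟩ := B.2 w
  exact ⟨max N N', fun i hi => hN i (le_trans (le_max_left _ _) hi),
    fun i hi => hN' i (le_trans (le_max_right _ _) hi)⟩

theorem deriv_prod_left (k : ℤ) (A B : modeFields W) :
    prod k (deriv A) B = (-k) • prod (k - 1) A B := by
  refine ext_apply fun n w => ?_
  change jacobiSum k (deriv A) B w 0 n = (-k) • jacobiSum (k - 1) A B w 0 n
  obtain ⟨N, hA, hB⟩ := exists_bound A B w
  obtain ⟨K, hK, hK'⟩ : ∃ K : ℕ, N ≤ K ∧ N ≤ n + K :=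
    ⟨(max N (N - n)).toNat, by omega, by omega⟩
  rw [jacobiSum_zero_eq_sum k (deriv A) B w n (N := N + 1) (K := K + 1)
    (fun i hi => by rw [deriv_apply, hA _ (by omega), smul_zero]) (fun i hi => hB _ (by omega))
    (by push_cast; omega) (by push_cast; omega),
    jacobiSum_zero_eq_sum (k - 1) A B w n hA hB hK hK']
  simp only [smul_sub, Finset.sum_sub_distrib, Finset.smul_sum]
  congr 1
  · rw [Finset.sum_range_succ, hB _ (by omega), map_zero, smul_zero, add_zero]
    refine Finset.sum_congr rfl fun i _ => ?_
    rw [deriv_apply, smul_smul, smul_smul, show k - (i : ℤ) - 1 = k - 1 - i by ring]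
    congr 1
    linear_combination -sub_mul_altChoose k i
  · rw [Finset.sum_range_succ', deriv_apply]
    simp only [deriv_apply, Nat.cast_zero, neg_zero, zero_smul, map_zero, smul_zero, add_zero]
    refine Finset.sum_congr rfl fun i _ => ?_
    rw [map_zsmul, smul_smul, smul_smul, smul_smul, smul_smul, Int.negOnePow_sub,
      Int.negOnePow_one, show ((i + 1 : ℕ) : ℤ) - 1 = i by push_cast; ring,
      show n + k - ((i + 1 : ℕ) : ℤ) = n + (k - 1) - i by push_cast; ring]
    congr 1
    push_cast
    linear_combination (-(Int.negOnePow k : ℤ)) * succ_mul_altChoose k i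

/-- The Leibniz rule, with the term of `deriv A` already rewritten as in `deriv_prod_left`. -/
theorem deriv_prod (k : ℤ) (A B : modeFields W) :
    deriv (prod k A B) = (-k) • prod (k - 1) A B + prod k A (deriv B) := by
  refine ext_apply fun n w => ?_
  change (-n) • jacobiSum k A B w 0 (n - 1)
    = (-k) • jacobiSum (k - 1) A B w 0 n + jacobiSum k A (deriv B) w 0 n
  obtain ⟨N, hA, hB⟩ := exists_bound A B w
  obtain ⟨K, hK, hK'⟩ : ∃ K : ℕ, N ≤ K ∧ N ≤ n + K :=
    ⟨(max N (N - n)).toNat, by omega, by omega⟩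
  rw [jacobiSum_zero_eq_sum k A (deriv B) w n (N := N + 1) (K := K + 1) (fun i hi => hA _ (by omega))
    (fun i hi => by rw [deriv_apply, hB _ (by omega), smul_zero])
    (by push_cast; omega) (by push_cast; omega),
    jacobiSum_zero_eq_sum (k - 1) A B w n hA hB hK hK',
    jacobiSum_zero_eq_sum k A B w (n - 1) hA hB (K := K + 1) (by push_cast; omega)
      (by push_cast; omega)]
  simp only [smul_sub, Finset.sum_sub_distrib, Finset.smul_sum]
  rw [sub_add_sub_comm]
  congr 1
  · rw [Finset.sum_range_succ', Finset.sum_range_succ' (fun i => altChoose k i • _), ← add_assoc,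
      ← Finset.sum_add_distrib]
    congr 1
    · refine Finset.sum_congr rfl fun i _ => ?_
      rw [deriv_apply, map_zsmul, show k - ((i + 1 : ℕ) : ℤ) = k - 1 - i by push_cast; ring,
        show n - 1 + ((i + 1 : ℕ) : ℤ) = n + i by push_cast; ring,
        show n + ((i + 1 : ℕ) : ℤ) - 1 = n + i by push_cast; ring, smul_smul, smul_smul, smul_smul,
        ← add_smul]
      congr 1
      push_cast
      linear_combination succ_mul_altChoose k i
    · rw [deriv_apply, map_zsmul, smul_comm]
      simp
  · rw [Finset.sum_range_succ, Finset.sum_range_succ, hA (K : ℤ) (by omega)]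
    simp only [map_zero, smul_zero, add_zero]
    rw [← Finset.sum_add_distrib]
    refine Finset.sum_congr rfl fun i _ => ?_
    rw [deriv_apply, show n - 1 + k - (i : ℤ) = n + k - i - 1 by ring,
      show n + (k - 1) - (i : ℤ) = n + k - i - 1 by ring, smul_smul, smul_smul, smul_smul, smul_smul,
      smul_smul, smul_smul, ← add_smul, Int.negOnePow_sub, Int.negOnePow_one]
    congr 1
    push_cast
    linear_combination (Int.negOnePow k : ℤ) * sub_mul_altChoose k i

end modeFields

/-! ### Modules over the Weyl algebra -/

namespace WeylAlgebra

/-- The generators with the mode index of their fields: `mode true n = a(n)` and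
`mode false n = a*(n + 1)`. -/
noncomputable def mode : Bool → ℤ → WeylAlgebra
  | true, n => a n
  | false, n => astar (n + 1)

/-- The structure constants of the commutators of the generators. -/
def commCoeff : Bool → Bool → ℤ
  | true, false => 1
  | false, true => -1
  | _, _ => 0

theorem mode_mul_sub (s t : Bool) (m n : ℤ) :
    mode s m * mode t n - mode t n * mode s m
      = if m + n = -1 then (commCoeff s t : WeylAlgebra) else 0 := by
  cases s <;> cases t <;> simp only [mode, commCoeff]
  · rw [astar_astar]; simp
  · rw [← neg_sub, a_astar]
    by_cases h : m + n = -1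
    · rw [if_pos h, if_pos (by omega)]; simp
    · rw [if_neg h, if_neg (by omega), neg_zero]
  · rw [a_astar]
    by_cases h : m + n = -1
    · rw [if_pos h, if_pos (by omega)]; simp
    · rw [if_neg h, if_neg (by omega)]
  · rw [a_a]; simp

/-- The universal property of the Weyl algebra. -/
noncomputable def lift {A : Type*} [Ring A] [Algebra ℂ A] (φ : Bool → ℤ → A)
    (hφ : ∀ s t m n, φ s m * φ t n - φ t n * φ s m
      = if m + n = -1 then (commCoeff s t : A) else 0) : WeylAlgebra →ₐ[ℂ] A :=
  RingQuot.liftAlgHom ℂ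
    ⟨FreeAlgebra.lift ℂ fun x => match x with
      | WeylGen.a n => φ true n
      | WeylGen.astar n => φ false (n - 1), by
      intro x y h
      cases h with
      | a_astar n m =>
        simp only [map_sub, map_mul, FreeAlgebra.lift_ι_apply]
        rw [hφ]
        by_cases h : n + m = 0
        · rw [if_pos h, if_pos (by omega)]; simp [commCoeff]
        · rw [if_neg h, if_neg (by omega), map_zero]
      | a_a n m =>
        simp only [map_sub, map_mul, FreeAlgebra.lift_ι_apply, map_zero]
        rw [hφ]
        simp [commCoeff]
      | astar_astar n m =>
        simp only [map_sub, map_mul, FreeAlgebra.lift_ι_apply, map_zero]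
        rw [hφ]
        simp [commCoeff]⟩

theorem lift_mode {A : Type*} [Ring A] [Algebra ℂ A] (φ : Bool → ℤ → A)
    (hφ : ∀ s t m n, φ s m * φ t n - φ t n * φ s m
      = if m + n = -1 then (commCoeff s t : A) else 0) (s : Bool) (n : ℤ) :
    lift φ hφ (mode s n) = φ s n := by
  cases s
  · refine ((RingQuot.liftAlgHom_mkAlgHom_apply ℂ _ _ _).trans
      (FreeAlgebra.lift_ι_apply _ _)).trans ?_
    change φ false (n + 1 - 1) = _
    rw [add_sub_cancel_right]
  · exact (RingQuot.liftAlgHom_mkAlgHom_apply ℂ _ _ _).trans (FreeAlgebra.lift_ι_apply _ _)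

theorem subalgebra_eq_top (S : Subalgebra ℂ WeylAlgebra) (h : ∀ s n, mode s n ∈ S) : S = ⊤ := by
  rw [eq_top_iff]
  rintro x -
  obtain ⟨y, rfl⟩ := RingQuot.mkAlgHom_surjective ℂ WeylRel x
  induction y using FreeAlgebra.induction with
  | grade0 r =>
    rw [AlgHom.commutes]
    exact S.algebraMap_mem r
  | grade1 x =>
    cases x with
    | a n => exact h true n
    | astar n =>
      have := h false (n - 1)
      simp only [mode, sub_add_cancel] at this
      exact this
  | mul x y hx hy => rw [map_mul]; exact S.mul_mem hx hy
  | add x y hx hy => rw [map_add]; exact S.add_mem hx hy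

/-! ### Cyclic and restricted modules -/

section Module

variable {W : Type*} [AddCommGroup W] [Module ℂ W] [Module WeylAlgebra W]
  [IsScalarTower ℂ WeylAlgebra W]

/-- A subspace that is stable under the generators is stable under the Weyl algebra. -/
theorem smul_mem_of_mode_smul_mem (S : Submodule ℂ W)
    (h : ∀ s n, ∀ w ∈ S, mode s n • w ∈ S) (r : WeylAlgebra) {w : W} (hw : w ∈ S) : r • w ∈ S := by
  let T : Subalgebra ℂ WeylAlgebra :=
    { carrier := {r | ∀ w ∈ S, r • w ∈ S}
      mul_mem' := fun {x y} hx hy w hw => by rw [mul_smul]; exact hx _ (hy _ hw)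
      add_mem' := fun {x y} hx hy w hw => by rw [add_smul]; exact S.add_mem (hx _ hw) (hy _ hw)
      algebraMap_mem' := fun c w hw => by rw [algebraMap_smul]; exact S.smul_mem c hw }
  have hT : T = ⊤ := subalgebra_eq_top T h
  have : r ∈ T := hT ▸ Algebra.mem_top
  exact this w hw

/-- A subspace of a cyclic module that contains the generator and is stable under the generators of
the Weyl algebra is everything. -/
theorem eq_top_of_mode_smul_mem {I : Submodule WeylAlgebra WeylAlgebra}
    (S : Submodule ℂ (WeylAlgebra ⧸ I)) (h1 : (Submodule.Quotient.mk 1 : WeylAlgebra ⧸ I) ∈ S)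
    (h : ∀ s n, ∀ w ∈ S, mode s n • w ∈ S) : S = ⊤ := by
  rw [eq_top_iff]
  rintro x -
  obtain ⟨r, rfl⟩ := Submodule.Quotient.mk_surjective I x
  have := smul_mem_of_mode_smul_mem S h r h1
  rwa [← Submodule.Quotient.mk_smul, smul_eq_mul, mul_one] at this

omit [Module ℂ W] [IsScalarTower ℂ WeylAlgebra W] in
theorem mode_smul_sub (s t : Bool) (m n : ℤ) (w : W) :
    mode s m • mode t n • w - mode t n • mode s m • w
      = if m + n = -1 then commCoeff s t • w else 0 := by
  rw [smul_smul, smul_smul, ← sub_smul, mode_mul_sub]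
  split_ifs
  · rw [Int.cast_smul_eq_zsmul]
  · rw [zero_smul]

variable (W) in
/-- Every vector is annihilated by all `a(n)` and `a*(n)` with `n` large. -/
def IsRestricted : Prop := ∀ (s : Bool) (w : W), ∃ N : ℤ, ∀ n, N ≤ n → mode s n • w = 0

theorem isRestricted_quotient {I : Submodule WeylAlgebra WeylAlgebra}
    (h : ∀ s : Bool, ∃ N : ℤ, ∀ n, N ≤ n → mode s n ∈ I) : IsRestricted (WeylAlgebra ⧸ I) := by
  intro s w
  let S : Submodule ℂ (WeylAlgebra ⧸ I) :=
    { carrier := {w | ∃ N : ℤ, ∀ n, N ≤ n → mode s n • w = 0}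
      add_mem' := by
        rintro x y ⟨N, hN⟩ ⟨N', hN'⟩
        exact ⟨max N N', fun n hn => by
          rw [smul_add, hN n (le_trans (le_max_left _ _) hn),
            hN' n (le_trans (le_max_right _ _) hn), add_zero]⟩
      zero_mem' := ⟨0, fun n _ => smul_zero _⟩
      smul_mem' := by
        rintro c x ⟨N, hN⟩
        exact ⟨N, fun n hn => by rw [smul_comm, hN n hn, smul_zero]⟩ }
  have hS : S = ⊤ := by
    apply eq_top_of_mode_smul_mem
    · obtain ⟨N, hN⟩ := h s
      refine ⟨N, fun n hn => ?_⟩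
      rw [← Submodule.Quotient.mk_smul, smul_eq_mul, mul_one, Submodule.Quotient.mk_eq_zero]
      exact hN n hn
    · rintro t m w ⟨N, hN⟩
      -- From `n ≥ -m` on, `m + n` is not `-1`, so the two generators commute.
      refine ⟨max N (-m), fun n hn => ?_⟩
      have := mode_smul_sub s t n m w
      rwa [hN n (le_trans (le_max_left _ _) hn), smul_zero, sub_zero,
        if_neg (by have := le_trans (le_max_right _ _) hn; omega)] at this
  have : w ∈ S := hS ▸ Submodule.mem_top
  exact this

end Module

end WeylAlgebra

/-! ### Fields attached to the vectors of the Weyl module -/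

namespace modeFields

section Locality

variable {W : Type*} [AddCommGroup W] [Module ℂ W]

theorem IsLocal.add_right {A B B' : modeFields W} (h : IsLocal A B) (h' : IsLocal A B') :
    IsLocal A (B + B') := by
  obtain ⟨N, hN⟩ := h
  obtain ⟨N', hN'⟩ := h'
  refine ⟨max N N', fun w => ?_⟩
  have e : (fun m n => A.1 m ((B + B').1 n w) - (B + B').1 n (A.1 m w))
      = (fun m n => A.1 m (B.1 n w) - B.1 n (A.1 m w))
        + fun m n => A.1 m (B'.1 n w) - B'.1 n (A.1 m w) := by
    funext m n
    change A.1 m (B.1 n w + B'.1 n w) - (B.1 n (A.1 m w) + B'.1 n (A.1 m w))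
      = A.1 m (B.1 n w) - B.1 n (A.1 m w) + (A.1 m (B'.1 n w) - B'.1 n (A.1 m w))
    rw [map_add]
    abel
  rw [e, map_add, diffOp_pow_eq_zero_of_le (le_max_left _ _) (hN w),
    diffOp_pow_eq_zero_of_le (le_max_right _ _) (hN' w), add_zero]

theorem IsLocal.smul_right {A B : modeFields W} (h : IsLocal A B) (c : ℂ) :
    IsLocal A (c • B) := by
  obtain ⟨N, hN⟩ := h
  refine ⟨N, fun w => ?_⟩
  have e : (fun m n => A.1 m ((c • B).1 n w) - (c • B).1 n (A.1 m w))
      = fun m n => DistribSMul.toAddMonoidHom W c (A.1 m (B.1 n w) - B.1 n (A.1 m w)) := by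
    funext m n
    change A.1 m (c • B.1 n w) - c • B.1 n (A.1 m w) = c • (A.1 m (B.1 n w) - B.1 n (A.1 m w))
    rw [map_smul, smul_sub]
  rw [e]
  funext m n
  rw [diffOp_pow_map, hN]
  simp

end Locality

end modeFields

namespace WeylAlgebra

open modeFields

variable {W : Type*} [AddCommGroup W] [Module ℂ W] [Module WeylAlgebra W]
  [IsScalarTower ℂ WeylAlgebra W]

/-- The field given by the action of the generators. -/
noncomputable def genField (hW : IsRestricted W) (s : Bool) : modeFields W :=
  ⟨fun n => Algebra.lsmul ℂ ℂ W (mode s n), hW s⟩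

theorem genField_apply (hW : IsRestricted W) (s : Bool) (n : ℤ) (w : W) :
    (genField hW s).1 n w = mode s n • w := rfl

/-- The commutator depends on `m + n` only, so a single factor `x₁ - x₂` kills it. -/
theorem isLocal_genField (hW : IsRestricted W) (s t : Bool) :
    IsLocal (genField hW s) (genField hW t) := by
  refine ⟨1, fun w => ?_⟩
  funext m n
  rw [pow_one, diffOp_apply]
  simp only [genField_apply]
  rw [mode_smul_sub, mode_smul_sub, show m + 1 + n = m + (n + 1) by ring, sub_self]
  rfl

theorem prod_natCast_genField (hW : IsRestricted W) (s t : Bool) (r : ℕ) :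
    prod (r : ℤ) (genField hW s) (genField hW t)
      = if r = 0 then commCoeff s t • idField W else 0 := by
  refine ext_apply fun n w => ?_
  rw [prod_apply, modeFields.jacobiSum, resSum_natCast r (truncRight_comp _ _ w) (truncLeft_comp _ _ w)]
  rcases r with _ | r
  · rw [if_pos rfl]
    change mode s 0 • mode t n • w - mode t n • mode s 0 • w = commCoeff s t • (idField W).1 n w
    rw [mode_smul_sub, idField_apply, zero_add]
    split_ifs <;> simp
  · rw [if_neg (Nat.succ_ne_zero r), diffOp_pow_eq_zero_of_le (N := 1) (by omega)]
    · rfl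
    funext m n
    rw [pow_one, diffOp_apply]
    change mode s (m + 1) • mode t n • w - mode t n • mode s (m + 1) • w
      - (mode s m • mode t (n + 1) • w - mode t (n + 1) • mode s m • w) = 0
    rw [mode_smul_sub, mode_smul_sub, show m + 1 + n = m + (n + 1) by ring, sub_self]

/-- The Weyl algebra acts on the fields by the products with the generating fields. -/
noncomputable def fieldRep (hW : IsRestricted W) : WeylAlgebra →ₐ[ℂ] Module.End ℂ (modeFields W) :=
  lift (fun s n => prod n (genField hW s)) (by
    intro s t m n
    refine LinearMap.ext fun C => ?_
    change prod m (genField hW s) (prod n (genField hW t) C)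
      - prod n (genField hW t) (prod m (genField hW s) C) = _
    -- Generating fields have a simple pole, so only `r = 0` survives; a multiple of the identity
    -- field then acts as a scalar exactly when `m + n = -1`, which is the Weyl relation.
    rw [prod_prod_sub_of_isLocal (isLocal_genField hW s t), finsum_eq_single _ 0]
    · rw [prod_natCast_genField, if_pos rfl, Ring.choose_zero_right, one_smul, Nat.cast_zero,
        sub_zero, zsmul_idField_prod]
      split_ifs
      · exact (Int.cast_smul_eq_zsmul (Module.End ℂ (modeFields W)) _ C).symm
      · rfl
    · intro r hr
      rw [prod_natCast_genField, if_neg hr]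
      have := zsmul_idField_prod 0 (m + n - r) C
      rw [zero_smul] at this
      rw [this, zero_smul, ite_self, smul_zero])

theorem fieldRep_mode (hW : IsRestricted W) (s : Bool) (n : ℤ) :
    fieldRep hW (mode s n) = prod n (genField hW s) :=
  lift_mode _ _ s n

/-- The vacuum ideal is generated by the modes of nonnegative index, and nonnegative products with
the identity field vanish. Hence acting on `idField W` descends to `M`. -/
theorem fieldRep_idField_of_mem (hW : IsRestricted W) {x : WeylAlgebra}
    (hx : x ∈ weylVacuumIdeal) : fieldRep hW x (idField W) = 0 := by
  induction hx using Submodule.span_induction with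
  | mem x hx =>
    rcases hx with ⟨k, rfl⟩ | ⟨k, rfl⟩
    · change fieldRep hW (mode true k) _ = 0
      rw [fieldRep_mode, prod_idField_of_nonneg _ (Int.natCast_nonneg k)]
    · change fieldRep hW (mode false k) _ = 0
      rw [fieldRep_mode, prod_idField_of_nonneg _ (Int.natCast_nonneg k)]
  | zero => rw [map_zero]; rfl
  | add x y _ _ hx hy => rw [map_add, LinearMap.add_apply, hx, hy, add_zero]
  | smul c x _ hx => rw [smul_eq_mul, map_mul, Module.End.mul_apply, hx, map_zero]

/-- The field on `W` of a vector of the Weyl module. -/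
noncomputable def vertexOp (hW : IsRestricted W) : WeylModule →ₗ[ℂ] modeFields W :=
  (Submodule.liftQ (weylVacuumIdeal.restrictScalars ℂ)
    (LinearMap.applyₗ (idField W) ∘ₗ (fieldRep hW).toLinearMap)
    (fun _ hx => fieldRep_idField_of_mem hW hx)) ∘ₗ
    (Submodule.Quotient.restrictScalarsEquiv ℂ weylVacuumIdeal).symm.toLinearMap

theorem vertexOp_mk (hW : IsRestricted W) (r : WeylAlgebra) :
    vertexOp hW (Submodule.Quotient.mk r) = fieldRep hW r (idField W) := rfl

theorem vertexOp_one (hW : IsRestricted W) : vertexOp hW WeylModule.one = idField W := by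
  rw [WeylModule.one, vertexOp_mk, map_one]
  rfl

theorem vertexOp_mode_smul (hW : IsRestricted W) (s : Bool) (n : ℤ) (v : WeylModule) :
    vertexOp hW (mode s n • v) = prod n (genField hW s) (vertexOp hW v) := by
  obtain ⟨r, rfl⟩ := Submodule.Quotient.mk_surjective _ v
  rw [← Submodule.Quotient.mk_smul, vertexOp_mk, vertexOp_mk, smul_eq_mul, map_mul, fieldRep_mode]
  rfl

theorem weylModule_induction {P : WeylModule → Prop} (hadd : ∀ u v, P u → P v → P (u + v))
    (hsmul : ∀ (c : ℂ) v, P v → P (c • v)) (h1 : P WeylModule.one)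
    (h : ∀ s n v, P v → P (mode s n • v)) (v : WeylModule) : P v := by
  let S : Submodule ℂ WeylModule :=
    { carrier := {v | P v}
      add_mem' := fun {x y} hx hy => hadd x y hx hy
      zero_mem' := by
        have := hsmul 0 _ h1
        rwa [zero_smul] at this
      smul_mem' := fun c x hx => hsmul c x hx }
  have : S = ⊤ := eq_top_of_mode_smul_mem S h1 (fun s n w hw => h s n w hw)
  have hv : v ∈ S := this ▸ Submodule.mem_top
  exact hv

/-- Every field of a vector is built from the identity field by products with generating fields, so
Dong's lemma propagates locality. -/
theorem isLocal_genField_vertexOp (hW : IsRestricted W) (v : WeylModule) :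
    ∀ s, IsLocal (genField hW s) (vertexOp hW v) := by
  induction v using weylModule_induction with
  | hadd u v hu hv => intro s; rw [map_add]; exact (hu s).add_right (hv s)
  | hsmul c v hv => intro s; rw [map_smul]; exact (hv s).smul_right c
  | h1 => intro s; rw [vertexOp_one]; exact isLocal_idField _
  | h t n v hv =>
    intro s
    rw [vertexOp_mode_smul]
    exact ((hv t).prod (isLocal_genField hW t s) (hv s).symm n).symm

theorem isLocal_vertexOp (hW : IsRestricted W) (u v : WeylModule) :
    IsLocal (vertexOp hW u) (vertexOp hW v) := by
  induction v using weylModule_induction with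
  | hadd v v' hv hv' => rw [map_add]; exact hv.add_right hv'
  | hsmul c v hv => rw [map_smul]; exact hv.smul_right c
  | h1 => rw [vertexOp_one]; exact isLocal_idField _
  | h t n v hv =>
    rw [vertexOp_mode_smul]
    exact ((isLocal_genField_vertexOp hW v t).prod (isLocal_genField_vertexOp hW u t) hv.symm n).symm

/-! ### Creation, translation and products on the Weyl module -/

theorem isRestricted_weylModule : IsRestricted WeylModule := by
  apply isRestricted_quotient
  intro s
  refine ⟨0, fun n hn => Submodule.subset_span ?_⟩
  obtain ⟨k, rfl⟩ := Int.eq_ofNat_of_zero_le hn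
  cases s
  · exact Or.inr ⟨k, rfl⟩
  · exact Or.inl ⟨k, rfl⟩

theorem mode_smul_one (s : Bool) {n : ℤ} (hn : 0 ≤ n) : mode s n • WeylModule.one = 0 := by
  rw [WeylModule.one, ← Submodule.Quotient.mk_smul, smul_eq_mul, mul_one,
    Submodule.Quotient.mk_eq_zero]
  apply Submodule.subset_span
  obtain ⟨k, rfl⟩ := Int.eq_ofNat_of_zero_le hn
  cases s
  · exact Or.inr ⟨k, rfl⟩
  · exact Or.inl ⟨k, rfl⟩

/-- The field on the Weyl module of a vector of the Weyl module. -/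
noncomputable abbrev stateField : WeylModule →ₗ[ℂ] modeFields WeylModule :=
  vertexOp isRestricted_weylModule

/-- The second half of the product vanishes because generators of nonnegative index kill the vacuum.
-/
theorem stateField_mode_smul_apply_one (s : Bool) (k n : ℤ) (u : WeylModule) :
    (stateField (mode s k • u)).1 n WeylModule.one
      = ∑ᶠ i : ℕ, altChoose k i • mode s (k - i) • (stateField u).1 (n + i) WeylModule.one := by
  rw [vertexOp_mode_smul, prod_apply, jacobiSum_eq_finsum]
  refine finsum_congr fun i => ?_
  rw [genField_apply, genField_apply, mode_smul_one s (by omega), map_zero, smul_zero, sub_zero,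
    zero_add]

theorem stateField_apply_one_of_nonneg (u : WeylModule) :
    ∀ n : ℤ, 0 ≤ n → (stateField u).1 n WeylModule.one = 0 := by
  induction u using weylModule_induction with
  | hadd u v hu hv =>
    intro n hn
    rw [map_add]
    exact (congrArg₂ (· + ·) (hu n hn) (hv n hn)).trans (add_zero _)
  | hsmul c v hv =>
    intro n hn
    rw [map_smul]
    exact (congrArg (c • ·) (hv n hn)).trans (smul_zero _)
  | h1 =>
    intro n hn
    rw [stateField, vertexOp_one, idField_apply_of_ne (by omega)]
  | h s k u hu =>
    intro n hn
    rw [stateField_mode_smul_apply_one]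
    refine finsum_eq_zero_of_forall_eq_zero fun i => ?_
    rw [hu _ (by omega), smul_zero, smul_zero]

theorem stateField_neg_one_apply_one (u : WeylModule) :
    (stateField u).1 (-1) WeylModule.one = u := by
  induction u using weylModule_induction with
  | hadd u v hu hv =>
    rw [map_add]
    exact congrArg₂ (· + ·) hu hv
  | hsmul c v hv =>
    rw [map_smul]
    exact congrArg (c • ·) hv
  | h1 => rw [stateField, vertexOp_one, idField_apply, if_pos rfl]
  | h s k u hu =>
    rw [stateField_mode_smul_apply_one, finsum_eq_single _ 0]
    · rw [altChoose_zero_right, one_smul, Nat.cast_zero, sub_zero, add_zero, hu]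
    · intro i hi
      rw [stateField_apply_one_of_nonneg _ _ (by omega), smul_zero, smul_zero]

theorem stateField_neg_two_mode_smul (s : Bool) (k : ℤ) (u : WeylModule) :
    (stateField (mode s k • u)).1 (-2) WeylModule.one
      = mode s k • (stateField u).1 (-2) WeylModule.one + (-k) • mode s (k - 1) • u := by
  rw [stateField_mode_smul_apply_one, finsum_eq_sum_range _ 2]
  · rw [Finset.sum_range_succ, Finset.sum_range_one, altChoose_zero_right, one_smul, Nat.cast_zero,
      sub_zero, add_zero, Nat.cast_one, show (-2 : ℤ) + 1 = -1 by norm_num,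
      stateField_neg_one_apply_one]
    congr 2
    simp [altChoose]
  · intro i hi
    rw [stateField_apply_one_of_nonneg _ _ (by omega), smul_zero, smul_zero]

/-- The map `u ↦ u_(-2) 𝟏` is the translation operator. On `mode s k • u` both sides follow the same
Leibniz rule, `stateField_neg_two_mode_smul` and `deriv_prod`. -/
theorem vertexOp_translation (hW : IsRestricted W) (u : WeylModule) :
    vertexOp hW ((stateField u).1 (-2) WeylModule.one) = deriv (vertexOp hW u) := by
  induction u using weylModule_induction with
  | hadd u v hu hv =>
    have e : (stateField (u + v)).1 (-2) WeylModule.one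
        = (stateField u).1 (-2) WeylModule.one + (stateField v).1 (-2) WeylModule.one := by
      rw [map_add]
      rfl
    rw [e, map_add, map_add, map_add, hu, hv]
  | hsmul c v hv =>
    have e : (stateField (c • v)).1 (-2) WeylModule.one
        = c • (stateField v).1 (-2) WeylModule.one := by
      rw [map_smul]
      rfl
    rw [e, map_smul, map_smul, map_smul, hv]
  | h1 =>
    rw [stateField, vertexOp_one, idField_apply_of_ne (by norm_num), map_zero, vertexOp_one]
    refine ext_apply fun n w => ?_
    rw [deriv_apply, idField_apply]
    split_ifs with h
    · rw [show n = 0 by omega]; simp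
    · rw [smul_zero]; rfl
  | h s k u hu =>
    rw [stateField_neg_two_mode_smul, map_add, map_zsmul, vertexOp_mode_smul, vertexOp_mode_smul,
      vertexOp_mode_smul, hu, deriv_prod, add_comm]

/-- For `l = -1 - j` the vector `u_l 𝟏` is a divided power of translation. The induction applies the
case `j` to the translate of `u` and cancels the factor `j + 1`. -/
theorem vertexOp_stateField_one (hW : IsRestricted W) (l : ℤ) : ∀ u : WeylModule,
    vertexOp hW ((stateField u).1 l WeylModule.one) = prod l (vertexOp hW u) (idField W) := by
  rcases le_or_gt 0 l with hl | hl
  · intro u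
    rw [stateField_apply_one_of_nonneg u l hl, map_zero, prod_idField_of_nonneg _ hl]
  · obtain ⟨j, hj⟩ := Int.eq_ofNat_of_zero_le (show 0 ≤ -1 - l by omega)
    obtain rfl : l = -1 - j := by omega
    clear hl hj
    induction j with
    | zero =>
      intro u
      rw [Nat.cast_zero, sub_zero, stateField_neg_one_apply_one, prod_neg_one_idField]
    | succ j ih =>
      intro u
      have h₁ := ih ((stateField u).1 (-2) WeylModule.one)
      rw [vertexOp_translation hW u, deriv_prod_left, stateField,
        vertexOp_translation isRestricted_weylModule u, deriv_apply, map_zsmul,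
        show -1 - (j : ℤ) - 1 = -1 - (j + 1 : ℕ) by push_cast; ring,
        ← Int.cast_smul_eq_zsmul ℂ, ← Int.cast_smul_eq_zsmul ℂ] at h₁
      refine smul_right_injective _ ?_ h₁
      rw [Int.cast_ne_zero]
      omega

/-- The field of an `l`-th product is the `l`-th product of the fields. -/
theorem vertexOp_stateField (hW : IsRestricted W) (v : WeylModule) : ∀ (u : WeylModule) (l : ℤ),
    vertexOp hW ((stateField u).1 l v) = prod l (vertexOp hW u) (vertexOp hW v) := by
  induction v using weylModule_induction with
  | hadd v v' hv hv' => intro u l; rw [map_add, map_add, map_add, map_add, hv, hv']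
  | hsmul c v hv => intro u l; rw [map_smul, map_smul, map_smul, map_smul, hv]
  | h1 => intro u l; rw [vertexOp_one, vertexOp_stateField_one]
  | h s k v ih =>
    intro u l
    obtain ⟨N, hN⟩ := isRestricted_weylModule s u
    have hz : ∀ i : ℕ, N.toNat ≤ i → mode s i • u = 0 := fun i hi => hN _ (by omega)
    -- Commute `mode s k` past `u_l` on vectors, and the corresponding products on fields. By the
    -- induction hypothesis for `v`, the two right-hand sides and the terms with `mode s k`
    -- outermost correspond, so the remaining terms do too.
    have h₁ := (isLocal_genField_vertexOp isRestricted_weylModule u s).commutator k l v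
    have h₂ := prod_prod_sub_of_isLocal (isLocal_genField_vertexOp hW u s) (vertexOp hW v) k l
    simp only [← vertexOp_mode_smul, genField_apply] at h₁
    simp only [← vertexOp_mode_smul] at h₂
    rw [finsum_eq_sum_range _ N.toNat] at h₁ h₂
    · have h₃ := congrArg (vertexOp hW) h₁
      rw [map_sub, vertexOp_mode_smul, ih, map_sum] at h₃
      simp only [map_zsmul, ih] at h₃
      rw [← h₂] at h₃
      exact sub_right_inj.mp h₃
    · intro i hi
      rw [hz i hi, map_zero]
      have := zsmul_idField_prod 0 (k + l - i) (vertexOp hW v)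
      rw [zero_smul, zero_smul, ite_self] at this
      rw [this, smul_zero]
    · intro i hi
      rw [hz i hi, map_zero]
      exact smul_zero (A := WeylModule) (Ring.choose k i : ℤ)

theorem jacobiIdentity_vertexOp (hW : IsRestricted W) :
    JacobiIdentity ((modeFields WeylModule).subtype ∘ₗ stateField)
      ((modeFields W).subtype ∘ₗ vertexOp hW) := by
  intro u v w l m n
  have h := (isLocal_vertexOp hW u v).jacobi l m n w
  rw [jacobiSum_eq_finsum] at h
  simp only [← vertexOp_stateField] at h
  exact h

/-- The Weyl vertex algebra. -/
noncomputable def weylVertexAlgebra : VertexAlgebra WeylModule where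
  vac := WeylModule.one
  Y := (modeFields WeylModule).subtype ∘ₗ stateField
  truncation u := (stateField u).2
  vacuum n := by
    change (stateField WeylModule.one).1 n = _
    rw [stateField, vertexOp_one]
    rfl
  creation_regular v n hn := stateField_apply_one_of_nonneg v n hn
  creation v := stateField_neg_one_apply_one v
  jacobi := jacobiIdentity_vertexOp isRestricted_weylModule

theorem vertexOp_mode_neg_one (hW : IsRestricted W) (s : Bool) :
    vertexOp hW (mode s (-1) • WeylModule.one) = genField hW s := by
  rw [vertexOp_mode_smul, vertexOp_one, prod_neg_one_idField]

/-- The weak module of the Weyl vertex algebra on a restricted module over the Weyl algebra. -/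
noncomputable def weylWeakModule (hW : IsRestricted W) : weylVertexAlgebra.WeakModule W where
  Y := (modeFields W).subtype ∘ₗ vertexOp hW
  truncation u := (vertexOp hW u).2
  vacuum n := by
    change (vertexOp hW WeylModule.one).1 n = _
    rw [vertexOp_one]
    rfl
  jacobi := jacobiIdentity_vertexOp hW

end WeylAlgebra

/-! ### Consequences of the Jacobi identity -/

namespace JacobiIdentity

variable {V W : Type*} [AddCommGroup V] [Module ℂ V] [AddCommGroup W] [Module ℂ W]
  {Y : V →ₗ[ℂ] (ℤ → Module.End ℂ V)} {YW : V →ₗ[ℂ] (ℤ → Module.End ℂ W)}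

theorem iterate (h : JacobiIdentity Y YW) (u v : V) (w : W) (l n : ℤ) :
    YW (Y u l v) n w = ∑ᶠ i : ℕ, altChoose l i • (YW u (l - i) (YW v (n + i) w)
      - (Int.negOnePow l : ℤ) • YW v (n + l - i) (YW u i w)) := by
  have h₁ := h u v w l 0 n
  have h₂ : (∑ᶠ i : ℕ, (Ring.choose (0 : ℤ) i : ℤ) • YW (Y u (l + i) v) (0 + n - i) w)
      = YW (Y u l v) n w := by
    rw [finsum_eq_single _ 0]
    · simp
    · intro i hi
      obtain ⟨j, rfl⟩ := Nat.exists_eq_succ_of_ne_zero hi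
      rw [Ring.choose_zero_succ, zero_smul]
  rw [← h₂, ← h₁]
  simp only [zero_add]
  rfl

/-- Weak associativity: `u_m v_n w` is a combination of vectors `(u_l v)_q w` with the same `w`. The
proof descends in `n` from the truncation bound of `v` on `w`. -/
theorem mode_mode_mem (h : JacobiIdentity Y YW)
    (htrunc : ∀ (u : V) (w : W), ∃ N : ℤ, ∀ n : ℤ, N ≤ n → YW u n w = 0) {u v : V} {w : W}
    (S : Submodule ℂ W) (hS : ∀ l q, YW (Y u l v) q w ∈ S) (m n : ℤ) :
    YW u m (YW v n w) ∈ S := by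
  obtain ⟨M, hM⟩ := htrunc u w
  obtain ⟨N, hN⟩ := htrunc v w
  have key : ∀ j : ℕ, ∀ n : ℤ, N - j ≤ n → ∀ m, YW u m (YW v n w) ∈ S := by
    intro j
    induction j with
    | zero =>
      intro n hn m
      rw [hN n (by simpa using hn), map_zero]
      exact S.zero_mem
    | succ j ih =>
      intro n hn m
      -- Since `u_(M+i) w = 0`, the second half of the left side disappears; the first exponent is
      -- `m - M` so that the leading term is `u_m v_n w`. The other terms have a larger mode index
      -- of `v` and are covered by the induction.
      have h₁ := h u v w (m - M) M n
      have h₂ : (∑ᶠ i : ℕ, (Ring.choose M i : ℤ) • YW (Y u (m - M + i) v) (M + n - i) w) ∈ S := by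
        apply finsum_induction (· ∈ S) S.zero_mem (fun _ _ => S.add_mem)
        exact fun i => zsmul_mem (hS _ _) _
      rw [← h₁, finsum_eq_sum_range _ (j + 1 + 1), Finset.sum_range_succ'] at h₂
      · have h₃ := (S.add_mem_iff_right (S.sum_mem fun i _ => ?_)).mp h₂
        · rw [Nat.cast_zero, hM (M + 0) (by omega), pow_zero, Ring.choose_zero_right] at h₃
          simpa using h₃
        · rw [hM _ (by omega), map_zero, smul_zero, sub_zero]
          exact zsmul_mem (ih _ (by push_cast; push_cast at hn; omega) _) _
      · intro i hi
        rw [hM _ (by omega), hN _ (by push_cast at hn; omega)]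
        simp
  exact key (N - n).toNat n (by omega) m

end JacobiIdentity

namespace WeylAlgebra

variable {W : Type*} [AddCommGroup W] [Module ℂ W] [Module WeylAlgebra W]
  [IsScalarTower ℂ WeylAlgebra W]

omit [IsScalarTower ℂ WeylAlgebra W] in
/-- The modes on a module are determined by the generators. -/
theorem modes_unique {Y Y' : WeylModule →ₗ[ℂ] (ℤ → Module.End ℂ WeylModule)}
    {YW YW' : WeylModule →ₗ[ℂ] (ℤ → Module.End ℂ W)}
    (h : JacobiIdentity Y YW) (h' : JacobiIdentity Y' YW')
    (hY : ∀ s n v, Y (mode s (-1) • WeylModule.one) n v = mode s n • v)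
    (hY' : ∀ s n v, Y' (mode s (-1) • WeylModule.one) n v = mode s n • v)
    (hYW : ∀ s n w, YW (mode s (-1) • WeylModule.one) n w = mode s n • w)
    (hYW' : ∀ s n w, YW' (mode s (-1) • WeylModule.one) n w = mode s n • w)
    (h1 : YW WeylModule.one = YW' WeylModule.one) : YW = YW' := by
  refine LinearMap.ext fun u => ?_
  induction u using weylModule_induction with
  | hadd u v hu hv => rw [map_add, map_add, hu, hv]
  | hsmul c v hv => rw [map_smul, map_smul, hv]
  | h1 => exact h1
  | h s k u hu =>
    funext n
    ext w
    rw [← hY, h.iterate, hY, ← hY' s k u, h'.iterate]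
    simp only [hYW, hYW', hu]

theorem isWeylVertexAlgebra_iff (A : VertexAlgebra WeylModule) : IsWeylVertexAlgebra A ↔
    A.vac = WeylModule.one ∧
      ∀ s n v, A.Y (mode s (-1) • WeylModule.one) n v = mode s n • v := by
  refine and_congr_right fun _ => ⟨fun ⟨h₁, h₂⟩ s n v => ?_, fun h => ⟨h true, fun n v => ?_⟩⟩
  · cases s
    · have := h₂ (n + 1) v
      rwa [add_sub_cancel_right] at this
    · exact h₁ n v
  · have := h false (n - 1) v
    simp only [mode, sub_add_cancel, neg_add_cancel] at this
    exact this

omit [IsScalarTower ℂ WeylAlgebra W] in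
theorem isInducedByWeylAction_iff {A : VertexAlgebra WeylModule} (N : A.WeakModule W) :
    IsInducedByWeylAction N ↔
      ∀ s n w, N.Y (mode s (-1) • WeylModule.one) n w = mode s n • w := by
  refine ⟨fun ⟨h₁, h₂⟩ s n v => ?_, fun h => ⟨h true, fun n v => ?_⟩⟩
  · cases s
    · have := h₂ (n + 1) v
      rwa [add_sub_cancel_right] at this
    · exact h₁ n v
  · have := h false (n - 1) v
    simp only [mode, sub_add_cancel, neg_add_cancel] at this
    exact this

theorem isWeylVertexAlgebra_weylVertexAlgebra : IsWeylVertexAlgebra weylVertexAlgebra := by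
  rw [isWeylVertexAlgebra_iff]
  refine ⟨rfl, fun s n v => ?_⟩
  change (stateField (mode s (-1) • WeylModule.one)).1 n v = _
  rw [stateField, vertexOp_mode_neg_one, genField_apply]

theorem eq_weylVertexAlgebra {A : VertexAlgebra WeylModule} (hA : IsWeylVertexAlgebra A) :
    A = weylVertexAlgebra := by
  have h₀ := (isWeylVertexAlgebra_iff _).mp isWeylVertexAlgebra_weylVertexAlgebra
  rw [isWeylVertexAlgebra_iff] at hA
  refine VertexAlgebra.ext (hA.1.trans h₀.1.symm) (modes_unique A.jacobi weylVertexAlgebra.jacobi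
    hA.2 h₀.2 hA.2 h₀.2 ?_)
  rw [← hA.1]
  funext n
  rw [A.vacuum, hA.1, ← h₀.1, weylVertexAlgebra.vacuum]

theorem isInducedByWeylAction_weylWeakModule (hW : IsRestricted W) :
    IsInducedByWeylAction (weylWeakModule hW) := by
  rw [isInducedByWeylAction_iff]
  intro s n w
  change (vertexOp hW (mode s (-1) • WeylModule.one)).1 n w = _
  rw [vertexOp_mode_neg_one, genField_apply]

omit [IsScalarTower ℂ WeylAlgebra W] in
theorem weakModule_ext {A : VertexAlgebra WeylModule} (hA : IsWeylVertexAlgebra A)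
    {N N' : A.WeakModule W} (hN : IsInducedByWeylAction N) (hN' : IsInducedByWeylAction N') :
    N = N' := by
  rw [isWeylVertexAlgebra_iff] at hA
  rw [isInducedByWeylAction_iff] at hN hN'
  refine VertexAlgebra.WeakModule.ext (modes_unique N.jacobi N'.jacobi hA.2 hA.2 hN hN' ?_)
  rw [← hA.1]
  funext n
  rw [N.vacuum, N'.vacuum]

/-! ### The automorphisms of the Weyl vertex algebra -/

/-- The factor by which `WeylModule.scale t` scales the generators. -/
noncomputable def scaleFactor (t : ℂˣ) : Bool → ℂ
  | true => t
  | false => (t : ℂ)⁻¹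

theorem scale_mode (t : ℂˣ) (s : Bool) (n : ℤ) :
    scale t (mode s n) = scaleFactor t s • mode s n := by
  cases s
  · exact scale_astar t _
  · exact scale_a t _

theorem scale_mk (t : ℂˣ) (r : WeylAlgebra) :
    WeylModule.scale t (Submodule.Quotient.mk r) = Submodule.Quotient.mk (scale t r) := rfl

theorem scale_one (t : ℂˣ) : WeylModule.scale t WeylModule.one = WeylModule.one := by
  rw [WeylModule.one, scale_mk, map_one]

theorem scale_smul (t : ℂˣ) (r : WeylAlgebra) (v : WeylModule) :
    WeylModule.scale t (r • v) = scale t r • WeylModule.scale t v := by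
  obtain ⟨x, rfl⟩ := Submodule.Quotient.mk_surjective _ v
  rw [← Submodule.Quotient.mk_smul, scale_mk, scale_mk, smul_eq_mul, map_mul]
  rfl

theorem scale_mode_smul (t : ℂˣ) (s : Bool) (n : ℤ) (v : WeylModule) :
    WeylModule.scale t (mode s n • v) = scaleFactor t s • mode s n • WeylModule.scale t v := by
  rw [scale_smul, scale_mode, smul_assoc]

/-- The iterate formula expresses the modes of `mode s k • u` by those of `u` and the generator;
each term contains the generator once and so picks up the same factor. -/
theorem scale_Y {A : VertexAlgebra WeylModule} (hA : IsWeylVertexAlgebra A) (t : ℂˣ)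
    (u : WeylModule) : ∀ (v : WeylModule) (n : ℤ),
      WeylModule.scale t (A.Y u n v) = A.Y (WeylModule.scale t u) n (WeylModule.scale t v) := by
  rw [isWeylVertexAlgebra_iff] at hA
  induction u using weylModule_induction with
  | hadd u u' hu hu' =>
    intro v n
    rw [map_add, map_add, map_add]
    simp only [Pi.add_apply, LinearMap.add_apply, map_add, hu, hu']
  | hsmul c u hu =>
    intro v n
    rw [map_smul, map_smul, map_smul]
    simp only [Pi.smul_apply, LinearMap.smul_apply, map_smul, hu]
  | h1 =>
    intro v n
    rw [scale_one, ← hA.1, A.vacuum]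
    split_ifs <;> simp
  | h s k u hu =>
    intro v n
    rw [scale_mode_smul, LinearMap.map_smul, Pi.smul_apply, LinearMap.smul_apply, ← hA.2 s k u,
      ← hA.2 s k (WeylModule.scale t u), A.jacobi.iterate, A.jacobi.iterate, AddEquivClass.map_finsum, smul_finsum]
    refine finsum_congr fun i => ?_
    rw [map_zsmul, map_sub, map_zsmul, hA.2, hA.2, hA.2, hA.2,
      scale_mode_smul, hu, hu, scale_mode_smul, map_smul, smul_comm (scaleFactor t s) (altChoose k i),
      smul_sub (scaleFactor t s), smul_comm (scaleFactor t s) (Int.negOnePow k : ℤ)]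

theorem scale_omega (t : ℂˣ) : WeylModule.scale t WeylModule.omega = WeylModule.omega := by
  have h : ∀ m n, scale t (a m * astar n) = a m * astar n := fun m n => by
    rw [map_mul, scale_a, scale_astar, smul_mul_smul_comm, mul_inv_cancel₀ t.ne_zero, one_smul]
  rw [WeylModule.omega, map_smul, scale_smul, map_sub, h, h, scale_one]

theorem scale_mem_aut {A : VertexAlgebra WeylModule} (hA : IsWeylVertexAlgebra A) (t : ℂˣ) :
    WeylModule.scale t ∈ A.aut WeylModule.omega :=
  ⟨fun u v n => scale_Y hA t u v n, scale_omega t⟩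

theorem zpowers_g_le_aut {A : VertexAlgebra WeylModule} (hA : IsWeylVertexAlgebra A) (p : ℕ) :
    Subgroup.zpowers (WeylModule.g p) ≤ A.aut WeylModule.omega :=
  Subgroup.zpowers_le.mpr (scale_mem_aut hA _)

/-! ### Subspaces that are stable under the modes of an orbifold -/

/-- Modes of eigenvectors of `scale t`. -/
def eigenSpan {A : VertexAlgebra WeylModule} (N : A.WeakModule W) (t : ℂˣ) (c : ℂ) (w : W) :
    Submodule ℂ W :=
  Submodule.span ℂ {x | ∃ (v : WeylModule) (q : ℤ), WeylModule.scale t v = c • v ∧ x = N.Y v q w}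

omit [Module WeylAlgebra W] [IsScalarTower ℂ WeylAlgebra W] in
theorem mem_eigenSpan_one {A : VertexAlgebra WeylModule} (hA : IsWeylVertexAlgebra A)
    (N : A.WeakModule W) (t : ℂˣ) (w : W) : w ∈ eigenSpan N t 1 w := by
  refine Submodule.subset_span ⟨WeylModule.one, -1, ?_, ?_⟩
  · rw [scale_one, one_smul]
  · rw [← hA.1, N.vacuum, if_pos rfl, Module.End.one_apply]

-- By `mode_mode_mem`, applying a generator to `v_q w` gives modes of the vectors `mode s l • v` on
-- `w`, and these have the eigenvalue of `v` times `scaleFactor t s`.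
omit [IsScalarTower ℂ WeylAlgebra W] in
theorem mode_smul_mem_eigenSpan {A : VertexAlgebra WeylModule} (hA : IsWeylVertexAlgebra A)
    {N : A.WeakModule W} (hN : IsInducedByWeylAction N) (t : ℂˣ) {c : ℂ} {w x : W} (s : Bool)
    (m : ℤ) (hx : x ∈ eigenSpan N t c w) :
    mode s m • x ∈ eigenSpan N t (scaleFactor t s * c) w := by
  rw [isWeylVertexAlgebra_iff] at hA
  rw [isInducedByWeylAction_iff] at hN
  induction hx using Submodule.span_induction with
  | mem x hx =>
    obtain ⟨v, q, hv, rfl⟩ := hx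
    rw [← hN]
    refine N.jacobi.mode_mode_mem N.truncation _ (fun l q => ?_) m q
    rw [hA.2]
    refine Submodule.subset_span ⟨_, q, ?_, rfl⟩
    rw [scale_mode_smul, hv, smul_comm (mode s l) c v, smul_smul]
  | zero => rw [smul_zero]; exact Submodule.zero_mem _
  | add x y _ _ hx hy => rw [smul_add]; exact Submodule.add_mem _ hx hy
  | smul c' x _ hx =>
    have : mode s m • c' • x = c' • mode s m • x := by
      rw [← hN, ← hN, map_smul]
    rw [this]
    exact Submodule.smul_mem _ c' hx

omit [IsScalarTower ℂ WeylAlgebra W] in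
theorem mode_pow_smul_mem_eigenSpan {A : VertexAlgebra WeylModule} (hA : IsWeylVertexAlgebra A)
    {N : A.WeakModule W} (hN : IsInducedByWeylAction N) (t : ℂˣ) (w : W) (s : Bool) (m : ℤ)
    (k : ℕ) : mode s m ^ k • w ∈ eigenSpan N t (scaleFactor t s ^ k) w := by
  induction k with
  | zero => rw [pow_zero, pow_zero, one_smul]; exact mem_eigenSpan_one hA N t w
  | succ k ih =>
    rw [pow_succ', pow_succ', mul_smul]
    exact mode_smul_mem_eigenSpan hA hN t s m ih

omit [Module WeylAlgebra W] [IsScalarTower ℂ WeylAlgebra W] in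
theorem eigenSpan_one_le {A : VertexAlgebra WeylModule} {N : A.WeakModule W} {t : ℂˣ}
    {U : Submodule ℂ W}
    (hU : ∀ v, WeylModule.scale t v = v → ∀ n, ∀ w ∈ U, N.Y v n w ∈ U) {w : W} (hw : w ∈ U) :
    eigenSpan N t 1 w ≤ U := by
  refine Submodule.span_le.mpr ?_
  rintro _ ⟨v, q, hv, rfl⟩
  exact hU v (by rw [hv, one_smul]) q w hw

end WeylAlgebra

/-! ### Operators with a single eigenvalue -/

section LocallyUnipotent

open Polynomial

/-- The derivative `p c^(p-1)` of `X^p` at `c` is nonzero, so `X^p` is a local coordinate there and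
`X` is a polynomial in it to any order. The induction corrects `q` one order at a time. -/
theorem exists_sub_pow_dvd_X_sub_comp {K : Type*} [Field K] [CharZero K] {c : K} (hc : c ≠ 0)
    {p : ℕ} (hp : 1 ≤ p) (m : ℕ) :
    ∃ q : K[X], (X - C c) ^ m ∣ X - q.comp (X ^ p) := by
  induction m with
  | zero => exact ⟨0, by simp⟩
  | succ m ih =>
    obtain ⟨q, r, hr⟩ := ih
    obtain ⟨S, hS⟩ : X - C c ∣ (X ^ p - C (c ^ p) : K[X]) := by
      rw [C_pow]; exact sub_dvd_pow_sub_pow _ _ _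
    have hS0 : S.eval c ≠ 0 := by
      have h := congrArg (fun f => (derivative f).eval c) hS
      simp only [derivative_mul, derivative_sub, derivative_X_pow, derivative_C, derivative_X,
        eval_add, eval_mul, eval_sub, eval_X, eval_C, eval_pow, sub_self, zero_mul, add_zero,
        sub_zero, one_mul, eval_natCast, map_natCast] at h
      rw [← h]
      exact mul_ne_zero (Nat.cast_ne_zero.mpr (by omega)) (pow_ne_zero _ hc)
    -- With `X^p - c^p = (X - c) S`, the correction contributes `S^m` times a constant after
    -- removing `(X - c)^m`; the constant makes the new remainder vanish at `c`.
    refine ⟨q + C (r.eval c / S.eval c ^ m) * (X - C (c ^ p)) ^ m, ?_⟩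
    have h : X - (q + C (r.eval c / S.eval c ^ m) * (X - C (c ^ p)) ^ m).comp (X ^ p)
        = (X - C c) ^ m * (r - C (r.eval c / S.eval c ^ m) * S ^ m) := by
      rw [add_comp, mul_comp, C_comp, pow_comp, sub_comp, X_comp, C_comp, hS, mul_pow]
      linear_combination hr
    rw [h, pow_succ]
    refine mul_dvd_mul_left _ (dvd_iff_isRoot.mpr ?_)
    rw [IsRoot.def, eval_sub, eval_mul, eval_C, eval_pow, div_mul_cancel₀ _ (pow_ne_zero m hS0),
      sub_self]

variable {K W : Type*} [Field K] [AddCommGroup W] [Module K W]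

theorem aeval_apply_mem {T : Module.End K W} {U : Submodule K W} (h : ∀ w ∈ U, T w ∈ U)
    (q : K[X]) {w : W} (hw : w ∈ U) : aeval T q w ∈ U := by
  induction q using Polynomial.induction_on' with
  | add q r hq hr => rw [map_add, LinearMap.add_apply]; exact U.add_mem hq hr
  | monomial n c =>
    rw [aeval_monomial, Module.algebraMap_end_eq_smul_id]
    refine U.smul_mem c ?_
    induction n with
    | zero => exact hw
    | succ n ih =>
      rw [pow_succ']
      exact h _ ih

/-- On a vector killed by `(T - c)^m`, the operator `T` agrees with a polynomial in `T^p`. -/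
theorem apply_mem_of_pow_apply_mem [CharZero K] {T : Module.End K W} {c : K} (hc : c ≠ 0)
    {p : ℕ} (hp : 1 ≤ p) (hT : ∀ w, ∃ m : ℕ, ((T - algebraMap K _ c) ^ m) w = 0)
    {U : Submodule K W} (hU : ∀ w ∈ U, (T ^ p) w ∈ U) {w : W} (hw : w ∈ U) : T w ∈ U := by
  obtain ⟨m, hm⟩ := hT w
  obtain ⟨q, r, hr⟩ := exists_sub_pow_dvd_X_sub_comp hc hp m
  rw [mul_comm] at hr
  have h := congrArg (fun f => aeval T f w) hr
  simp only [map_sub, map_mul, aeval_X, map_pow, aeval_C, aeval_comp] at h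
  rw [LinearMap.sub_apply, Module.End.mul_apply, hm, map_zero, sub_eq_zero] at h
  rw [h]
  exact aeval_apply_mem hU q hw

/-- As `X` is coprime to `(X - c)^m`, Bézout gives a preimage of `w` that is a polynomial in `T`
applied to `w`, hence in `U`. -/
theorem exists_apply_eq_of_locally_unipotent {T : Module.End K W} {c : K} (hc : c ≠ 0)
    (hT : ∀ w, ∃ m : ℕ, ((T - algebraMap K _ c) ^ m) w = 0)
    {U : Submodule K W} (hU : ∀ w ∈ U, T w ∈ U) {w : W} (hw : w ∈ U) : ∃ w' ∈ U, T w' = w := by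
  obtain ⟨m, hm⟩ := hT w
  have hcop : IsCoprime (X : K[X]) ((X - C c) ^ m) := by
    apply IsCoprime.pow_right
    have := isCoprime_X_sub_C_of_isUnit_sub (R := K) (a := 0) (b := c)
      (by rw [zero_sub]; exact (neg_ne_zero.mpr hc).isUnit)
    simpa using this
  obtain ⟨f, g, hfg⟩ := hcop
  refine ⟨aeval T f w, aeval_apply_mem hU f hw, ?_⟩
  have h := congrArg (fun f => aeval T f w) hfg
  simp only [map_add, map_mul, aeval_X, map_pow, map_sub, aeval_C, map_one, LinearMap.add_apply,
    Module.End.mul_apply, hm, map_zero, add_zero, Module.End.one_apply] at h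
  have hcomm : aeval T (X * f) = aeval T (f * X) := by rw [mul_comm]
  rw [map_mul, map_mul, aeval_X] at hcomm
  rw [← Module.End.mul_apply, hcomm]
  exact h

end LocallyUnipotent

/-! ### Irreducibility of Whittaker modules over the Weyl algebra -/

namespace MvPolynomial

variable {σ K : Type*} [Field K]

theorem eq_C_of_pderiv_eq_zero [CharZero K] {p : MvPolynomial σ K} (h : ∀ i, pderiv i p = 0) :
    p = C (coeff 0 p) := by
  classical
  ext m
  rw [coeff_C]
  split_ifs with hm
  · rw [hm]
  · obtain ⟨i, hi⟩ := Finsupp.ne_iff.mp (Ne.symm hm)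
    rw [Finsupp.zero_apply] at hi
    have h₁ := coeff_pderiv (i := i) p (m - Finsupp.single i 1)
    rw [h, coeff_zero, tsub_add_cancel_of_le (Finsupp.single_le_iff.mpr
      (Nat.one_le_iff_ne_zero.mpr hi))] at h₁
    exact (mul_eq_zero.mp h₁.symm).resolve_right (Nat.cast_add_one_ne_zero _)

theorem totalDegree_pderiv_le {p : MvPolynomial σ K} {i : σ} {d : ℕ} (hp : p.totalDegree ≤ d + 1) :
    (pderiv i p).totalDegree ≤ d := by
  refine Finset.sup_le fun m hm => ?_
  rw [mem_support_iff, coeff_pderiv] at hm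
  have h₁ := le_totalDegree (mem_support_iff.mpr (left_ne_zero_of_mul hm))
  rw [Finsupp.sum_add_index' (fun _ => rfl) (fun _ _ _ => rfl),
    Finsupp.sum_single_index rfl] at h₁
  omega

/-- A nonzero space of polynomials that is stable under differentiation contains the constants. -/
theorem one_mem_of_pderiv_mem [CharZero K] {U : Submodule K (MvPolynomial σ K)}
    (hU : ∀ i, ∀ p ∈ U, pderiv i p ∈ U) (d : ℕ) : ∀ p ∈ U, p ≠ 0 → p.totalDegree ≤ d → 1 ∈ U := by
  have const : ∀ p ∈ U, p ≠ 0 → (∀ i, pderiv i p = 0) → 1 ∈ U := by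
    intro p hp hp0 h
    obtain ⟨c, rfl⟩ : ∃ c, p = C c := ⟨_, eq_C_of_pderiv_eq_zero h⟩
    have hc : c ≠ 0 := fun h0 => hp0 (by rw [h0, C_0])
    have h₁ := U.smul_mem c⁻¹ hp
    rwa [smul_eq_C_mul, ← C_mul, inv_mul_cancel₀ hc, C_1] at h₁
  induction d with
  | zero =>
    intro p hp hp0 hd
    refine const p hp hp0 fun i => ?_
    rw [totalDegree_eq_zero_iff_eq_C.mp (Nat.le_zero.mp hd), pderiv_C]
  | succ d ih =>
    intro p hp hp0 hd
    by_cases h : ∀ i, pderiv i p = 0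
    · exact const p hp hp0 h
    · push Not at h
      obtain ⟨i, hi⟩ := h
      exact ih _ (hU i p hp) hi (totalDegree_pderiv_le hd)

theorem pderiv_comm (i j : σ) (p : MvPolynomial σ K) :
    pderiv i (pderiv j p) = pderiv j (pderiv i p) := by
  classical
  have h : ⁅(pderiv i : Derivation K (MvPolynomial σ K) (MvPolynomial σ K)),
      (pderiv j : Derivation K (MvPolynomial σ K) (MvPolynomial σ K))⁆ = 0 := by
    refine derivation_ext fun k => ?_
    rw [Derivation.commutator_apply, pderiv_X, pderiv_X, Pi.single_apply, Pi.single_apply]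
    split_ifs <;> simp
  have := DFunLike.congr_fun h p
  rw [Derivation.commutator_apply] at this
  exact sub_eq_zero.mp this

end MvPolynomial

namespace WeylAlgebra

/-- The action of the generators on polynomials: those with negative index multiply by a variable,
the others act by derivatives and constants. -/
noncomputable def polyOp (χ : Bool → ℕ → ℂ) (s : Bool) :
    ℤ → Module.End ℂ (MvPolynomial (Bool × ℕ) ℂ)
  | Int.ofNat k => (commCoeff s (!s) : ℂ) • (MvPolynomial.pderiv (!s, k)).toLinearMap + χ s k • 1
  | Int.negSucc k => LinearMap.mulLeft ℂ (MvPolynomial.X (s, k))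

theorem polyOp_ofNat_apply (χ : Bool → ℕ → ℂ) (s : Bool) (k : ℕ)
    (p : MvPolynomial (Bool × ℕ) ℂ) : polyOp χ s (Int.ofNat k) p
      = (commCoeff s (!s) : ℂ) • MvPolynomial.pderiv (!s, k) p + χ s k • p := rfl

theorem polyOp_negSucc_apply (χ : Bool → ℕ → ℂ) (s : Bool) (k : ℕ)
    (p : MvPolynomial (Bool × ℕ) ℂ) :
    polyOp χ s (Int.negSucc k) p = MvPolynomial.X (s, k) * p := rfl

theorem polyOp_ofNat_mul_negSucc (χ : Bool → ℕ → ℂ) (s t : Bool) (k j : ℕ)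
    (p : MvPolynomial (Bool × ℕ) ℂ) :
    polyOp χ s (Int.ofNat k) (polyOp χ t (Int.negSucc j) p)
      - polyOp χ t (Int.negSucc j) (polyOp χ s (Int.ofNat k) p)
      = if k = j then (commCoeff s t : ℂ) • p else 0 := by
  classical
  rw [polyOp_negSucc_apply, polyOp_ofNat_apply, polyOp_ofNat_apply, polyOp_negSucc_apply,
    MvPolynomial.pderiv_mul, MvPolynomial.pderiv_X, mul_add, mul_smul_comm, mul_smul_comm]
  by_cases hk : k = j
  · subst hk
    rw [if_pos rfl]
    cases s <;> cases t <;> simp [commCoeff]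
  · rw [if_neg hk, Pi.single_apply, if_neg (fun h => hk (Prod.ext_iff.mp h).2.symm)]
    simp

theorem polyOp_mul_sub (χ : Bool → ℕ → ℂ) (s t : Bool) (m n : ℤ) :
    polyOp χ s m * polyOp χ t n - polyOp χ t n * polyOp χ s m
      = if m + n = -1 then (commCoeff s t : Module.End ℂ (MvPolynomial (Bool × ℕ) ℂ)) else 0 := by
  refine LinearMap.ext fun p => ?_
  rw [LinearMap.sub_apply, Module.End.mul_apply, Module.End.mul_apply]
  have hc : ∀ c : ℤ, (c : Module.End ℂ (MvPolynomial (Bool × ℕ) ℂ)) p = (c : ℂ) • p := fun c => by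
    rw [Int.cast_smul_eq_zsmul]
    exact Int.cast_smul_eq_zsmul (Module.End ℂ (MvPolynomial (Bool × ℕ) ℂ)) c p
  rcases m with k | k <;> rcases n with j | j
  · rw [if_neg (by simp only [Int.ofNat_eq_natCast]; omega), polyOp_ofNat_apply, polyOp_ofNat_apply,
      polyOp_ofNat_apply, polyOp_ofNat_apply, map_add, map_add, Derivation.map_smul,
      Derivation.map_smul, Derivation.map_smul, Derivation.map_smul, MvPolynomial.pderiv_comm]
    simp only [LinearMap.zero_apply]
    module
  · rw [polyOp_ofNat_mul_negSucc]
    by_cases h : k = j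
    · rw [if_pos h, if_pos (by simp only [Int.ofNat_eq_natCast]; omega), hc]
    · rw [if_neg h, if_neg (by simp only [Int.ofNat_eq_natCast]; omega), LinearMap.zero_apply]
  · rw [← neg_sub, polyOp_ofNat_mul_negSucc]
    by_cases h : j = k
    · rw [if_pos h, if_pos (by simp only [Int.ofNat_eq_natCast]; omega), hc, ← neg_smul]
      congr 1
      cases s <;> cases t <;> simp [commCoeff]
    · rw [if_neg h, if_neg (by simp only [Int.ofNat_eq_natCast]; omega), LinearMap.zero_apply, neg_zero]
  · rw [if_neg (by omega), polyOp_negSucc_apply, polyOp_negSucc_apply, polyOp_negSucc_apply,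
      polyOp_negSucc_apply, LinearMap.zero_apply]
    ring

/-- The representation of the Weyl algebra on polynomials. -/
noncomputable def polyRep (χ : Bool → ℕ → ℂ) :
    WeylAlgebra →ₐ[ℂ] Module.End ℂ (MvPolynomial (Bool × ℕ) ℂ) :=
  lift (polyOp χ) (polyOp_mul_sub χ)

theorem polyRep_sub_apply_one (χ : Bool → ℕ → ℂ) (s : Bool) (k : ℕ) :
    polyRep χ (mode s k - algebraMap ℂ WeylAlgebra (χ s k)) 1 = 0 := by
  rw [map_sub, polyRep, lift_mode, AlgHom.commutes, LinearMap.sub_apply,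
    Module.algebraMap_end_apply]
  change polyOp χ s (Int.ofNat k) 1 - _ = 0
  rw [polyOp_ofNat_apply, MvPolynomial.pderiv_one]
  simp

/-- In the polynomial representation the constant `1` is a Whittaker vector for `χ`. The ideal kills
it and the unit does not. -/
theorem one_notMem_of_span {χ : Bool → ℕ → ℂ} {I : Submodule WeylAlgebra WeylAlgebra}
    (hI : I ≤ Submodule.span WeylAlgebra
      {x | ∃ s k, x = mode s (k : ℕ) - algebraMap ℂ WeylAlgebra (χ s k)}) :
    (1 : WeylAlgebra) ∉ I := by
  intro h
  have key : ∀ x ∈ Submodule.span WeylAlgebra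
      {x | ∃ s k, x = mode s (k : ℕ) - algebraMap ℂ WeylAlgebra (χ s k)}, polyRep χ x 1 = 0 := by
    intro x hx
    induction hx using Submodule.span_induction with
    | mem x hx =>
      obtain ⟨s, k, rfl⟩ := hx
      exact polyRep_sub_apply_one χ s k
    | zero => rw [map_zero]; rfl
    | add x y _ _ hx hy => rw [map_add, LinearMap.add_apply, hx, hy, add_zero]
    | smul c x _ hx => rw [smul_eq_mul, map_mul, Module.End.mul_apply, hx, map_zero]
  have := key 1 (hI h)
  rw [map_one (polyRep χ), Module.End.one_apply] at this
  exact one_ne_zero this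

theorem creation_comm (i j : Bool × ℕ) :
    mode i.1 (Int.negSucc i.2) * mode j.1 (Int.negSucc j.2)
      = mode j.1 (Int.negSucc j.2) * mode i.1 (Int.negSucc i.2) := by
  rw [← sub_eq_zero, mode_mul_sub, if_neg (by omega)]

/-- The generators with negative index generate a commutative algebra, which is a quotient of a
polynomial algebra. -/
theorem exists_creationHom : ∃ f : MvPolynomial (Bool × ℕ) ℂ →ₐ[ℂ] WeylAlgebra,
    ∀ i, f (MvPolynomial.X i) = mode i.1 (Int.negSucc i.2) := by
  let S := Algebra.adjoin ℂ (Set.range fun i : Bool × ℕ => mode i.1 (Int.negSucc i.2))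
  have : IsMulCommutative S := Algebra.isMulCommutative_adjoin ℂ (by
    rintro _ ⟨i, rfl⟩ _ ⟨j, rfl⟩
    exact creation_comm i j)
  let _ : CommRing S := { (inferInstance : Ring S) with mul_comm := this.is_comm.comm }
  let g : MvPolynomial (Bool × ℕ) ℂ →ₐ[ℂ] S :=
    MvPolynomial.aeval (S₁ := S) fun i => ⟨mode i.1 (Int.negSucc i.2), Algebra.subset_adjoin ⟨i, rfl⟩⟩
  refine ⟨S.val.comp g, fun i => ?_⟩
  change S.val (g (MvPolynomial.X i)) = _
  rw [MvPolynomial.aeval_X]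
  rfl

/-- The embedding of the polynomials in the generators with negative index. -/
noncomputable def creationHom : MvPolynomial (Bool × ℕ) ℂ →ₐ[ℂ] WeylAlgebra :=
  exists_creationHom.choose

theorem creationHom_X (i : Bool × ℕ) :
    creationHom (MvPolynomial.X i) = mode i.1 (Int.negSucc i.2) :=
  exists_creationHom.choose_spec i

/-- Commutation with a generator of nonnegative index is a derivation, fixed by its values on the
variables. -/
theorem mode_mul_creationHom (s : Bool) (k : ℕ) (p : MvPolynomial (Bool × ℕ) ℂ) :
    mode s k * creationHom p = creationHom p * mode s k
      + (commCoeff s (!s) : ℂ) • creationHom (MvPolynomial.pderiv (!s, k) p) := by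
  classical
  induction p using MvPolynomial.induction_on with
  | C c =>
    rw [MvPolynomial.pderiv_C, map_zero, smul_zero, add_zero, ← MvPolynomial.algebraMap_eq,
      AlgHom.commutes, Algebra.commutes]
  | add p q hp hq =>
    rw [map_add, map_add, map_add, mul_add, add_mul, hp, hq, smul_add]
    abel
  | mul_X p i hp =>
    have h : mode s k * mode i.1 (Int.negSucc i.2) = mode i.1 (Int.negSucc i.2) * mode s k
        + (commCoeff s (!s) : ℂ) • creationHom (MvPolynomial.pderiv (!s, k) (MvPolynomial.X i)) := by
      rw [← sub_eq_iff_eq_add', mode_mul_sub, MvPolynomial.pderiv_X]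
      obtain ⟨t, j⟩ := i
      by_cases hk : k = j
      · subst hk
        rw [if_pos (by simp only; omega), Pi.single_apply]
        cases s <;> cases t <;> simp [commCoeff]
      · rw [if_neg (by simp only; omega), Pi.single_apply,
          if_neg (fun h => hk (Prod.ext_iff.mp h).2.symm)]
        simp
    rw [map_mul, creationHom_X, ← mul_assoc, hp, add_mul, mul_assoc (creationHom p), h, mul_add,
      ← mul_assoc, MvPolynomial.pderiv_mul, map_add, map_mul, map_mul, creationHom_X, smul_add,
      mul_smul_comm, smul_mul_assoc]
    abel

/-! ### Cyclic modules generated by a Whittaker vector -/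

section Cyclic

variable {χ : Bool → ℕ → ℂ} {I : Submodule WeylAlgebra WeylAlgebra}

theorem mode_smul_mk_one (hI : ∀ s k, mode s (k : ℕ) - algebraMap ℂ WeylAlgebra (χ s k) ∈ I)
    (s : Bool) (k : ℕ) : mode s k • (Submodule.Quotient.mk 1 : WeylAlgebra ⧸ I)
      = χ s k • (Submodule.Quotient.mk 1 : WeylAlgebra ⧸ I) := by
  rw [← algebraMap_smul WeylAlgebra (χ s k), ← sub_eq_zero, ← sub_smul,
    ← Submodule.Quotient.mk_smul, smul_eq_mul, mul_one, Submodule.Quotient.mk_eq_zero]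
  exact hI s k

theorem mode_smul_creationHom_smul_mk_one
    (hI : ∀ s k, mode s (k : ℕ) - algebraMap ℂ WeylAlgebra (χ s k) ∈ I) (s : Bool) (k : ℕ)
    (p : MvPolynomial (Bool × ℕ) ℂ) :
    mode s k • creationHom p • (Submodule.Quotient.mk 1 : WeylAlgebra ⧸ I)
      = χ s k • creationHom p • (Submodule.Quotient.mk 1 : WeylAlgebra ⧸ I)
        + (commCoeff s (!s) : ℂ) • creationHom (MvPolynomial.pderiv (!s, k) p)
          • (Submodule.Quotient.mk 1 : WeylAlgebra ⧸ I) := by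
  rw [smul_smul, mode_mul_creationHom, add_smul, mul_smul, mode_smul_mk_one hI, smul_assoc,
    smul_comm (creationHom p) (χ s k)]

/-- The vectors obtained from the generator by polynomials in the generators with negative index. -/
noncomputable def creationMap (I : Submodule WeylAlgebra WeylAlgebra) :
    MvPolynomial (Bool × ℕ) ℂ →ₗ[ℂ] WeylAlgebra ⧸ I where
  toFun p := creationHom p • (Submodule.Quotient.mk 1 : WeylAlgebra ⧸ I)
  map_add' p q := by rw [map_add, add_smul]
  map_smul' c p := by rw [map_smul, smul_assoc]; rfl

/-- Surjectivity suffices for simplicity: submodules are pulled back to polynomials, and injectivity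
plays no role. -/
theorem creationMap_surjective
    (hI : ∀ s k, mode s (k : ℕ) - algebraMap ℂ WeylAlgebra (χ s k) ∈ I) :
    LinearMap.range (creationMap I) = ⊤ := by
  apply eq_top_of_mode_smul_mem
  · refine ⟨1, ?_⟩
    change creationHom 1 • (Submodule.Quotient.mk 1 : WeylAlgebra ⧸ I) = _
    rw [map_one, one_smul]
  · rintro s n _ ⟨p, rfl⟩
    rcases n with k | k
    · refine ⟨χ s k • p + (commCoeff s (!s) : ℂ) • MvPolynomial.pderiv (!s, k) p, ?_⟩
      rw [map_add, map_smul, map_smul]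
      exact (mode_smul_creationHom_smul_mk_one hI s k p).symm
    · refine ⟨MvPolynomial.X (s, k) * p, ?_⟩
      change creationHom (MvPolynomial.X (s, k) * p) • (Submodule.Quotient.mk 1 : WeylAlgebra ⧸ I) = _
      rw [map_mul, creationHom_X, mul_smul]
      rfl

/-- Whittaker modules over the Weyl algebra are simple. -/
theorem eq_bot_or_eq_top_of_mode_smul_mem
    (hI : ∀ s k, mode s (k : ℕ) - algebraMap ℂ WeylAlgebra (χ s k) ∈ I)
    (U : Submodule ℂ (WeylAlgebra ⧸ I)) (hU : ∀ s n, ∀ w ∈ U, mode s n • w ∈ U) :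
    U = ⊥ ∨ U = ⊤ := by
  rw [or_iff_not_imp_left]
  intro hbot
  obtain ⟨w, hw, hw0⟩ := U.ne_bot_iff.mp hbot
  obtain ⟨p, rfl⟩ : w ∈ LinearMap.range (creationMap I) :=
    creationMap_surjective hI ▸ Submodule.mem_top
  have hp0 : p ≠ 0 := fun h => hw0 (by rw [h, map_zero])
  -- A generator of nonnegative index minus its eigenvalue acts on polynomials as a partial
  -- derivative up to sign, so the pullback of `U` is stable under differentiation.
  have h1 : (1 : MvPolynomial (Bool × ℕ) ℂ) ∈ U.comap (creationMap I) := by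
    refine MvPolynomial.one_mem_of_pderiv_mem ?_ p.totalDegree p hw hp0 le_rfl
    rintro ⟨s, k⟩ q hq
    have h₁ := U.sub_mem (hU (!s) k _ hq) (U.smul_mem (χ (!s) k) hq)
    change mode (!s) k • creationHom q • (Submodule.Quotient.mk 1 : WeylAlgebra ⧸ I)
      - χ (!s) k • creationHom q • (Submodule.Quotient.mk 1 : WeylAlgebra ⧸ I) ∈ U at h₁
    rw [mode_smul_creationHom_smul_mk_one hI, add_sub_cancel_left, Bool.not_not] at h₁
    refine (U.smul_mem_iff ?_).mp h₁
    cases s <;> simp [commCoeff]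
  refine eq_top_of_mode_smul_mem U ?_ hU
  have h₂ : creationHom 1 • (Submodule.Quotient.mk 1 : WeylAlgebra ⧸ I) ∈ U := h1
  rwa [map_one, one_smul] at h₂

/-- The commutator of `mode s m - c` with a generator is a scalar, so one further power absorbs it.
-/
theorem pow_sub_apply_mode_smul {W : Type*} [AddCommGroup W] [Module ℂ W] [Module WeylAlgebra W]
    [IsScalarTower ℂ WeylAlgebra W] (s t : Bool) (m n : ℤ) (c : ℂ) (k : ℕ) : ∀ w : W,
    ((Algebra.lsmul ℂ ℂ W (mode s m) - algebraMap ℂ _ c) ^ k) w = 0 →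
      ((Algebra.lsmul ℂ ℂ W (mode s m) - algebraMap ℂ _ c) ^ (k + 1)) (mode t n • w) = 0 := by
  set D : Module.End ℂ W := Algebra.lsmul ℂ ℂ W (mode s m) - algebraMap ℂ _ c with hD
  have hDapp : ∀ w, D w = mode s m • w - c • w := fun w => rfl
  have hcomm : ∀ w, D (mode t n • w)
      = mode t n • D w + if m + n = -1 then commCoeff s t • w else 0 := by
    intro w
    rw [hDapp, hDapp, smul_sub, ← mode_smul_sub, smul_comm (mode t n) c w]
    abel
  induction k with
  | zero =>
    intro w hw
    have : w = 0 := hw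
    rw [this, smul_zero, map_zero]
  | succ k ih =>
    intro w hw
    rw [pow_succ, Module.End.mul_apply, hcomm, map_add, ih (D w)]
    · split_ifs
      · rw [map_zsmul, hw, smul_zero, add_zero]
      · rw [map_zero, add_zero]
    · rw [← Module.End.mul_apply, ← pow_succ, hw]

theorem exists_pow_sub_apply_eq_zero
    (hI : ∀ s k, mode s (k : ℕ) - algebraMap ℂ WeylAlgebra (χ s k) ∈ I) (s : Bool) (k : ℕ)
    (w : WeylAlgebra ⧸ I) :
    ∃ m : ℕ, ((Algebra.lsmul ℂ ℂ (WeylAlgebra ⧸ I) (mode s k) - algebraMap ℂ _ (χ s k)) ^ m) w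
      = 0 := by
  let S : Submodule ℂ (WeylAlgebra ⧸ I) :=
    { carrier := {w | ∃ m : ℕ, ((Algebra.lsmul ℂ ℂ (WeylAlgebra ⧸ I) (mode s k)
        - algebraMap ℂ _ (χ s k)) ^ m) w = 0}
      add_mem' := by
        rintro x y ⟨m, hm⟩ ⟨m', hm'⟩
        refine ⟨m + m', ?_⟩
        rw [map_add]
        nth_rw 1 [add_comm m m']
        rw [pow_add, pow_add, Module.End.mul_apply, Module.End.mul_apply, hm, hm', map_zero,
          map_zero, add_zero]
      zero_mem' := ⟨0, map_zero _⟩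
      smul_mem' := by
        rintro c x ⟨m, hm⟩
        exact ⟨m, by rw [map_smul, hm, smul_zero]⟩ }
  have hS : S = ⊤ := by
    apply eq_top_of_mode_smul_mem
    · refine ⟨1, ?_⟩
      rw [pow_one]
      change mode s k • (Submodule.Quotient.mk 1 : WeylAlgebra ⧸ I) - χ s k • (Submodule.Quotient.mk 1 : WeylAlgebra ⧸ I) = 0
      rw [mode_smul_mk_one hI, sub_self]
    · rintro t n w ⟨m, hm⟩
      exact ⟨m + 1, pow_sub_apply_mode_smul s t k n (χ s k) m w hm⟩
  have : w ∈ S := hS ▸ Submodule.mem_top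
  exact this

/-- A subspace of a Whittaker module that is stable under the modes of all vectors fixed by
`scale t`, for a root of unity `t`, is trivial. -/
theorem eq_bot_or_eq_top_of_fixed_modes_mem
    (hI : ∀ s k, mode s (k : ℕ) - algebraMap ℂ WeylAlgebra (χ s k) ∈ I) {s : Bool} {k : ℕ}
    (hχ : χ s k ≠ 0) {A : VertexAlgebra WeylModule} (hA : IsWeylVertexAlgebra A)
    {N : A.WeakModule (WeylAlgebra ⧸ I)} (hN : IsInducedByWeylAction N) {t : ℂˣ} {p : ℕ}
    (hp : 1 ≤ p) (ht : (t : ℂ) ^ p = 1) (U : Submodule ℂ (WeylAlgebra ⧸ I))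
    (hU : ∀ v, WeylModule.scale t v = v → ∀ n, ∀ w ∈ U, N.Y v n w ∈ U) : U = ⊥ ∨ U = ⊤ := by
  set T : Module.End ℂ (WeylAlgebra ⧸ I) := Algebra.lsmul ℂ ℂ (WeylAlgebra ⧸ I) (mode s k) with hT
  have hTpow : ∀ (j : ℕ) (w : WeylAlgebra ⧸ I), (T ^ j) w = mode s k ^ j • w := by
    intro j w
    rw [hT, ← map_pow]
    rfl
  have hfac : ∀ s', scaleFactor t s' ^ p = 1 := by
    intro s'
    cases s'
    · change ((t : ℂ)⁻¹) ^ p = 1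
      rw [inv_pow, ht, inv_one]
    · exact ht
  have hnil := exists_pow_sub_apply_eq_zero hI s k
  -- `T^p` has weight `1` because `t^p = 1`, so it preserves `U`.
  have hTU : ∀ w ∈ U, T w ∈ U := fun w hw => by
    refine apply_mem_of_pow_apply_mem hχ hp hnil (fun w hw => ?_) hw
    have := mode_pow_smul_mem_eigenSpan hA hN t w s k p
    rw [hfac] at this
    rw [hTpow]
    exact eigenSpan_one_le hU hw this
  have hsurj : ∀ j : ℕ, ∀ w ∈ U, ∃ w' ∈ U, mode s k ^ j • w' = w := by
    intro j
    induction j with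
    | zero => exact fun w hw => ⟨w, hw, by rw [pow_zero, one_smul]⟩
    | succ j ih =>
      intro w hw
      obtain ⟨w', hw', h⟩ := exists_apply_eq_of_locally_unipotent hχ hnil hTU hw
      obtain ⟨w'', hw'', h'⟩ := ih w' hw'
      refine ⟨w'', hw'', ?_⟩
      rw [pow_succ', mul_smul, h']
      exact h
  refine eq_bot_or_eq_top_of_mode_smul_mem hI U fun s' n w hw => ?_
  -- Writing `w = T^j w'` with `w' ∈ U` supplies the factors that bring the weight of the generator
  -- to `1`. A generator of the same kind as `T` needs `j = p - 1`, one of the other kind, with the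
  -- inverse weight, needs `j = 1`.
  have key : ∀ j : ℕ, scaleFactor t s' * scaleFactor t s ^ j = 1 → mode s' n • w ∈ U := by
    intro j hj
    obtain ⟨w', hw', rfl⟩ := hsurj j w hw
    have := mode_smul_mem_eigenSpan hA hN t s' n (mode_pow_smul_mem_eigenSpan hA hN t w' s k j)
    rw [hj] at this
    exact eigenSpan_one_le hU hw' this
  by_cases hs : s' = s
  · subst hs
    refine key (p - 1) ?_
    rw [← pow_succ', Nat.sub_add_cancel hp, hfac]
  · refine key 1 ?_
    rw [pow_one]
    cases s <;> cases s' <;> simp_all [scaleFactor]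

end Cyclic

/-! ### The Whittaker modules `M_1(λ, μ)` -/

section Whittaker

variable {n : ℕ} (lam : Fin (n + 1) → ℂ) (mu : Fin n → ℂ)

/-- The eigenvalues of the generators with nonnegative index on the Whittaker vector. -/
def whittakerChar : Bool → ℕ → ℂ
  | true, k => if h : k < n + 1 then lam ⟨k, h⟩ else 0
  | false, k => if h : k < n then mu ⟨k, h⟩ else 0

theorem mode_sub_mem_whittakerIdeal (s : Bool) (k : ℕ) :
    mode s k - algebraMap ℂ WeylAlgebra (whittakerChar lam mu s k) ∈ whittakerIdeal lam mu := by
  apply Submodule.subset_span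
  cases s
  · by_cases h : k < n
    · refine Or.inl (Or.inr ⟨⟨k, h⟩, ?_⟩)
      rw [whittakerChar, dif_pos h, mode]
    · refine Or.inr ⟨k + 1, by omega, Or.inr ?_⟩
      rw [whittakerChar, dif_neg h, map_zero, sub_zero, mode]
  · by_cases h : k < n + 1
    · refine Or.inl (Or.inl ⟨⟨k, h⟩, ?_⟩)
      rw [whittakerChar, dif_pos h, mode]
    · refine Or.inr ⟨k, by omega, Or.inl ?_⟩
      rw [whittakerChar, dif_neg h, map_zero, sub_zero, mode]

/-- Serves to show that the module is nonzero, through `one_notMem_of_span`. -/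
theorem whittakerIdeal_le_span : whittakerIdeal lam mu ≤ Submodule.span WeylAlgebra
    {x | ∃ s k, x = mode s (k : ℕ) - algebraMap ℂ WeylAlgebra (whittakerChar lam mu s k)} := by
  refine Submodule.span_mono ?_
  rintro x ((⟨k, rfl⟩ | ⟨k, rfl⟩) | ⟨k, hk, rfl | rfl⟩)
  · exact ⟨true, k, by rw [whittakerChar, dif_pos k.2, mode]⟩
  · exact ⟨false, k, by rw [whittakerChar, dif_pos k.2, mode]⟩
  · obtain ⟨j, rfl⟩ := Int.eq_ofNat_of_zero_le (show 0 ≤ k by omega)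
    exact ⟨true, j, by rw [whittakerChar, dif_neg (by omega), map_zero, sub_zero, mode]⟩
  · obtain ⟨j, hj⟩ := Int.eq_ofNat_of_zero_le (show 0 ≤ k - 1 by omega)
    obtain rfl : k = j + 1 := by omega
    exact ⟨false, j, by rw [whittakerChar, dif_neg (by omega), map_zero, sub_zero, mode]⟩

theorem isRestricted_whittakerModule : IsRestricted (WhittakerModule lam mu) := by
  apply isRestricted_quotient
  intro s
  refine ⟨n + 1, fun k hk => Submodule.subset_span (Or.inr ?_)⟩
  cases s
  · exact ⟨k + 1, by omega, Or.inr rfl⟩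
  · exact ⟨k, by omega, Or.inl rfl⟩

theorem nontrivial_whittakerModule : Nontrivial (WhittakerModule lam mu) := by
  refine ⟨⟨Submodule.Quotient.mk 1, 0, fun h => ?_⟩⟩
  rw [Submodule.Quotient.mk_eq_zero] at h
  exact one_notMem_of_span (whittakerIdeal_le_span lam mu) h

theorem exists_whittakerChar_ne_zero (h : (lam, mu) ≠ 0) :
    ∃ s k, whittakerChar lam mu s k ≠ 0 := by
  by_contra! hc
  apply h
  rw [Prod.mk_eq_zero]
  constructor
  · funext k
    have := hc true k
    rwa [whittakerChar, dif_pos k.2] at this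
  · funext k
    have := hc false k
    rwa [whittakerChar, dif_pos k.2] at this

theorem zeta_pow {p : ℕ} (hp : 1 ≤ p) : (WeylModule.zeta p : ℂ) ^ p = 1 := by
  have hp0 : (p : ℂ) ≠ 0 := Nat.cast_ne_zero.mpr (by omega)
  change Complex.exp (2 * Real.pi * Complex.I / p) ^ p = 1
  rw [← Complex.exp_nat_mul, mul_div_cancel₀ _ hp0, Complex.exp_two_pi_mul_I]

/-- The stabilizer of `v` is a subgroup, so it contains the cyclic group once it contains `g_p`. -/
theorem mem_orbifold_of_g_apply {A : VertexAlgebra WeylModule} {p : ℕ}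
    (hg : Subgroup.zpowers (WeylModule.g p) ≤ A.aut WeylModule.omega) {v : WeylModule}
    (hv : WeylModule.g p v = v) :
    v ∈ (A.orbifold WeylModule.omega (Subgroup.zpowers (WeylModule.g p)) hg).toSubmodule := by
  intro h hh
  have hle : Subgroup.zpowers (WeylModule.g p)
      ≤ MulAction.stabilizer (WeylModule ≃ₗ[ℂ] WeylModule) v :=
    Subgroup.zpowers_le.mpr hv
  exact hle hh

end Whittaker

end WeylAlgebra

/-! ### The irreducibility theorem -/

theorem theorem9p3 (n : ℕ) (lam : Fin (n + 1) → ℂ) (mu : Fin n → ℂ) (hΛ : (lam, mu) ≠ 0)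
    (p : ℕ) (hp : 1 ≤ p) :
    -- the Weyl vertex algebra structure on `M` exists and is unique
    (∃! A : VertexAlgebra WeylModule, IsWeylVertexAlgebra A) ∧
    ∀ A : VertexAlgebra WeylModule, IsWeylVertexAlgebra A →
      -- `⟨g_p⟩` is a group of automorphisms of `(M, ω)`
      ∃ hg : Subgroup.zpowers (WeylModule.g p) ≤ A.aut WeylModule.omega,
        -- the weak `M`-module structure on `M_1(λ, μ)` exists and is unique
        (∃! N : A.WeakModule (WhittakerModule lam mu), IsInducedByWeylAction N) ∧
        -- its restriction to the orbifold `M^⟨g_p⟩` is irreducible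
        ∀ N : A.WeakModule (WhittakerModule lam mu), IsInducedByWeylAction N →
          (N.restrict (A.orbifold WeylModule.omega (Subgroup.zpowers (WeylModule.g p)) hg)).IsIrreducible := by
  open WeylAlgebra in
  refine ⟨⟨weylVertexAlgebra, isWeylVertexAlgebra_weylVertexAlgebra,
    fun A hA => eq_weylVertexAlgebra hA⟩, fun A hA => ⟨zpowers_g_le_aut hA p, ?_, ?_⟩⟩
  · obtain rfl := eq_weylVertexAlgebra hA
    exact ⟨weylWeakModule (isRestricted_whittakerModule lam mu),
      isInducedByWeylAction_weylWeakModule _, fun N hN =>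
        weakModule_ext hA hN (isInducedByWeylAction_weylWeakModule _)⟩
  · intro N hN
    obtain ⟨s, k, hχ⟩ := exists_whittakerChar_ne_zero lam mu hΛ
    refine ⟨nontrivial_whittakerModule lam mu, fun U hU => ?_⟩
    refine eq_bot_or_eq_top_of_fixed_modes_mem (mode_sub_mem_whittakerIdeal lam mu) hχ hA hN hp
      (zeta_pow hp) U fun v hv m w hw => ?_
    exact hU ⟨v, mem_orbifold_of_g_apply _ hv⟩ m w hw
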